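/- **Setting.** Write $[m]=\{1,\dots,m\}$. Identify $SO(2)$ with the circle $S^1=\mathbb R/2\pi\mathbb Z$, with the normalized measure $\int_{S^1}(\cdots)\,d\alpha=\frac1{2\pi}\int_0^{2\pi}(\cdots)\,d\alpha$, and let $\Theta_t$ be the linear rotation of $\mathbb R^2$ by the angle $t$. *Bases.* Let $\{\varphi_m\}_{m\in\mathbb Z}$ be the real Fourier basis of $L^2(S^1)$: $\varphi_0=1$, $\varphi_m(\beta)=\sqrt2\cos(m\beta)$ for $m>0$, $\varphi_m(\beta)=\sqrt2\sin(|m|\beta)$ for $m<0$. Let $\{\psi_k\}_k$ be the real Fourier–Bessel basis of the unit disk: the index is a pair $k=(n,R)$ with $n\in\mathbb Z$ and $R>0$ a zero of the Bessel function $J_{|n|}$, and $\psi_k(r,\theta)=c_kJ_{|n|}(Rr)\varphi_n(\theta)$ for $r\le1$, $\psi_k=0$ for $r>1$, where $c_k>0$ is such that $\int\psi_k^2=\pi$. Let $\mu_k=R^2$ be the corresponding Dirichlet Laplacian eigenvalue of the unit disk. For $j\in\mathbb R$ put $\psi_{j,k}(v)=2^{-2j}\psi_k(2^{-j}v)$.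 *Network.* A RotDCF net has channel numbers $M_0,M_1,\dots\ge1$, an activation $\sigma:\mathbb R\to\mathbb R$, scales $j_l\in\mathbb R$, biases $b^{(l)}(\lambda)\in\mathbb R$ and real coefficients $a^{(l)}_{\lambda',\lambda}$ ($l\ge1$, $\lambda'\in[M_{l-1}]$, $\lambda\in[M_l]$), which give the filters $$W^{(1)}_{\lambda',\lambda}(v)=\sum_k a^{(1)}_{\lambda',\lambda}(k)\,\psi_{j_1,k}(v),\qquad W^{(l)}_{\lambda',\lambda}(v,\beta)=\sum_{k,m}a^{(l)}_{\lambda',\lambda}(k,m)\,\psi_{j_l,k}(v)\,\varphi_m(\beta)\quad(l>1),$$ the sums being finite or, more generally, convergent in $L^2$. From an input $x^{(0)}(u,\lambda)$, $u\in\mathbb R^2$, $\lambda\in[M_0]$, the layers $x^{(l)}=x^{(l)}[x^{(0)}]$ are $$x^{(1)}(u,\alpha,\lambda)=\sigma\Big(\sum_{\lambda'}\int_{\mathbb R^2}x^{(0)}(u+v',\lambda')W^{(1)}_{\lambda',\lambda}(\Theta_\alpha v')\,dv'+b^{(1)}(\lambda)\Big),$$ $$x^{(l)}(u,\alpha,\lambda)=\sigma\Big(\sum_{\lambda'}\int_{S^1}\int_{\mathbb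 R^2}x^{(l-1)}(u+v',\alpha',\lambda')W^{(l)}_{\lambda',\lambda}(\Theta_\alpha v',\alpha'-\alpha)\,dv'\,d\alpha'+b^{(l)}(\lambda)\Big),\quad l>1.$$ *Norms.* Fix $\Omega\subset\mathbb R^2$ with $0<|\Omega|<\infty$ and put $\|x^{(0)}\|^2=\frac1{M_0}\sum_\lambda\frac1{|\Omega|}\int_{\mathbb R^2}x^{(0)}(u,\lambda)^2\,du$ and, for $l\ge1$, $\|x^{(l)}\|^2=\frac1{M_l}\sum_\lambda\frac1{|\Omega|}\int_{\mathbb R^2}\int_{S^1}x^{(l)}(u,\alpha,\lambda)^2\,d\alpha\,du$. Let $\|a^{(1)}_{\lambda',\lambda}\|_{FB}^2=\sum_k\mu_k\,a^{(1)}_{\lambda',\lambda}(k)^2$, $\|a^{(l)}_{\lambda',\lambda}\|_{FB}^2=\sum_{k,m}\mu_k\,a^{(l)}_{\lambda',\lambda}(k,m)^2$ for $l>1$, and $$A_l=\pi\max\Big\{\sup_\lambda\sum_{\lambda'=1}^{M_{l-1}}\|a^{(l)}_{\lambda',\lambda}\|_{FB},\ \sup_{\lambda'}\frac{M_{l-1}}{M_l}\sum_{\lambda=1}^{M_l}\|a^{(l)}_{\lambda',\lambda}\|_{FB}\Big\}.$$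 *Transformations.* For $\tau:\mathbb R^2\to\mathbb R^2$ of class $C^2$ let $D_\tau x^{(0)}(u,\lambda)=x^{(0)}(u-\tau(u),\lambda)$, $|\tau|_\infty=\sup_u|\tau(u)|\in[0,\infty]$, and $|\nabla\tau|_\infty=\sup_u\|\nabla\tau(u)\|$ (operator norm). For $u_0\in\mathbb R^2$ and $t\in S^1$ let $\rho u=\rho_{u_0,t}u=u_0+\Theta_t(u-u_0)$, $D_\rho x^{(0)}(u,\lambda)=x^{(0)}(\rho u,\lambda)$ and $T_\rho x^{(l)}(u,\alpha,\lambda)=x^{(l)}(\rho u,\alpha-t,\lambda)$. **Theorem.** Let $L\ge1$ and assume - (A1) $\sigma$ is non-expansive: $|\sigma(s)-\sigma(s')|\le|s-s'|$ for all $s,s'\in\mathbb R$; - (A2) $A_l\le1$ for $1\le l\le L$; - (A3) $|\nabla\tau|_\infty<\frac15$. Then for every rotation $\rho=\rho_{u_0,t}$ and every input $x^{(0)}$ whose channels are in $L^2(\mathbb R^2)$, $$\big\|x^{(L)}[D_\rho\circ D_\tau x^{(0)}]-T_\rho x^{(L)}[x^{(0)}]\big\|\le\big(2c_1L\,|\nabla\tau|_\infty+c_2\,2^{-j_L}|\tau|_\infty\big)\|x^{(0)}\|,\qquad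 c_1=4,\ c_2=2$$ (both sides in $[0,\infty]$, with $\infty\cdot0=0$). -/

import Mathlib

open MeasureTheory Filter Topology
open scoped Real ENNReal

namespace RotDCF

noncomputable section

instance fact_two_pi_pos : Fact ((0 : ℝ) < 2 * π) := ⟨Real.two_pi_pos⟩

/-- The circle `S¹ = ℝ / 2πℤ ≅ SO(2)`, an element being an angle. -/
abbrev S1 : Type := AddCircle (2 * π)

/-- The normalized measure `dα / 2π` on `S¹`, of total mass one. -/
abbrev dS1 : Measure S1 := AddCircle.haarAddCircle

/- The plane `ℝ²` is `ℂ` with its real structure: `‖·‖` is the Euclidean norm and `volume` is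
the Lebesgue measure. -/

/-- The product of the Lebesgue measure on the plane and the normalized measure on `S¹`. -/
abbrev dPlaneS1 : Measure (ℂ × S1) := (volume : Measure ℂ).prod dS1

/-- The linear rotation `Θ_t` of the plane by the angle `t`. -/
def rot (t : S1) (v : ℂ) : ℂ := (AddCircle.toCircle t : ℂ) * v

/-- The rigid rotation `ρ_{u₀,t}` around the point `u₀` by the angle `t`. -/
def rotAround (u₀ : ℂ) (t : S1) (u : ℂ) : ℂ := u₀ + rot t (u - u₀)

/-! ### Fourier and Fourier-Bessel bases -/

/-- The real Fourier basis of `L²(S¹)`: `1`, `√2 cos (m β)` for `m > 0`, and `√2 sin (|m| β)`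
for `m < 0`. (Mathlib's `fourier m β` is `exp (i m β)`.) -/
def fourierReal (m : ℤ) (β : S1) : ℝ :=
  if m = 0 then 1
  else if 0 < m then √2 * (fourier m β).re
  else √2 * (fourier (-m) β).im

/-- The Bessel function of the first kind `J_n`, for an order `n ∈ ℕ`. -/
def besselJ (n : ℕ) (x : ℝ) : ℝ :=
  ∑' k : ℕ, (-1) ^ k / ((k.factorial : ℝ) * ((n + k).factorial : ℝ)) * (x / 2) ^ (2 * k + n)

/-- Indices of the real Fourier-Bessel basis of the unit disk: an angular frequency `n ∈ ℤ`
(cosine modes for `n ≥ 0`, sine modes for `n < 0`) and a positive zero `R` of `J_{|n|}`. -/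
abbrev FBIndex : Type := {p : ℤ × ℝ // 0 < p.2 ∧ besselJ p.1.natAbs p.2 = 0}

/-- The Dirichlet Laplacian eigenvalue `μ_k = R²` of the unit disk that belongs to the
eigenfunction with index `k = (n, R)`. -/
def FBIndex.mu (k : FBIndex) : ℝ := k.1.2 ^ 2

/-- The Fourier-Bessel function `ψ_k(r, θ) = c_k J_{|n|}(R r) φ_n(θ)` on the unit disk, extended
by zero. The constant `c_k = (2 ∫₀¹ J_{|n|}(R r)² r dr)^{-1/2}` is the one for which the mean
square of `ψ_k` over the unit disk is one, i.e. `∫ ψ_k² = π`. -/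
def psi (k : FBIndex) (v : ℂ) : ℝ :=
  if ‖v‖ ≤ 1 then
    (√(2 * ∫ r in (0 : ℝ)..1, besselJ k.1.1.natAbs (k.1.2 * r) ^ 2 * r))⁻¹
      * besselJ k.1.1.natAbs (k.1.2 * ‖v‖) * fourierReal k.1.1 (v.arg : S1)
  else 0

/-- The rescaled function `ψ_{j,k}(v) = 2^{-2j} ψ_k(2^{-j} v)`, supported on the disk of
radius `2^j`. -/
def psiScaled (j : ℝ) (k : FBIndex) (v : ℂ) : ℝ :=
  (2 : ℝ) ^ (-2 * j) * psi k ((2 : ℝ) ^ (-j) • v)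

/-- The joint basis `ψ_{j,k}(v) φ_m(β)` of functions on `ℝ² × S¹`. -/
def psiJoint (j : ℝ) (q : FBIndex × ℤ) (p : ℂ × S1) : ℝ :=
  psiScaled j q.1 p.1 * fourierReal q.2 p.2

/-- `W = ∑_i a_i e_i`, as an unconditionally convergent sum in `L²(ν)`. If only finitely many
`a_i` are nonzero, this says that `W` is the finite sum, almost everywhere. -/
def IsL2Expansion {X ι : Type*} [MeasurableSpace X] (ν : Measure X) (a : ι → ℝ)
    (e : ι → X → ℝ) (W : X → ℝ) : Prop :=
  MemLp W 2 ν ∧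
    Tendsto (fun s : Finset ι => eLpNorm (fun x => W x - ∑ i ∈ s, a i * e i x) 2 ν) atTop (𝓝 0)

/-- The weighted norm `(∑_k μ_k a(k)²)^{1/2} ∈ [0, ∞]`. -/
def fbNorm (a : FBIndex → ℝ) : ℝ≥0∞ :=
  (∑' k : FBIndex, ENNReal.ofReal (k.mu * a k ^ 2)) ^ (1 / 2 : ℝ)

/-- The weighted norm `(∑_k ∑_m μ_k a(k,m)²)^{1/2} ∈ [0, ∞]`. -/
def fbNormJoint (a : FBIndex × ℤ → ℝ) : ℝ≥0∞ :=
  (∑' k : FBIndex, ∑' m : ℤ, ENNReal.ofReal (k.mu * a (k, m) ^ 2)) ^ (1 / 2 : ℝ)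

/-! ### The network -/

/-- A RotDCF net with channel numbers `M_0, M_1, …`, scales `j_1, j_2, …`, biases, activation
`σ`, and filters given by their Fourier-Bessel coefficients. The first filter lives on `ℝ²`, the
others live on `ℝ² × S¹`. The fields `a n`, `W n` belong to the layer `n + 2`; the values `j 0`
and `b 0` are not used. -/
structure Net where
  /-- The number `M_l` of unstructured channels of layer `l`. -/
  M : ℕ → ℕ
  M_pos : ∀ l, 0 < M l
  /-- The activation. -/
  σ : ℝ → ℝ
  /-- The scale `j_l` of the filters of layer `l`. -/
  j : ℕ → ℝ
  /-- The biases of layer `l`. -/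
  b : (l : ℕ) → Fin (M l) → ℝ
  /-- The coefficients `a^{(1)}_{λ',λ}(k)`. -/
  a₁ : Fin (M 0) → Fin (M 1) → FBIndex → ℝ
  /-- The filters `W^{(1)}_{λ',λ}(v)`. -/
  W₁ : Fin (M 0) → Fin (M 1) → ℂ → ℝ
  W₁_eq : ∀ c' c, IsL2Expansion volume (a₁ c' c) (psiScaled (j 1)) (W₁ c' c)
  /-- The coefficients `a^{(n+2)}_{λ',λ}(k,m)`. -/
  a : (n : ℕ) → Fin (M (n + 1)) → Fin (M (n + 2)) → FBIndex × ℤ → ℝ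
  /-- The filters `W^{(n+2)}_{λ',λ}(v,β)`. -/
  W : (n : ℕ) → Fin (M (n + 1)) → Fin (M (n + 2)) → ℂ × S1 → ℝ
  W_eq : ∀ n c' c, IsL2Expansion dPlaneS1 (a n c' c) (psiJoint (j (n + 2))) (W n c' c)

/-- The first layer, applied to an input `x(u, λ')`. -/
def Net.firstLayer (N : Net) (x : ℂ → Fin (N.M 0) → ℝ) : ℂ → S1 → Fin (N.M 1) → ℝ :=
  fun u α c => N.σ ((∑ c', ∫ v : ℂ, x (u + v) c' * N.W₁ c' c (rot α v)) + N.b 1 c)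

/-- The layer `n + 2`, a joint convolution over `ℝ² × S¹`, applied to `x(u, α, λ')`. -/
def Net.jointLayer (N : Net) (n : ℕ) (x : ℂ → S1 → Fin (N.M (n + 1)) → ℝ) :
    ℂ → S1 → Fin (N.M (n + 2)) → ℝ :=
  fun u α c => N.σ ((∑ c', ∫ p : ℂ × S1,
    x (u + p.1) p.2 c' * N.W n c' c (rot α p.1, p.2 - α) ∂dPlaneS1) + N.b (n + 2) c)

/-- The output `x^{(l)}[x]` of layer `l` from the input `x`. For `l = 0` it is the input, as a
function that does not depend on the angle. -/
def Net.output (N : Net) (x : ℂ → Fin (N.M 0) → ℝ) : (l : ℕ) → ℂ → S1 → Fin (N.M l) → ℝ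
  | 0 => fun u _ c => x u c
  | 1 => N.firstLayer x
  | n + 2 => N.jointLayer n (N.output x (n + 1))

/-- `π max {sup_λ ∑_{λ'} w_{λ',λ}, sup_{λ'} (M'/M) ∑_λ w_{λ',λ}}`, for `λ' ∈ [M']`, `λ ∈ [M]`. -/
def boundOf {M' M : ℕ} (w : Fin M' → Fin M → ℝ≥0∞) : ℝ≥0∞ :=
  ENNReal.ofReal π *
    max (⨆ c, ∑ c', w c' c) (⨆ c', ((M' : ℝ≥0∞) / (M : ℝ≥0∞)) * ∑ c, w c' c)

/-- The quantity `A_l ∈ [0, ∞]` of the layer `l ≥ 1` (there is no layer `0`). -/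
def Net.A (N : Net) : ℕ → ℝ≥0∞
  | 0 => 0
  | 1 => boundOf fun c' c => fbNorm (N.a₁ c' c)
  | n + 2 => boundOf fun c' c => fbNormJoint (N.a n c' c)

/-! ### Norms and transformations -/

/-- The normalized `L²` norm of an input `x(u, λ)`, with values in `[0, ∞]`. -/
def inputNorm (Ω : Set ℂ) {M : ℕ} (x : ℂ → Fin M → ℝ) : ℝ≥0∞ :=
  ((M : ℝ≥0∞)⁻¹ * ∑ c, (volume Ω)⁻¹ * ∫⁻ u, ‖x u c‖ₑ ^ 2) ^ (1 / 2 : ℝ)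

/-- The normalized `L²` norm of a feature map `x(u, α, λ)`, with values in `[0, ∞]`. -/
def featureNorm (Ω : Set ℂ) {M : ℕ} (x : ℂ → S1 → Fin M → ℝ) : ℝ≥0∞ :=
  ((M : ℝ≥0∞)⁻¹ * ∑ c, (volume Ω)⁻¹ * ∫⁻ p : ℂ × S1, ‖x p.1 p.2 c‖ₑ ^ 2 ∂dPlaneS1) ^ (1 / 2 : ℝ)

/-- `D_ρ x(u, λ) = x(ρ u, λ)` for `ρ = ρ_{u₀,t}`. -/
def Drho (u₀ : ℂ) (t : S1) {M : ℕ} (x : ℂ → Fin M → ℝ) : ℂ → Fin M → ℝ :=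
  fun u c => x (rotAround u₀ t u) c

/-- `D_τ x(u, λ) = x(u - τ(u), λ)`. -/
def Dtau (τ : ℂ → ℂ) {M : ℕ} (x : ℂ → Fin M → ℝ) : ℂ → Fin M → ℝ :=
  fun u c => x (u - τ u) c

/-- `T_ρ x(u, α, λ) = x(ρ u, α - t, λ)` for `ρ = ρ_{u₀,t}`. -/
def Trho (u₀ : ℂ) (t : S1) {M : ℕ} (x : ℂ → S1 → Fin M → ℝ) : ℂ → S1 → Fin M → ℝ :=
  fun u α c => x (rotAround u₀ t u) (α - t) c

/-- `|τ|_∞ = sup_u |τ(u)| ∈ [0, ∞]`. -/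
def supNorm (τ : ℂ → ℂ) : ℝ≥0∞ := ⨆ u, ‖τ u‖ₑ

/-- `|∇τ|_∞ = sup_u ‖∇τ(u)‖ ∈ [0, ∞]`, with the operator norm of the real derivative. -/
def supGrad (τ : ℂ → ℂ) : ℝ≥0∞ := ⨆ u, ‖fderiv ℝ τ u‖ₑ

end

end RotDCF

/-!
Green's identity shows that the Fourier-Bessel functions of the disk are orthogonal for the
Dirichlet form as well, with `∫ |∇ψ_k|² = μ_k ∫ ψ_k² = π μ_k`. So a finite expansion with
coefficients `b` has Dirichlet energy `π ∑ μ_k b_k²`, and Cauchy-Schwarz on the supporting disk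
bounds the `L¹` norm of its gradient. Integrating the gradient along segments bounds the `L¹`
norms of its increments under deformations of the plane, and, by translating the filter off its own
support, the `L¹` norm of the filter itself. These bounds survive `L²` limits.

With `A_l ≤ 1`, the Schur test turns `L¹` bounds on filters into `L²` bounds on layers: every layer
is non-expansive, fails to commute with the deformation `u ↦ u - τ u` by at most `8 |∇τ|_∞`, and
its output moves by at most `2 · 2^{-j} |τ|_∞` under that deformation. Summing the commutators over
the layers and adding the displacement of the last output gives the estimate without rotation.
Rotations are exact symmetries of the network and of the norm.
-/

namespace RotDCF

noncomputable section

/-! ### Bessel functions -/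

section Bessel

/-- The coefficients of the Bessel-Clifford function `besselClifford n`. -/
def besselCliffordCoeff (n k : ℕ) : ℝ := 1 / ((k.factorial : ℝ) * ((n + k).factorial : ℝ))

/-- The Bessel-Clifford function `C_n`, the entire function with `J_n(x) = (x/2)^n C_n(-x²/4)`. -/
def besselClifford (n : ℕ) (y : ℝ) : ℝ := ∑' k : ℕ, besselCliffordCoeff n k * y ^ k

variable (n : ℕ)

lemma besselCliffordCoeff_nonneg (k : ℕ) : 0 ≤ besselCliffordCoeff n k := by
  unfold besselCliffordCoeff
  positivity

lemma besselCliffordCoeff_le (k : ℕ) : besselCliffordCoeff n k ≤ 1 / k.factorial := by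
  have : (1 : ℝ) ≤ (n + k).factorial := mod_cast Nat.factorial_pos _
  exact one_div_le_one_div_of_le (by positivity) (le_mul_of_one_le_right (by positivity) this)

lemma besselCliffordCoeff_succ_mul (k : ℕ) :
    besselCliffordCoeff n (k + 1) * (k + 1 : ℕ) = besselCliffordCoeff (n + 1) k := by
  rw [besselCliffordCoeff, besselCliffordCoeff, Nat.factorial_succ, Nat.add_right_comm, add_assoc]
  push_cast
  field_simp

lemma besselCliffordCoeff_succ_eq (k : ℕ) :
    besselCliffordCoeff n (k + 1)
      = (n + 1) * besselCliffordCoeff (n + 1) (k + 1) + besselCliffordCoeff (n + 2) k := by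
  simp only [besselCliffordCoeff, Nat.factorial_succ, show n + (k + 1) = n + k + 1 by ring,
    show n + 1 + (k + 1) = n + k + 1 + 1 by ring, show n + 2 + k = n + k + 1 + 1 by ring]
  push_cast
  field_simp
  ring

lemma besselCliffordCoeff_zero_eq :
    besselCliffordCoeff n 0 = (n + 1) * besselCliffordCoeff (n + 1) 0 := by
  simp only [besselCliffordCoeff, add_zero, Nat.factorial_succ, Nat.factorial_zero]
  push_cast
  field_simp

lemma summable_besselClifford (y : ℝ) : Summable fun k => besselCliffordCoeff n k * y ^ k := by
  refine Summable.of_norm_bounded (Real.summable_pow_div_factorial |y|) fun k => ?_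
  rw [Real.norm_eq_abs, abs_mul, abs_pow, abs_of_nonneg (besselCliffordCoeff_nonneg n k),
    div_eq_mul_one_div, mul_comm]
  gcongr
  exact besselCliffordCoeff_le n k

lemma hasDerivAt_besselClifford_tsum (y : ℝ) :
    HasDerivAt (besselClifford n) (∑' k : ℕ, besselCliffordCoeff n k * (k * y ^ (k - 1))) y := by
  have hbound : ∀ k : ℕ, ∀ z ∈ Metric.ball (0 : ℝ) (|y| + 1),
      ‖besselCliffordCoeff n k * (k * z ^ (k - 1))‖
        ≤ besselCliffordCoeff n k * k * (|y| + 1) ^ (k - 1) := fun k z hz => by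
    have hz' : |z| ≤ |y| + 1 := by simpa using (Metric.mem_ball.1 hz).le
    rw [Real.norm_eq_abs, abs_mul, abs_mul, abs_pow, Nat.abs_cast,
      abs_of_nonneg (besselCliffordCoeff_nonneg n k), ← mul_assoc]
    have := besselCliffordCoeff_nonneg n k
    gcongr
  have hsum : Summable fun k : ℕ => besselCliffordCoeff n k * k * (|y| + 1) ^ (k - 1) := by
    rw [← summable_nat_add_iff 1]
    simpa only [besselCliffordCoeff_succ_mul, Nat.add_sub_cancel]
      using summable_besselClifford (n + 1) (|y| + 1)
  exact hasDerivAt_tsum_of_isPreconnected hsum Metric.isOpen_ball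
    (convex_ball _ _).isPreconnected (fun k z _ => (hasDerivAt_pow k z).const_mul _) hbound
    (Metric.mem_ball_self (by positivity)) (summable_besselClifford n 0) (by simp)

lemma hasDerivAt_besselClifford (y : ℝ) :
    HasDerivAt (besselClifford n) (besselClifford (n + 1) y) y := by
  refine (hasDerivAt_besselClifford_tsum n y).congr_deriv ?_
  have hshift : ∀ k : ℕ, besselCliffordCoeff n (k + 1) * ((k + 1 : ℕ) * y ^ (k + 1 - 1))
      = besselCliffordCoeff (n + 1) k * y ^ k := fun k => by
    rw [← mul_assoc, besselCliffordCoeff_succ_mul, Nat.add_sub_cancel]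
  rw [tsum_eq_zero_add' (by simpa only [hshift] using summable_besselClifford (n + 1) y)]
  simp only [hshift, Nat.cast_zero, zero_mul, mul_zero, zero_add, besselClifford]

lemma besselClifford_recurrence (y : ℝ) :
    besselClifford n y = (n + 1) * besselClifford (n + 1) y + y * besselClifford (n + 2) y := by
  have h₀ := summable_besselClifford n y
  have h₁ := (summable_besselClifford (n + 1) y).mul_left ((n : ℝ) + 1)
  have h₂ := (summable_besselClifford (n + 2) y).mul_left y
  simp only [besselClifford]
  rw [← tsum_mul_left, ← tsum_mul_left, h₀.tsum_eq_zero_add, h₁.tsum_eq_zero_add, add_assoc,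
    ← ((summable_nat_add_iff 1).2 h₁).tsum_add h₂, besselCliffordCoeff_zero_eq]
  congr 1
  · ring
  · refine tsum_congr fun k => ?_
    rw [besselCliffordCoeff_succ_eq]
    ring

lemma contDiff_besselClifford : ContDiff ℝ 1 (besselClifford n) := by
  refine contDiff_one_iff_deriv.2 ⟨fun y => (hasDerivAt_besselClifford n y).differentiableAt, ?_⟩
  rw [funext fun y => (hasDerivAt_besselClifford n y).deriv]
  exact continuous_iff_continuousAt.2 fun y => (hasDerivAt_besselClifford (n + 1) y).continuousAt

lemma besselJ_eq_besselClifford (x : ℝ) :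
    besselJ n x = (x / 2) ^ n * besselClifford n (-(x ^ 2 / 4)) := by
  rw [besselJ, besselClifford, ← tsum_mul_left]
  refine tsum_congr fun k => ?_
  rw [besselCliffordCoeff, pow_add, pow_mul, show (x / 2) ^ 2 = x ^ 2 / 4 by ring,
    neg_pow (x ^ 2 / 4)]
  ring

/-- The derivative `J_n'` of the Bessel function. -/
def besselJDeriv : ℕ → ℝ → ℝ
  | 0, x => -besselJ 1 x
  | n + 1, x => (besselJ n x - besselJ (n + 2) x) / 2

/-- The function `n J_n(x) / x`, in a form without the removable singularity at `x = 0`. -/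
def besselJQuot (x : ℝ) : ℝ := besselJDeriv n x + besselJ (n + 1) x

lemma besselJ_recurrence (x : ℝ) :
    x * (besselJ n x + besselJ (n + 2) x) = 2 * (n + 1) * besselJ (n + 1) x := by
  simp only [besselJ_eq_besselClifford]
  rw [besselClifford_recurrence n]
  ring

lemma hasDerivAt_besselJ (x : ℝ) : HasDerivAt (besselJ n) (besselJDeriv n x) x := by
  have hsq : HasDerivAt (fun x : ℝ => -(x ^ 2 / 4)) (-(x / 2)) x :=
    ((hasDerivAt_pow 2 x).div_const 4).neg.congr_deriv (by norm_num; ring)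
  have hpow : HasDerivAt (fun x : ℝ => (x / 2) ^ n) (n * (x / 2) ^ (n - 1) * (1 / 2)) x :=
    ((hasDerivAt_id x).div_const 2).pow n
  rw [funext (besselJ_eq_besselClifford n)]
  refine (hpow.mul ((hasDerivAt_besselClifford n _).comp x hsq)).congr_deriv ?_
  cases n with
  | zero =>
    simp only [besselJDeriv, besselJ_eq_besselClifford, Function.comp]
    simp
    ring
  | succ n =>
    simp only [besselJDeriv, besselJ_eq_besselClifford, Function.comp, Nat.add_sub_cancel]
    rw [besselClifford_recurrence n]
    push_cast
    ring

@[fun_prop]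
lemma continuous_besselJ : Continuous (besselJ n) :=
  continuous_iff_continuousAt.2 fun x => (hasDerivAt_besselJ n x).continuousAt

@[fun_prop]
lemma continuous_besselJDeriv : Continuous (besselJDeriv n) := by
  cases n with
  | zero => exact (continuous_besselJ 1).neg
  | succ n => exact ((continuous_besselJ n).sub (continuous_besselJ (n + 2))).div_const 2

@[fun_prop]
lemma continuous_besselJQuot : Continuous (besselJQuot n) :=
  (continuous_besselJDeriv n).add (continuous_besselJ (n + 1))

lemma besselJQuot_zero (x : ℝ) : besselJQuot 0 x = 0 := neg_add_cancel _

lemma mul_besselJQuot (x : ℝ) : x * besselJQuot n x = n * besselJ n x := by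
  cases n with
  | zero => simp [besselJQuot_zero]
  | succ n =>
    have := besselJ_recurrence n x
    simp only [besselJQuot, besselJDeriv]
    push_cast
    linarith

/-- Bessel's differential equation `(x J_n')' = n² J_n / x - x J_n`. -/
lemma hasDerivAt_mul_besselJDeriv (x : ℝ) :
    HasDerivAt (fun x => x * besselJDeriv n x) (n * besselJQuot n x - x * besselJ n x) x := by
  have h : (fun x => x * besselJDeriv n x)
      = fun x => n * besselJ n x - x * besselJ (n + 1) x := by
    funext y
    rw [← mul_besselJQuot, besselJQuot]
    ring
  rw [h]
  refine (((hasDerivAt_besselJ n x).const_mul (n : ℝ)).sub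
    ((hasDerivAt_id x).mul (hasDerivAt_besselJ (n + 1) x))).congr_deriv ?_
  have := besselJ_recurrence n x
  simp only [besselJQuot, besselJDeriv, id]
  linarith

/-- The radial density of `∇u · ∇v` for `u = J_n(R r) φ(θ)`, `v = J_n(S r) φ(θ)` with an angular
factor `φ` of frequency `n`: the product of the radial derivatives plus that of the angular ones. -/
def besselGradInner (R S r : ℝ) : ℝ :=
  R * besselJDeriv n (R * r) * (S * besselJDeriv n (S * r))
    + R * besselJQuot n (R * r) * (S * besselJQuot n (S * r))

lemma besselGradInner_comm (R S r : ℝ) : besselGradInner n R S r = besselGradInner n S R r := by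
  simp only [besselGradInner]
  ring

@[fun_prop]
lemma continuous_besselGradInner (R S : ℝ) : Continuous (besselGradInner n R S) := by
  unfold besselGradInner
  fun_prop

variable {n}

/-- Green's identity on the unit disk for Bessel functions with a Dirichlet condition. -/
lemma integral_besselGradInner (R : ℝ) {S : ℝ} (hS : besselJ n S = 0) :
    ∫ r in (0 : ℝ)..1, besselGradInner n R S r * r
      = R ^ 2 * ∫ r in (0 : ℝ)..1, besselJ n (R * r) * besselJ n (S * r) * r := by
  have hlin : ∀ c r : ℝ, HasDerivAt (fun r => c * r) c r := fun c r => by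
    simpa using (hasDerivAt_id r).const_mul c
  have hderiv : ∀ r : ℝ,
      HasDerivAt (fun r => (R * r) * besselJDeriv n (R * r) * besselJ n (S * r))
        ((n * besselJQuot n (R * r) - (R * r) * besselJ n (R * r)) * R * besselJ n (S * r)
          + (R * r) * besselJDeriv n (R * r) * (besselJDeriv n (S * r) * S)) r := fun r =>
    ((hasDerivAt_mul_besselJDeriv n (R * r)).comp r (hlin R r)).mul
      ((hasDerivAt_besselJ n (S * r)).comp r (hlin S r))
  have hboundary := intervalIntegral.integral_eq_sub_of_hasDerivAt (a := 0) (b := 1)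
    (fun r _ => hderiv r) ((by fun_prop : Continuous _).intervalIntegrable _ _)
  simp only [mul_one, hS, mul_zero, zero_mul, sub_zero] at hboundary
  have hgrad : Continuous fun r : ℝ => besselGradInner n R S r * r := by fun_prop
  have hprod : Continuous fun r : ℝ => R ^ 2 * (besselJ n (R * r) * besselJ n (S * r) * r) := by
    fun_prop
  rw [← sub_eq_zero, ← intervalIntegral.integral_const_mul,
    ← intervalIntegral.integral_sub (hgrad.intervalIntegrable _ _) (hprod.intervalIntegrable _ _)]
  refine Eq.trans (intervalIntegral.integral_congr fun r _ => ?_) hboundary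
  simp only [besselGradInner]
  linear_combination R * besselJQuot n (R * r) * mul_besselJQuot n (S * r)

lemma integral_besselJ_mul_eq_zero {R S : ℝ} (hR : besselJ n R = 0) (hS : besselJ n S = 0)
    (hRS : R ^ 2 ≠ S ^ 2) :
    ∫ r in (0 : ℝ)..1, besselJ n (R * r) * besselJ n (S * r) * r = 0 := by
  have hcomm : ∀ r, besselJ n (S * r) * besselJ n (R * r) * r
      = besselJ n (R * r) * besselJ n (S * r) * r := fun r => by ring
  have h := integral_besselGradInner S hR
  simp_rw [besselGradInner_comm n S R, hcomm] at h
  rw [integral_besselGradInner R hS] at h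
  exact (mul_eq_mul_right_iff.1 h).resolve_left hRS

end Bessel

/-! ### The real Fourier basis -/

section Fourier

/-- The complex constant `c_m` with `φ_m(β) = Re (c_m exp (i |m| β))`. -/
def fourierConst (m : ℤ) : ℂ :=
  if m = 0 then 1 else if 0 < m then (√2 : ℝ) else -((√2 : ℝ) * Complex.I)

lemma fourierReal_eq_re (m : ℤ) (β : S1) :
    fourierReal m β = (fourierConst m * fourier (m.natAbs : ℤ) β).re := by
  rcases lt_trichotomy m 0 with hm | rfl | hm
  · have h : (m.natAbs : ℤ) = -m := by omega
    simp [fourierReal, fourierConst, hm.ne, hm.not_gt, h]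
  · simp [fourierReal, fourierConst]
  · have h : (m.natAbs : ℤ) = m := by omega
    simp [fourierReal, fourierConst, hm.ne', hm, h]

@[fun_prop]
lemma continuous_fourierReal (m : ℤ) : Continuous (fourierReal m) := by
  rw [funext (fourierReal_eq_re m)]
  fun_prop

lemma fourierReal_coe (m : ℤ) (θ : ℝ) :
    fourierReal m (θ : S1) = (fourierConst m * Complex.exp (θ * Complex.I) ^ m.natAbs).re := by
  rw [fourierReal_eq_re, fourier_coe_apply, ← Complex.exp_nat_mul]
  congr 3
  have : (π : ℂ) ≠ 0 := mod_cast Real.pi_ne_zero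
  rw [Int.cast_natCast]
  push_cast
  field_simp

lemma integrable_const_mul_fourier (c : ℂ) (n : ℤ) :
    Integrable (fun β : S1 => c * fourier n β) dS1 :=
  (by fun_prop : Continuous fun β : S1 => c * fourier n β).integrable_of_hasCompactSupport
    (HasCompactSupport.of_compactSpace _)

lemma integral_re_const_mul_fourier (c : ℂ) (n : ℤ) :
    ∫ β : S1, (c * fourier n β).re ∂dS1 = if n = 0 then c.re else 0 := by
  have hn : ∫ β : S1, fourier n β ∂dS1 = if n = 0 then (1 : ℂ) else 0 := by
    have h := congrFun (fourierCoeff_fourier (T := 2 * π) n) 0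
    simp only [fourierCoeff, neg_zero, fourier_zero, one_smul] at h
    rw [h, Pi.single_apply]
    simp only [eq_comm]
  have hre := integral_re (integrable_const_mul_fourier c n)
  simp only [RCLike.re_eq_complex_re] at hre
  rw [hre, integral_const_mul, hn]
  split_ifs <;> simp

lemma fourierReal_mul_fourierReal (m n : ℤ) (β : S1) :
    fourierReal m β * fourierReal n β
      = (fourierConst m * fourierConst n * fourier ((m.natAbs : ℤ) + n.natAbs) β).re / 2
        + (fourierConst m * (starRingEnd ℂ) (fourierConst n)
            * fourier ((m.natAbs : ℤ) + -n.natAbs) β).re / 2 := by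
  have re_mul_re : ∀ z w : ℂ,
      z.re * w.re = (z * w).re / 2 + (z * (starRingEnd ℂ) w).re / 2 := fun z w => by
    simp only [Complex.mul_re, Complex.conj_re, Complex.conj_im]
    ring
  rw [fourierReal_eq_re, fourierReal_eq_re, re_mul_re, fourier_add, fourier_add, fourier_neg,
    map_mul]
  ring_nf

lemma fourierConst_mul_self_add (m : ℤ) :
    (if m = 0 then (fourierConst m * fourierConst m).re else 0)
      + (fourierConst m * (starRingEnd ℂ) (fourierConst m)).re = 2 := by
  rcases lt_trichotomy m 0 with hm | rfl | hm
  · simp [fourierConst, hm.ne, hm.not_gt]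
  · norm_num [fourierConst]
  · simp [fourierConst, hm.ne', hm]

lemma fourierConst_neg_orthogonal {m : ℤ} (hm : m ≠ 0) :
    (fourierConst m * (starRingEnd ℂ) (fourierConst (-m))).re = 0 := by
  rcases hm.lt_or_gt with hm | hm
  · simp [fourierConst, hm.ne, hm.not_gt, hm]
  · simp [fourierConst, hm.ne', hm.not_gt, hm]

lemma integral_fourierReal_mul (m n : ℤ) :
    ∫ β : S1, fourierReal m β * fourierReal n β ∂dS1 = if m = n then 1 else 0 := by
  have hint : ∀ (c : ℂ) (n : ℤ), Integrable (fun β : S1 => (c * fourier n β).re / 2) dS1 :=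
    fun c n => (integrable_const_mul_fourier c n).re.div_const 2
  simp_rw [fourierReal_mul_fourierReal]
  rw [integral_add (hint _ _) (hint _ _), integral_div, integral_div,
    integral_re_const_mul_fourier, integral_re_const_mul_fourier, ← add_div]
  rcases eq_or_ne m n with rfl | hmn
  · have hsum : ((m.natAbs : ℤ) + m.natAbs = 0) ↔ m = 0 := by omega
    simp only [hsum, add_neg_cancel, if_true, fourierConst_mul_self_add]
    norm_num
  · have hsum : ¬ ((m.natAbs : ℤ) + n.natAbs = 0) := by omega
    rw [if_neg hsum, if_neg hmn, zero_add]
    split_ifs with hdiff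
    · obtain rfl : n = -m := by omega
      rw [fourierConst_neg_orthogonal (by omega), zero_div]
    · exact zero_div _

lemma intervalIntegral_fourierReal_mul (m n : ℤ) :
    ∫ θ in (-π)..π, fourierReal m (θ : S1) * fourierReal n (θ : S1)
      = if m = n then 2 * π else 0 := by
  have hinterval := AddCircle.intervalIntegral_preimage (2 * π) (-π)
    (fun β => fourierReal m β * fourierReal n β)
  have hcircle := integral_fourierReal_mul m n
  rw [AddCircle.integral_haarAddCircle, smul_eq_mul,
    inv_mul_eq_iff_eq_mul₀ Real.two_pi_pos.ne'] at hcircle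
  rw [show -π + 2 * π = π by ring, hcircle] at hinterval
  rw [hinterval]
  split_ifs <;> simp

lemma intervalIntegral_sum_fourierReal_sq {ι : Type*} (s : Finset ι) (n : ι → ℤ) (x : ι → ℝ) :
    ∫ θ in (-π)..π, (∑ k ∈ s, x k * fourierReal (n k) (θ : S1)) ^ 2
      = 2 * π * ∑ k ∈ s, ∑ l ∈ s, if n k = n l then x k * x l else 0 := by
  have hcont : ∀ k l, Continuous fun θ : ℝ =>
      x k * x l * (fourierReal (n k) (θ : S1) * fourierReal (n l) (θ : S1)) := fun k l => by
    fun_prop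
  have hsq : ∀ θ : ℝ, (∑ k ∈ s, x k * fourierReal (n k) (θ : S1)) ^ 2
      = ∑ k ∈ s, ∑ l ∈ s, x k * x l * (fourierReal (n k) (θ : S1) * fourierReal (n l) (θ : S1)) :=
    fun θ => by simp_rw [sq, Finset.sum_mul_sum, mul_mul_mul_comm]
  simp_rw [hsq]
  rw [intervalIntegral.integral_finsetSum fun k _ =>
    (continuous_finsetSum _ fun l _ => hcont k l).intervalIntegrable _ _, Finset.mul_sum]
  refine Finset.sum_congr rfl fun k _ => ?_
  rw [intervalIntegral.integral_finsetSum fun l _ => (hcont k l).intervalIntegrable _ _,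
    Finset.mul_sum]
  refine Finset.sum_congr rfl fun l _ => ?_
  rw [intervalIntegral.integral_const_mul, intervalIntegral_fourierReal_mul]
  split_ifs <;> ring

lemma hasDerivAt_fourierReal_coe (m : ℤ) (θ : ℝ) :
    HasDerivAt (fun θ : ℝ => fourierReal m (θ : S1)) (-m * fourierReal (-m) (θ : S1)) θ := by
  have hexp : HasDerivAt
      (fun z : ℂ => fourierConst m * Complex.exp (m.natAbs * (z * Complex.I)))
      (fourierConst m * (Complex.exp (m.natAbs * (θ * Complex.I))
        * (m.natAbs * (1 * Complex.I)))) (θ : ℂ) :=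
    ((((hasDerivAt_id (θ : ℂ)).mul_const Complex.I).const_mul _).cexp).const_mul _
  have hre : (fun θ : ℝ => fourierReal m (θ : S1))
      = fun θ : ℝ => (fourierConst m * Complex.exp (m.natAbs * (θ * Complex.I))).re := by
    funext x
    rw [fourierReal_coe, ← Complex.exp_nat_mul]
  rw [hre]
  refine hexp.real_of_complex.congr_deriv ?_
  rw [fourierReal_coe, ← Complex.exp_nat_mul, Int.natAbs_neg]
  generalize Complex.exp (m.natAbs * (θ * Complex.I)) = e
  rcases lt_trichotomy m 0 with hm | rfl | hm
  · have habs : |(m : ℝ)| = -m := abs_of_neg (Int.cast_lt_zero.2 hm)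
    simp [fourierConst, hm.ne, hm.not_gt, hm, habs]
    ring
  · simp
  · have habs : |(m : ℝ)| = m := abs_of_pos (Int.cast_pos.2 hm)
    simp [fourierConst, hm.ne', hm.not_gt, hm, habs]
    ring

end Fourier

/-! ### The Dirichlet energy of Fourier-Bessel expansions -/

section DirichletEnergy

namespace FBIndex

/-- The angular frequency `n` of the index `k = (n, R)`. -/
abbrev freq (k : FBIndex) : ℤ := k.1.1

/-- The order `|n|` of the Bessel function that belongs to the index `k = (n, R)`. -/
abbrev order (k : FBIndex) : ℕ := k.1.1.natAbs

/-- The Bessel zero `R` of the index `k = (n, R)`. -/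
abbrev root (k : FBIndex) : ℝ := k.1.2

/-- The normalizing constant `c_k` of `psi k`. -/
def normConst (k : FBIndex) : ℝ :=
  (√(2 * ∫ r in (0 : ℝ)..1, besselJ k.order (k.root * r) ^ 2 * r))⁻¹

lemma normConst_sq_mul_le (k : FBIndex) :
    k.normConst ^ 2 * ∫ r in (0 : ℝ)..1, besselJ k.order (k.root * r) ^ 2 * r ≤ 1 / 2 := by
  have hI : 0 ≤ ∫ r in (0 : ℝ)..1, besselJ k.order (k.root * r) ^ 2 * r :=
    intervalIntegral.integral_nonneg zero_le_one fun r hr => mul_nonneg (sq_nonneg _) hr.1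
  rw [normConst, inv_pow, Real.sq_sqrt (by positivity), mul_inv, mul_assoc, one_div]
  exact mul_le_of_le_one_right (by norm_num) (inv_mul_le_one)

/-- The radial factor of the radial derivative of `psi k`. -/
def radialFactor (k : FBIndex) (r : ℝ) : ℝ :=
  k.normConst * (k.root * besselJDeriv k.order (k.root * r))

/-- The radial factor of the angular derivative of `psi k`, divided by the radius. -/
def angularFactor (k : FBIndex) (r : ℝ) : ℝ :=
  -k.freq.sign * (k.normConst * (k.root * besselJQuot k.order (k.root * r)))

@[fun_prop]
lemma continuous_radialFactor (k : FBIndex) : Continuous k.radialFactor := by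
  unfold radialFactor
  fun_prop

@[fun_prop]
lemma continuous_angularFactor (k : FBIndex) : Continuous k.angularFactor := by
  unfold angularFactor
  fun_prop

lemma mul_angularFactor (k : FBIndex) (r : ℝ) :
    r * k.angularFactor r = k.normConst * besselJ k.order (k.root * r) * -k.freq := by
  have hfreq : (k.freq : ℝ) = k.freq.sign * k.order := by
    rw [← Int.cast_natCast k.order, ← Int.cast_mul, Int.sign_mul_natAbs]
  rw [angularFactor, hfreq]
  linear_combination (-k.normConst * k.freq.sign) * mul_besselJQuot k.order (k.root * r)

/-- The part of `∇ψ_k · ∇ψ_l` at radius `r` that survives the integration over the angle. -/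
def gradInner (k l : FBIndex) (r : ℝ) : ℝ :=
  if k.freq = l.freq then
    k.radialFactor r * l.radialFactor r + k.angularFactor r * l.angularFactor r
  else 0

@[fun_prop]
lemma continuous_gradInner (k l : FBIndex) : Continuous (k.gradInner l) := by
  unfold gradInner
  split_ifs <;> fun_prop

lemma gradInner_eq {k l : FBIndex} (h : k.freq = l.freq) (r : ℝ) :
    k.gradInner l r
      = k.normConst * l.normConst * besselGradInner k.order k.root l.root r := by
  have hsign : (k.freq.sign : ℝ) ^ 2 * besselJQuot k.order (k.root * r)
      = besselJQuot k.order (k.root * r) := by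
    rcases eq_or_ne k.freq 0 with h₀ | h₀
    · simp [order, h₀, besselJQuot_zero]
    · have habs : |(k.freq.sign : ℝ)| = 1 := by
        rw [← Int.cast_abs, Int.abs_sign_of_ne_zero h₀, Int.cast_one]
      rw [← sq_abs, habs, one_pow, one_mul]
  have horder : l.order = k.order := congrArg Int.natAbs h.symm
  rw [gradInner, if_pos h, radialFactor, radialFactor, angularFactor, angularFactor,
    besselGradInner, ← h, horder]
  linear_combination (k.normConst * l.normConst * k.root * l.root
    * besselJQuot k.order (l.root * r)) * hsign

lemma integral_gradInner_self_le (k : FBIndex) :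
    ∫ r in (0 : ℝ)..1, k.gradInner k r * r ≤ k.mu / 2 := by
  simp_rw [gradInner_eq rfl, mul_assoc (k.normConst * k.normConst)]
  rw [intervalIntegral.integral_const_mul, integral_besselGradInner _ k.2.2, ← sq, mu]
  simp_rw [← sq]
  nlinarith [k.normConst_sq_mul_le, sq_nonneg k.root]

lemma integral_gradInner_of_ne {k l : FBIndex} (h : k ≠ l) :
    ∫ r in (0 : ℝ)..1, k.gradInner l r * r = 0 := by
  by_cases hfreq : k.freq = l.freq
  · have hroot : k.root ^ 2 ≠ l.root ^ 2 := fun hsq =>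
      h (Subtype.ext (Prod.ext hfreq ((pow_left_inj₀ k.2.1.le l.2.1.le two_ne_zero).1 hsq)))
    have horder : l.order = k.order := congrArg Int.natAbs hfreq.symm
    have hl : besselJ k.order l.root = 0 := horder ▸ l.2.2
    simp_rw [gradInner_eq hfreq, mul_assoc (k.normConst * l.normConst)]
    rw [intervalIntegral.integral_const_mul, integral_besselGradInner _ hl,
      integral_besselJ_mul_eq_zero k.2.2 hl hroot, mul_zero, mul_zero]
  · simp [gradInner, hfreq]

end FBIndex

open FBIndex

/-- The smooth extension of `psi k` from the unit disk to the plane. -/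
def psiSmooth (k : FBIndex) (v : ℂ) : ℝ :=
  k.normConst * ((k.root / 2) ^ k.order * besselClifford k.order (-(k.root ^ 2 / 4 * ‖v‖ ^ 2)))
    * (fourierConst k.freq * v ^ k.order).re

lemma psiSmooth_polar (k : FBIndex) (r θ : ℝ) :
    psiSmooth k (r * Complex.exp (θ * Complex.I))
      = k.normConst * besselJ k.order (k.root * r) * fourierReal k.freq (θ : S1) := by
  have hnorm : ‖(r : ℂ) * Complex.exp (θ * Complex.I)‖ ^ 2 = r ^ 2 := by
    rw [norm_mul, Complex.norm_exp_ofReal_mul_I, mul_one, Complex.norm_real, Real.norm_eq_abs,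
      sq_abs]
  rw [psiSmooth, hnorm, besselJ_eq_besselClifford, fourierReal_coe, mul_pow, ← Complex.ofReal_pow,
    mul_left_comm (fourierConst _), Complex.re_ofReal_mul]
  ring_nf

lemma psi_eq_psiSmooth (k : FBIndex) {v : ℂ} (hv : ‖v‖ ≤ 1) : psi k v = psiSmooth k v := by
  conv_rhs => rw [← Complex.norm_mul_exp_arg_mul_I v, psiSmooth_polar]
  rw [psi, if_pos hv]
  rfl

lemma psi_eq_zero (k : FBIndex) {v : ℂ} (hv : 1 ≤ ‖v‖) : psi k v = 0 := by
  rcases hv.eq_or_lt with h | h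
  · rw [psi, if_pos h.ge, ← h, mul_one, k.2.2, mul_zero, zero_mul]
  · rw [psi, if_neg h.not_ge]

@[fun_prop]
lemma contDiff_psiSmooth (k : FBIndex) : ContDiff ℝ 1 (psiSmooth k) := by
  have hangular : ContDiff ℝ 1 fun v : ℂ => (fourierConst k.freq * v ^ k.order).re :=
    Complex.reCLM.contDiff.comp (contDiff_const.mul (contDiff_id.pow _))
  have hradial : ContDiff ℝ 1 fun v : ℂ => -(k.root ^ 2 / 4 * ‖v‖ ^ 2) :=
    (contDiff_const.mul (contDiff_norm_sq ℝ)).neg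
  exact (contDiff_const.mul (contDiff_const.mul
    ((contDiff_besselClifford _).comp hradial))).mul hangular

variable (s : Finset FBIndex) (b : FBIndex → ℝ)

/-- The finite expansion `∑_{k ∈ s} b_k ψ_k`, extended smoothly from the unit disk to the plane. -/
def smoothExpansion (v : ℂ) : ℝ := ∑ k ∈ s, b k * psiSmooth k v

lemma contDiff_smoothExpansion : ContDiff ℝ 1 (smoothExpansion s b) :=
  ContDiff.sum fun k _ => contDiff_const.mul (contDiff_psiSmooth k)

lemma smoothExpansion_polar (r θ : ℝ) :
    smoothExpansion s b (r * Complex.exp (θ * Complex.I))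
      = ∑ k ∈ s, b k * (k.normConst * besselJ k.order (k.root * r)
          * fourierReal k.freq (θ : S1)) := by
  simp only [smoothExpansion, psiSmooth_polar]

/-- The radial derivative of `smoothExpansion s b` in polar coordinates `p = (r, θ)`. -/
def radialDeriv (p : ℝ × ℝ) : ℝ :=
  ∑ k ∈ s, b k * k.radialFactor p.1 * fourierReal k.freq (p.2 : S1)

/-- The angular derivative of `smoothExpansion s b` in polar coordinates `p = (r, θ)`, divided by
the radius. -/
def angularDeriv (p : ℝ × ℝ) : ℝ :=
  ∑ k ∈ s, b k * k.angularFactor p.1 * fourierReal (-k.freq) (p.2 : S1)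

@[fun_prop]
lemma continuous_radialDeriv : Continuous (radialDeriv s b) := by
  unfold radialDeriv
  fun_prop

@[fun_prop]
lemma continuous_angularDeriv : Continuous (angularDeriv s b) := by
  unfold angularDeriv
  fun_prop

lemma hasDerivAt_smoothExpansion_comp {c : ℝ → ℂ} {c' : ℂ} {x : ℝ} (hc : HasDerivAt c c' x) :
    HasDerivAt (fun x => smoothExpansion s b (c x)) (fderiv ℝ (smoothExpansion s b) (c x) c') x :=
  (((contDiff_smoothExpansion s b).differentiable one_ne_zero _).hasFDerivAt).comp_hasDerivAt x hc

lemma fderiv_smoothExpansion_radial (r θ : ℝ) :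
    fderiv ℝ (smoothExpansion s b) (r * Complex.exp (θ * Complex.I)) (Complex.exp (θ * Complex.I))
      = radialDeriv s b (r, θ) := by
  have hray : HasDerivAt (fun r : ℝ => (r : ℂ) * Complex.exp (θ * Complex.I))
      (Complex.exp (θ * Complex.I)) r := by
    simpa using (Complex.ofRealCLM.hasDerivAt (x := r)).mul_const (Complex.exp (θ * Complex.I))
  refine (hasDerivAt_smoothExpansion_comp s b hray).unique ?_
  simp only [smoothExpansion_polar, radialDeriv]
  refine HasDerivAt.fun_sum fun k _ => ?_
  have hscale : HasDerivAt (fun r : ℝ => k.root * r) k.root r := by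
    simpa using (hasDerivAt_id r).const_mul k.root
  refine (((((hasDerivAt_besselJ k.order (k.root * r)).comp r hscale).const_mul
    k.normConst).mul_const _).const_mul (b k)).congr_deriv ?_
  rw [radialFactor]
  ring

lemma fderiv_smoothExpansion_angular {r : ℝ} (hr : r ≠ 0) (θ : ℝ) :
    fderiv ℝ (smoothExpansion s b) (r * Complex.exp (θ * Complex.I))
      (Complex.I * Complex.exp (θ * Complex.I)) = angularDeriv s b (r, θ) := by
  have hcircle : HasDerivAt (fun θ : ℝ => (r : ℂ) * Complex.exp (θ * Complex.I))
      (r • (Complex.I * Complex.exp (θ * Complex.I))) θ := by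
    refine (((Complex.ofRealCLM.hasDerivAt (x := θ)).mul_const Complex.I).cexp.const_mul
      (r : ℂ)).congr_deriv ?_
    simp only [Complex.ofRealCLM_apply, Complex.real_smul, Complex.ofReal_one]
    ring
  have hderiv := hasDerivAt_smoothExpansion_comp s b hcircle
  rw [map_smul, smul_eq_mul] at hderiv
  refine mul_left_cancel₀ hr (hderiv.unique ?_)
  simp only [smoothExpansion_polar, angularDeriv, Finset.mul_sum]
  refine HasDerivAt.fun_sum fun k _ => ?_
  refine (((hasDerivAt_fourierReal_coe k.freq θ).const_mul _).const_mul (b k)).congr_deriv ?_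
  linear_combination (-b k * fourierReal (-k.freq) (θ : S1)) * k.mul_angularFactor r

lemma norm_sq_le_add_sq_of_norm_eq_one (f : ℂ →L[ℝ] ℝ) {e : ℂ} (he : ‖e‖ = 1) :
    ‖f‖ ^ 2 ≤ f e ^ 2 + f (Complex.I * e) ^ 2 := by
  have hnonneg : 0 ≤ f e ^ 2 + f (Complex.I * e) ^ 2 := by positivity
  suffices ‖f‖ ≤ √(f e ^ 2 + f (Complex.I * e) ^ 2) by
    simpa only [Real.sq_sqrt hnonneg] using pow_le_pow_left₀ (norm_nonneg f) this 2
  refine f.opNorm_le_bound (Real.sqrt_nonneg _) fun v => ?_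
  have hv : v = (v / e).re • e + (v / e).im • (Complex.I * e) := by
    rw [Complex.real_smul, Complex.real_smul, ← mul_assoc, ← add_mul, Complex.re_add_im,
      div_mul_cancel₀ v (norm_ne_zero_iff.1 (he ▸ one_ne_zero))]
  have hnorm : ‖v‖ ^ 2 = (v / e).re ^ 2 + (v / e).im ^ 2 := by
    rw [← div_one ‖v‖, ← he, ← norm_div, Complex.sq_norm, Complex.normSq_apply]
    ring
  refine abs_le_of_sq_le_sq ?_ (by positivity)
  rw [mul_pow, Real.sq_sqrt hnonneg, hnorm]
  conv_lhs => rw [hv]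
  rw [map_add, map_smul, map_smul, smul_eq_mul, smul_eq_mul]
  nlinarith [sq_nonneg ((v / e).re * f (Complex.I * e) - (v / e).im * f e)]

lemma intervalIntegral_polar_energy (r : ℝ) :
    ∫ θ in (-π)..π, (radialDeriv s b (r, θ) ^ 2 + angularDeriv s b (r, θ) ^ 2) * r
      = 2 * π * ∑ k ∈ s, ∑ l ∈ s, b k * b l * (k.gradInner l r * r) := by
  rw [intervalIntegral.integral_mul_const, intervalIntegral.integral_add
    ((by fun_prop : Continuous fun θ : ℝ => radialDeriv s b (r, θ) ^ 2).intervalIntegrable _ _)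
    ((by fun_prop : Continuous fun θ : ℝ => angularDeriv s b (r, θ) ^ 2).intervalIntegrable _ _)]
  simp only [radialDeriv, angularDeriv]
  rw [intervalIntegral_sum_fourierReal_sq, intervalIntegral_sum_fourierReal_sq, ← mul_add,
    ← Finset.sum_add_distrib]
  simp_rw [← Finset.sum_add_distrib, Finset.mul_sum, Finset.sum_mul, neg_inj, gradInner]
  refine Finset.sum_congr rfl fun k _ => Finset.sum_congr rfl fun l _ => ?_
  split_ifs <;> ring

lemma integral_polar_energy_le :
    ∫ r in (0 : ℝ)..1, ∫ θ in (-π)..π,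
        (radialDeriv s b (r, θ) ^ 2 + angularDeriv s b (r, θ) ^ 2) * r
      ≤ π * ∑ k ∈ s, k.mu * b k ^ 2 := by
  have hcont : ∀ k l : FBIndex, Continuous fun r : ℝ => b k * b l * (k.gradInner l r * r) :=
    fun k l => by fun_prop
  simp_rw [intervalIntegral_polar_energy]
  rw [intervalIntegral.integral_const_mul, intervalIntegral.integral_finsetSum fun k _ =>
    (continuous_finsetSum _ fun l _ => hcont k l).intervalIntegrable _ _, mul_comm 2 π, mul_assoc,
    Finset.mul_sum]
  refine mul_le_mul_of_nonneg_left (Finset.sum_le_sum fun k hk => ?_) Real.pi_pos.le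
  rw [intervalIntegral.integral_finsetSum fun l _ => (hcont k l).intervalIntegrable _ _,
    Finset.sum_eq_single_of_mem k hk fun l _ hl => by
      rw [intervalIntegral.integral_const_mul, integral_gradInner_of_ne hl.symm, mul_zero],
    intervalIntegral.integral_const_mul]
  nlinarith [mul_le_mul_of_nonneg_left k.integral_gradInner_self_le (sq_nonneg (b k))]

end DirichletEnergy

/-! ### Lower integrals: Cauchy-Schwarz and antilipschitz changes of variables -/

section LowerIntegrals

lemma sq_lintegral_mul_le {X : Type*} [MeasurableSpace X] {μ : Measure X} {f g : X → ℝ≥0∞}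
    (hf : AEMeasurable f μ) (hg : AEMeasurable g μ) :
    (∫⁻ x, f x * g x ∂μ) ^ 2 ≤ (∫⁻ x, f x ^ 2 ∂μ) * ∫⁻ x, g x ^ 2 ∂μ := by
  have holder := ENNReal.lintegral_mul_le_Lp_mul_Lq μ Real.HolderConjugate.two_two hf hg
  simp only [Pi.mul_apply, ENNReal.rpow_two] at holder
  refine (pow_le_pow_left' holder 2).trans_eq ?_
  rw [mul_pow, ← ENNReal.rpow_two, ← ENNReal.rpow_two, ← ENNReal.rpow_mul, ← ENNReal.rpow_mul]
  norm_num

lemma sq_lintegral_le_measure_univ_mul {X : Type*} [MeasurableSpace X] {μ : Measure X}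
    {f : X → ℝ≥0∞} (hf : AEMeasurable f μ) :
    (∫⁻ x, f x ∂μ) ^ 2 ≤ μ Set.univ * ∫⁻ x, f x ^ 2 ∂μ := by
  simpa using sq_lintegral_mul_le (f := fun _ => 1) aemeasurable_const hf

variable {E : Type*} [NormedAddCommGroup E] [NormedSpace ℝ E] [FiniteDimensional ℝ E]
  [MeasurableSpace E] [BorelSpace E] (μ : Measure E) [μ.IsAddHaarMeasure] {g : E → E} {K : NNReal}

lemma addHaar_preimage_le_of_antilipschitz (hg : AntilipschitzWith K g) (s : Set E) :
    μ (g ⁻¹' s) ≤ (K : ℝ≥0∞) ^ Module.finrank ℝ E * μ s := by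
  have hHaar : Measure.IsAddHaarMeasure (μH[Module.finrank ℝ E] : Measure E) :=
    isAddHaarMeasure_hausdorffMeasure
  have hHausdorff := hg.hausdorffMeasure_preimage_le (Nat.cast_nonneg (Module.finrank ℝ E)) s
  rw [ENNReal.rpow_natCast] at hHausdorff
  rw [Measure.isAddLeftInvariant_eq_smul μ (μH[Module.finrank ℝ E] : Measure E),
    Measure.smul_apply, Measure.smul_apply, mul_smul_comm]
  gcongr

lemma map_addHaar_le_of_antilipschitz (hg : AntilipschitzWith K g) (hgm : Measurable g) :
    μ.map g ≤ (K : ℝ≥0∞) ^ Module.finrank ℝ E • μ := Measure.le_iff.2 fun s hs => by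
  rw [Measure.map_apply hgm hs]
  exact addHaar_preimage_le_of_antilipschitz μ hg s

lemma lintegral_comp_le_of_antilipschitz (hg : AntilipschitzWith K g) (hgm : Measurable g)
    {f : E → ℝ≥0∞} (hf : Measurable f) :
    ∫⁻ v, f (g v) ∂μ ≤ (K : ℝ≥0∞) ^ Module.finrank ℝ E * ∫⁻ v, f v ∂μ := by
  rw [← lintegral_map hf hgm, ← smul_eq_mul, ← lintegral_smul_measure]
  exact lintegral_mono' (map_addHaar_le_of_antilipschitz μ hg hgm) le_rfl

end LowerIntegrals

/-! ### Increments of finite expansions along deformations -/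

section Increments

variable {E : Type*} [NormedAddCommGroup E] {F f : E → ℝ}

/-- The function `f` agrees with `F` on the closed unit ball, where `F` has zero boundary values,
and vanishes outside. -/
structure IsZeroExtension (F f : E → ℝ) : Prop where
  eq_of_norm_le : ∀ v, ‖v‖ ≤ 1 → f v = F v
  eq_zero_of_le_norm : ∀ v, 1 ≤ ‖v‖ → f v = 0

lemma IsZeroExtension.continuous (h : IsZeroExtension F f) (hF : Continuous F) :
    Continuous f := by
  have hf : f = fun v => if ‖v‖ ≤ 1 then F v else 0 := by
    funext v
    split_ifs with hv
    · exact h.eq_of_norm_le v hv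
    · exact h.eq_zero_of_le_norm v (not_le.1 hv).le
  rw [hf]
  refine hF.if_le continuous_const continuous_norm continuous_const fun v hv => ?_
  rw [← h.eq_of_norm_le v hv.le, h.eq_zero_of_le_norm v hv.ge]

section NormedSpace

variable [NormedSpace ℝ E]

/-- The size of the gradient of `F` inside the unit ball, and zero outside. -/
def ballGradient (F : E → ℝ) (v : E) : ℝ≥0∞ :=
  (Metric.ball (0 : E) 1).indicator (fun v => ‖fderiv ℝ F v‖ₑ) v

lemma ballGradient_of_norm_lt {v : E} (hv : ‖v‖ < 1) : ballGradient F v = ‖fderiv ℝ F v‖ₑ :=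
  Set.indicator_of_mem (mem_ball_zero_iff.2 hv) _

lemma ballGradient_of_le_norm {v : E} (hv : 1 ≤ ‖v‖) : ballGradient F v = 0 :=
  Set.indicator_of_notMem (fun h => hv.not_gt (mem_ball_zero_iff.1 h)) _

lemma measurable_ballGradient [MeasurableSpace E] [OpensMeasurableSpace E]
    (hF : ContDiff ℝ 1 F) : Measurable (ballGradient F) :=
  Measurable.indicator (hF.continuous_fderiv one_ne_zero).enorm.measurable
    Metric.isOpen_ball.measurableSet

lemma IsZeroExtension.hasDerivAt_line (h : IsZeroExtension F f) (hF : Differentiable ℝ F)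
    {z w : E} {t : ℝ} (ht : ‖z + t • w‖ ≠ 1) :
    HasDerivAt (fun t : ℝ => f (z + t • w))
      ({t : ℝ | ‖z + t • w‖ < 1}.indicator (fun t => fderiv ℝ F (z + t • w) w) t) t := by
  have hnorm : Continuous fun t : ℝ => ‖z + t • w‖ := by fun_prop
  rcases ht.lt_or_gt with hlt | hgt
  · have hline : HasDerivAt (fun t : ℝ => z + t • w) w t := by
      simpa using ((hasDerivAt_id t).smul_const w).const_add z
    rw [Set.indicator_of_mem (by exact hlt)]
    refine ((hF (z + t • w)).hasFDerivAt.comp_hasDerivAt t hline).congr_of_eventuallyEq ?_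
    filter_upwards [(isOpen_lt hnorm continuous_const).mem_nhds hlt] with x hx
    exact h.eq_of_norm_le _ (le_of_lt hx)
  · rw [Set.indicator_of_notMem (by exact hgt.not_gt)]
    refine (hasDerivAt_const t (0 : ℝ)).congr_of_eventuallyEq ?_
    filter_upwards [(isOpen_lt continuous_const hnorm).mem_nhds hgt] with x hx
    exact h.eq_zero_of_le_norm _ (le_of_lt hx)

/-- The maps `T₀ + s (T₁ - T₀)`, `0 ≤ s ≤ 1`, are all antilipschitz with constant `K`, and `T₁` is
`δ`-close to `T₀` wherever one of them takes values in the ball of radius `1 / c`. -/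
structure IsDeformation (c : ℝ) (K : NNReal) (δ : ℝ≥0∞) (T₀ T₁ : E → E) : Prop where
  continuous₀ : Continuous T₀
  continuous₁ : Continuous T₁
  antilipschitz : ∀ s ∈ Set.Icc (0 : ℝ) 1, AntilipschitzWith K fun v => T₀ v + s • (T₁ v - T₀ v)
  close : ∀ s ∈ Set.Icc (0 : ℝ) 1, ∀ v, c * ‖T₀ v + s • (T₁ v - T₀ v)‖ < 1 → ‖T₁ v - T₀ v‖ₑ ≤ δ

namespace IsDeformation

variable {c : ℝ} {K : NNReal} {δ : ℝ≥0∞} {T₀ T₁ : E → E}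

lemma antilipschitz₀ (h : IsDeformation c K δ T₀ T₁) : AntilipschitzWith K T₀ := by
  simpa using h.antilipschitz 0 (by simp)

lemma antilipschitz₁ (h : IsDeformation c K δ T₀ T₁) : AntilipschitzWith K T₁ := by
  simpa using h.antilipschitz 1 (by simp)

lemma const_smul (hc : 0 < c) (h : IsDeformation c K δ T₀ T₁) :
    IsDeformation 1 (K * c.toNNReal⁻¹) (ENNReal.ofReal c * δ) (fun v => c • T₀ v)
      (fun v => c • T₁ v) := by
  have hsmul : ∀ s : ℝ, ∀ v, c • T₀ v + s • (c • T₁ v - c • T₀ v)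
      = c • (T₀ v + s • (T₁ v - T₀ v)) := fun s v => by
    rw [smul_add, smul_comm c s, smul_sub c]
  refine ⟨h.continuous₀.const_smul c, h.continuous₁.const_smul c, fun s hs => ?_,
    fun s hs v hv => ?_⟩
  · simp_rw [hsmul]
    refine AntilipschitzWith.of_le_mul_dist fun x y => ?_
    rw [dist_smul₀, Real.norm_of_nonneg hc.le]
    refine ((h.antilipschitz s hs).le_mul_dist x y).trans_eq ?_
    rw [NNReal.coe_mul, NNReal.coe_inv, Real.coe_toNNReal c hc.le]
    field_simp
  · rw [hsmul, norm_smul, Real.norm_of_nonneg hc.le, one_mul] at hv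
    rw [← smul_sub, enorm_smul, Real.enorm_of_nonneg hc.le]
    gcongr
    exact h.close s hs v hv

end IsDeformation

end NormedSpace

section InnerProductSpace

variable [InnerProductSpace ℝ E]

open Polynomial in
lemma finite_setOf_norm_add_smul_eq (z : E) {w : E} (hw : w ≠ 0) (R : ℝ) :
    {t : ℝ | ‖z + t • w‖ = R}.Finite := by
  set p : ℝ[X] := C (‖w‖ ^ 2) * X ^ 2 + C (2 * inner ℝ z w) * X + C (‖z‖ ^ 2 - R ^ 2) with hp
  have hlead : p.leadingCoeff = ‖w‖ ^ 2 :=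
    leadingCoeff_quadratic (pow_ne_zero 2 (norm_ne_zero_iff.2 hw))
  have hp0 : p ≠ 0 := leadingCoeff_ne_zero.1 (hlead ▸ pow_ne_zero 2 (norm_ne_zero_iff.2 hw))
  refine (finite_setOfPred_isRoot hp0).subset fun t (ht : ‖z + t • w‖ = R) => ?_
  have hquad := congrArg (· ^ 2) ht
  simp only [norm_add_sq_real, inner_smul_right, norm_smul, mul_pow, Real.norm_eq_abs,
    sq_abs] at hquad
  simp only [Set.mem_ofPred_eq, IsRoot, hp, eval_add, eval_mul, eval_C, eval_pow, eval_X]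
  linarith

lemma IsZeroExtension.enorm_sub_le (h : IsZeroExtension F f) (hF : ContDiff ℝ 1 F) (z w : E) :
    ‖f (z + w) - f z‖ₑ ≤ ∫⁻ t in Set.Ioc (0 : ℝ) 1, ‖w‖ₑ * ballGradient F (z + t • w) := by
  rcases eq_or_ne w 0 with rfl | hw
  · simp
  have hline : Continuous fun t : ℝ => z + t • w := by fun_prop
  set slope : ℝ → ℝ :=
    {t : ℝ | ‖z + t • w‖ < 1}.indicator fun t => fderiv ℝ F (z + t • w) w with hslope
  have hcont : Continuous fun t : ℝ => fderiv ℝ F (z + t • w) w :=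
    ((hF.continuous_fderiv one_ne_zero).comp hline).clm_apply continuous_const
  have hint : IntervalIntegrable slope volume 0 1 := by
    rw [intervalIntegrable_iff]
    exact (intervalIntegrable_iff.1 (hcont.intervalIntegrable 0 1)).indicator
      (isOpen_lt hline.norm continuous_const).measurableSet
  have hFTC := MeasureTheory.integral_eq_of_hasDerivAt_off_countable
    (fun t : ℝ => f (z + t • w)) slope (a := 0) (b := 1)
    (finite_setOf_norm_add_smul_eq z hw 1).countable
    ((h.continuous hF.continuous).comp hline).continuousOn
    (fun t ht => h.hasDerivAt_line (hF.differentiable one_ne_zero) ht.2) hint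
  simp only [one_smul, zero_smul, add_zero] at hFTC
  rw [← hFTC, intervalIntegral.integral_of_le zero_le_one]
  refine (enorm_integral_le_lintegral_enorm _).trans (lintegral_mono fun t => ?_)
  rcases lt_or_ge ‖z + t • w‖ 1 with hlt | hge
  · rw [hslope, Set.indicator_of_mem (by exact hlt), ballGradient_of_norm_lt hlt, mul_comm]
    exact (fderiv ℝ F (z + t • w)).le_opENorm w
  · rw [hslope, Set.indicator_of_notMem (by exact hge.not_gt), enorm_zero]
    exact zero_le

lemma IsZeroExtension.lintegral_enorm_sub_le [FiniteDimensional ℝ E] [MeasurableSpace E]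
    [BorelSpace E] (μ : Measure E) [μ.IsAddHaarMeasure] (hf : IsZeroExtension F f)
    (hF : ContDiff ℝ 1 F) {K : NNReal} {δ : ℝ≥0∞} {T₀ T₁ : E → E}
    (hT : IsDeformation 1 K δ T₀ T₁) :
    ∫⁻ v, ‖f (T₁ v) - f (T₀ v)‖ₑ ∂μ
      ≤ δ * K ^ Module.finrank ℝ E * ∫⁻ v, ballGradient F v ∂μ := by
  have hT₀ := hT.continuous₀
  have hT₁ := hT.continuous₁
  have hgrad := measurable_ballGradient hF
  have hjoint : Measurable fun p : E × ℝ =>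
      δ * ballGradient F (T₀ p.1 + p.2 • (T₁ p.1 - T₀ p.1)) :=
    (hgrad.comp (by fun_prop : Continuous fun p : E × ℝ =>
      T₀ p.1 + p.2 • (T₁ p.1 - T₀ p.1)).measurable).const_mul δ
  have hpointwise : ∀ v, ‖f (T₁ v) - f (T₀ v)‖ₑ
      ≤ ∫⁻ t in Set.Ioc (0 : ℝ) 1, δ * ballGradient F (T₀ v + t • (T₁ v - T₀ v)) := fun v => by
    have hsegment := hf.enorm_sub_le hF (T₀ v) (T₁ v - T₀ v)
    rw [add_sub_cancel] at hsegment
    refine hsegment.trans (setLIntegral_mono' measurableSet_Ioc fun t ht => ?_)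
    rcases lt_or_ge ‖T₀ v + t • (T₁ v - T₀ v)‖ 1 with hlt | hge
    · gcongr
      exact hT.close t (Set.Ioc_subset_Icc_self ht) v (by rwa [one_mul])
    · rw [ballGradient_of_le_norm hge, mul_zero, mul_zero]
  have hslice : ∀ t ∈ Set.Ioc (0 : ℝ) 1,
      ∫⁻ v, δ * ballGradient F (T₀ v + t • (T₁ v - T₀ v)) ∂μ
        ≤ δ * K ^ Module.finrank ℝ E * ∫⁻ v, ballGradient F v ∂μ := fun t ht => by
    have hTt : Measurable fun v => T₀ v + t • (T₁ v - T₀ v) :=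
      (by fun_prop : Continuous fun v => T₀ v + t • (T₁ v - T₀ v)).measurable
    rw [lintegral_const_mul _ (by exact hgrad.comp hTt), mul_assoc]
    gcongr
    exact lintegral_comp_le_of_antilipschitz μ
      (hT.antilipschitz t (Set.Ioc_subset_Icc_self ht)) hTt hgrad
  refine (lintegral_mono hpointwise).trans ?_
  rw [lintegral_lintegral_swap hjoint.aemeasurable]
  exact (setLIntegral_mono' measurableSet_Ioc hslice).trans_eq (by simp)

end InnerProductSpace

end Increments

section FiniteExpansion

variable (s : Finset FBIndex) (b : FBIndex → ℝ)

lemma ofReal_mul_ballGradient_polar_sq_le {r : ℝ} (hr : 0 < r) (θ : ℝ) :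
    ENNReal.ofReal r * ballGradient (smoothExpansion s b) (r * Complex.exp (θ * Complex.I)) ^ 2
      ≤ (Set.Ioc (0 : ℝ) 1).indicator (fun r => ENNReal.ofReal
          ((radialDeriv s b (r, θ) ^ 2 + angularDeriv s b (r, θ) ^ 2) * r)) r := by
  have hnorm : ‖(r : ℂ) * Complex.exp (θ * Complex.I)‖ = r := by
    rw [norm_mul, Complex.norm_exp_ofReal_mul_I, mul_one, Complex.norm_real,
      Real.norm_of_nonneg hr.le]
  rcases lt_or_ge r 1 with hlt | hge
  · rw [ballGradient_of_norm_lt (hnorm.trans_lt hlt),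
      Set.indicator_of_mem (Set.mem_Ioc.2 ⟨hr, hlt.le⟩),
      ← ofReal_norm, ← ENNReal.ofReal_pow (norm_nonneg _), ← ENNReal.ofReal_mul hr.le, mul_comm r,
      ← fderiv_smoothExpansion_radial, ← fderiv_smoothExpansion_angular s b hr.ne']
    gcongr
    exact norm_sq_le_add_sq_of_norm_eq_one _ (Complex.norm_exp_ofReal_mul_I θ)
  · rw [ballGradient_of_le_norm (hnorm.symm ▸ hge), zero_pow two_ne_zero, mul_zero]
    exact zero_le

lemma lintegral_ballGradient_sq_le :
    ∫⁻ v, ballGradient (smoothExpansion s b) v ^ 2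
      ≤ ENNReal.ofReal (π * ∑ k ∈ s, k.mu * b k ^ 2) := by
  set energy : ℝ × ℝ → ℝ := fun p => (radialDeriv s b p ^ 2 + angularDeriv s b p ^ 2) * p.1
  set box : Set (ℝ × ℝ) := Set.Ioc (0 : ℝ) 1 ×ˢ Set.Ioc (-π) π
  have hbox : MeasurableSet box := measurableSet_Ioc.prod measurableSet_Ioc
  have henergy : IntegrableOn energy box (volume.prod volume) :=
    ((by fun_prop : Continuous energy).continuousOn.integrableOn_compact
      (isCompact_Icc.prod isCompact_Icc)).mono_set
      (Set.prod_mono Set.Ioc_subset_Icc_self Set.Ioc_subset_Icc_self)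
  have hpolar : ∀ p ∈ polarCoord.target,
      ENNReal.ofReal p.1 • ballGradient (smoothExpansion s b) (Complex.polarCoord.symm p) ^ 2
        ≤ box.indicator (fun p => ENNReal.ofReal (energy p)) p := by
    rintro ⟨r, θ⟩ ⟨hr, hθ⟩
    rw [Complex.polarCoord_symm_apply, Complex.ofReal_cos, Complex.ofReal_sin, ← Complex.exp_mul_I]
    refine (ofReal_mul_ballGradient_polar_sq_le s b hr θ).trans_eq ?_
    simp only [Set.indicator, box, Set.mem_prod, Set.Ioo_subset_Ioc_self hθ, and_true]
    rfl
  calc ∫⁻ v, ballGradient (smoothExpansion s b) v ^ 2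
      = ∫⁻ p in polarCoord.target, ENNReal.ofReal p.1
          • ballGradient (smoothExpansion s b) (Complex.polarCoord.symm p) ^ 2 :=
        (Complex.lintegral_comp_polarCoord_symm _).symm
    _ ≤ ∫⁻ p, box.indicator (fun p => ENNReal.ofReal (energy p)) p :=
        (setLIntegral_mono' polarCoord.open_target.measurableSet hpolar).trans
          (setLIntegral_le_lintegral _ _)
    _ = ENNReal.ofReal (∫ p in box, energy p) := by
        rw [lintegral_indicator hbox]
        exact (ofReal_integral_eq_lintegral_ofReal henergy ((ae_restrict_mem hbox).mono
          fun p hp => mul_nonneg (by positivity) hp.1.1.le)).symm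
    _ ≤ _ := by
        refine ENNReal.ofReal_le_ofReal (le_of_eq_of_le ?_ (integral_polar_energy_le s b))
        rw [Measure.volume_eq_prod, setIntegral_prod _ henergy,
          intervalIntegral.integral_of_le zero_le_one]
        simp_rw [intervalIntegral.integral_of_le (neg_le_self Real.pi_pos.le)]
        rfl

lemma lintegral_ballGradient_le :
    ∫⁻ v, ballGradient (smoothExpansion s b) v
      ≤ ENNReal.ofReal (π * √(∑ k ∈ s, k.mu * b k ^ 2)) := by
  have hnonneg : 0 ≤ ∑ k ∈ s, k.mu * b k ^ 2 :=
    Finset.sum_nonneg fun k _ => mul_nonneg (sq_nonneg _) (sq_nonneg _)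
  have hball : ∫⁻ v, ballGradient (smoothExpansion s b) v
      = ∫⁻ v in Metric.ball (0 : ℂ) 1, ballGradient (smoothExpansion s b) v := by
    simp only [ballGradient]
    rw [← lintegral_indicator measurableSet_ball, Set.indicator_indicator, Set.inter_self]
  refine (ENNReal.pow_le_pow_left_iff two_ne_zero).1 ?_
  rw [hball]
  calc (∫⁻ v in Metric.ball (0 : ℂ) 1, ballGradient (smoothExpansion s b) v) ^ 2
      ≤ volume (Metric.ball (0 : ℂ) 1) * ∫⁻ v, ballGradient (smoothExpansion s b) v ^ 2 := by
        refine (sq_lintegral_le_measure_univ_mul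
          (measurable_ballGradient (contDiff_smoothExpansion s b)).aemeasurable).trans ?_
        rw [Measure.restrict_apply_univ]
        gcongr
        exact Measure.restrict_le_self
    _ ≤ ENNReal.ofReal π * ENNReal.ofReal (π * ∑ k ∈ s, k.mu * b k ^ 2) := by
        rw [Complex.volume_ball, ENNReal.ofReal_one, one_pow, one_mul, ← NNReal.coe_real_pi,
          ENNReal.ofReal_coe_nnreal]
        gcongr
        exact lintegral_ballGradient_sq_le s b
    _ = ENNReal.ofReal (π * √(∑ k ∈ s, k.mu * b k ^ 2)) ^ 2 := by
        rw [← ENNReal.ofReal_mul Real.pi_pos.le, ← ENNReal.ofReal_pow (by positivity), mul_pow,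
          Real.sq_sqrt hnonneg, sq, mul_assoc]

/-- The finite Fourier-Bessel expansion `∑_{k ∈ s} b_k ψ_k`. -/
def finiteExpansion (v : ℂ) : ℝ := ∑ k ∈ s, b k * psi k v

lemma isZeroExtension_finiteExpansion :
    IsZeroExtension (smoothExpansion s b) (finiteExpansion s b) where
  eq_of_norm_le _ hv := Finset.sum_congr rfl fun k _ => by rw [psi_eq_psiSmooth k hv]
  eq_zero_of_le_norm _ hv := Finset.sum_eq_zero fun k _ => by rw [psi_eq_zero k hv, mul_zero]

lemma continuous_psi (k : FBIndex) : Continuous (psi k) := by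
  have hpsi : finiteExpansion {k} 1 = psi k := by
    funext v
    simp [finiteExpansion]
  exact hpsi ▸ (isZeroExtension_finiteExpansion {k} 1).continuous
    (contDiff_smoothExpansion {k} 1).continuous

lemma psiScaled_eq (j : ℝ) (k : FBIndex) (v : ℂ) :
    psiScaled j k v = ((2 : ℝ) ^ (-j)) ^ 2 * psi k ((2 : ℝ) ^ (-j) • v) := by
  rw [psiScaled, ← Real.rpow_mul_natCast zero_le_two, Nat.cast_ofNat, neg_mul, neg_mul, mul_comm j]

lemma sum_mul_psiScaled (j : ℝ) (v : ℂ) :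
    ∑ k ∈ s, b k * psiScaled j k v
      = ((2 : ℝ) ^ (-j)) ^ 2 * finiteExpansion s b ((2 : ℝ) ^ (-j) • v) := by
  simp only [finiteExpansion, Finset.mul_sum, psiScaled_eq, mul_left_comm]

@[fun_prop]
lemma continuous_psiScaled (j : ℝ) (k : FBIndex) : Continuous (psiScaled j k) :=
  continuous_const.mul ((continuous_psi k).comp (continuous_const_smul _))

lemma psiScaled_eq_zero (j : ℝ) (k : FBIndex) {v : ℂ} (hv : 1 ≤ (2 : ℝ) ^ (-j) * ‖v‖) :
    psiScaled j k v = 0 := by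
  rw [psiScaled, psi_eq_zero, mul_zero]
  rwa [norm_smul, Real.norm_of_nonneg (by positivity)]

lemma lintegral_sum_psiScaled_sub_le (j : ℝ) {K : NNReal} {δ : ℝ≥0∞} {T₀ T₁ : ℂ → ℂ}
    (h : IsDeformation ((2 : ℝ) ^ (-j)) K δ T₀ T₁) :
    ∫⁻ v, ‖∑ k ∈ s, b k * psiScaled j k (T₁ v) - ∑ k ∈ s, b k * psiScaled j k (T₀ v)‖ₑ
      ≤ δ * K ^ 2 * ENNReal.ofReal ((2 : ℝ) ^ (-j))
        * ENNReal.ofReal (π * √(∑ k ∈ s, k.mu * b k ^ 2)) := by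
  set c : ℝ := (2 : ℝ) ^ (-j)
  have hc : 0 < c := by positivity
  have hcancel : ENNReal.ofReal c ^ 2 * ((K * c.toNNReal⁻¹ : NNReal) : ℝ≥0∞) ^ 2 = K ^ 2 := by
    rw [ENNReal.ofReal, ← ENNReal.coe_pow, ← ENNReal.coe_pow, ← ENNReal.coe_pow, ← ENNReal.coe_mul,
      ← mul_pow, mul_left_comm, mul_inv_cancel₀ (Real.toNNReal_pos.2 hc).ne', mul_one]
  have hincrement := (isZeroExtension_finiteExpansion s b).lintegral_enorm_sub_le volume
    (contDiff_smoothExpansion s b) (h.const_smul hc)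
  rw [Complex.finrank_real_complex] at hincrement
  simp_rw [sum_mul_psiScaled, ← mul_sub, enorm_mul]
  rw [lintegral_const_mul' _ _ enorm_ne_top, Real.enorm_of_nonneg (sq_nonneg _),
    ENNReal.ofReal_pow hc.le]
  refine (mul_le_mul_right (hincrement.trans (mul_le_mul_right
    (lintegral_ballGradient_le s b) _)) _).trans_eq ?_
  rw [← hcancel]
  ring

/-- The total increment of `W` along every deformation, as a multiple of the constant `A`. -/
def HasDeformationBound (c : ℝ) (A : ℝ≥0∞) (W : ℂ × S1 → ℝ) : Prop :=
  ∀ (K : NNReal) (δ : ℝ≥0∞) (T₀ T₁ : S1 → ℂ → ℂ), Continuous (Function.uncurry T₀) →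
    Continuous (Function.uncurry T₁) → (∀ β, IsDeformation c K δ (T₀ β) (T₁ β)) →
    ∫⁻ β, (∫⁻ v, ‖W (T₁ β v, β) - W (T₀ β v, β)‖ₑ) ∂dS1 ≤ δ * K ^ 2 * ENNReal.ofReal c * A

lemma hasDeformationBound_planar (j : ℝ) :
    HasDeformationBound ((2 : ℝ) ^ (-j)) (ENNReal.ofReal π * fbNorm b)
      fun p => ∑ k ∈ s, b k * psiScaled j k p.1 := by
  intro K δ T₀ T₁ _ _ h
  have hnonneg : ∀ k ∈ s, 0 ≤ k.mu * b k ^ 2 := fun k _ => mul_nonneg (sq_nonneg _) (sq_nonneg _)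
  have hfinite : ENNReal.ofReal (π * √(∑ k ∈ s, k.mu * b k ^ 2))
      ≤ ENNReal.ofReal π * fbNorm b := by
    rw [ENNReal.ofReal_mul Real.pi_pos.le, Real.sqrt_eq_rpow,
      ← ENNReal.ofReal_rpow_of_nonneg (Finset.sum_nonneg hnonneg) (by norm_num),
      ENNReal.ofReal_sum_of_nonneg hnonneg, fbNorm]
    gcongr
    exact ENNReal.sum_le_tsum s
  refine (lintegral_mono fun β => (lintegral_sum_psiScaled_sub_le s b j (h β)).trans
    (mul_le_mul_right hfinite _)).trans_eq ?_
  rw [lintegral_const, measure_univ, mul_one]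

end FiniteExpansion

section AngularSlice

variable {ι : Type*} [DecidableEq ι] (s : Finset (ι × ℤ)) (a : ι × ℤ → ℝ)

/-- The coefficient at the index `k ∈ ι` of the slice `∑_{(k,m) ∈ s} a(k,m) φ_m(β) e_k` of a joint
expansion at the angle `β`. -/
def sliceCoeff (β : S1) (k : ι) : ℝ := ∑ q ∈ s with q.1 = k, a q * fourierReal q.2 β

@[fun_prop]
lemma continuous_sliceCoeff (k : ι) : Continuous fun β => sliceCoeff s a β k := by
  unfold sliceCoeff
  fun_prop

lemma sum_mul_fourierReal_eq_sum_sliceCoeff (e : ι → ℝ) (β : S1) :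
    ∑ q ∈ s, a q * (e q.1 * fourierReal q.2 β)
      = ∑ k ∈ s.image Prod.fst, sliceCoeff s a β k * e k := by
  rw [← Finset.sum_fiberwise_of_maps_to (g := Prod.fst) fun q hq => Finset.mem_image_of_mem _ hq]
  refine Finset.sum_congr rfl fun k _ => ?_
  rw [sliceCoeff, Finset.sum_mul]
  refine Finset.sum_congr rfl fun q hq => ?_
  rw [(Finset.mem_filter.1 hq).2]
  ring

lemma integrable_dS1_of_continuous {f : S1 → ℝ} (hf : Continuous f) : Integrable f dS1 :=
  hf.integrable_of_hasCompactSupport (HasCompactSupport.of_compactSpace _)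

lemma integral_sliceCoeff_sq (k : ι) :
    ∫ β, sliceCoeff s a β k ^ 2 ∂dS1 = ∑ q ∈ s with q.1 = k, a q ^ 2 := by
  simp_rw [sliceCoeff, sq, Finset.sum_mul_sum, mul_mul_mul_comm (a _) (fourierReal _ _)]
  have hcont : ∀ q r : ι × ℤ, Continuous fun β =>
      a q * a r * (fourierReal q.2 β * fourierReal r.2 β) := fun q r => by fun_prop
  rw [integral_finsetSum _ fun q _ =>
    integrable_dS1_of_continuous (continuous_finsetSum _ fun r _ => hcont q r)]
  refine Finset.sum_congr rfl fun q hq => ?_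
  rw [integral_finsetSum _ fun r _ => integrable_dS1_of_continuous (hcont q r)]
  simp_rw [integral_const_mul, integral_fourierReal_mul]
  rw [Finset.sum_eq_single_of_mem q hq, if_pos rfl, mul_one]
  refine fun r hr hrq => ?_
  rw [if_neg fun hm => hrq (Prod.ext
    ((Finset.mem_filter.1 hr).2.trans (Finset.mem_filter.1 hq).2.symm) hm.symm), mul_zero]

lemma integral_sum_mul_sliceCoeff_sq (w : ι → ℝ) :
    ∫ β, ∑ k ∈ s.image Prod.fst, w k * sliceCoeff s a β k ^ 2 ∂dS1
      = ∑ q ∈ s, w q.1 * a q ^ 2 := by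
  rw [integral_finsetSum _ fun k _ => integrable_dS1_of_continuous (by fun_prop),
    ← Finset.sum_fiberwise_of_maps_to (g := Prod.fst) fun q hq => Finset.mem_image_of_mem _ hq]
  simp_rw [integral_const_mul, integral_sliceCoeff_sq, Finset.mul_sum]
  exact Finset.sum_congr rfl fun k _ => Finset.sum_congr rfl fun q hq => by
    rw [(Finset.mem_filter.1 hq).2]

end AngularSlice

section JointExpansion

variable (s : Finset (FBIndex × ℤ)) (a : FBIndex × ℤ → ℝ)

lemma lintegral_sqrt_sliceCoeff_le :
    ∫⁻ β, ENNReal.ofReal (√(∑ k ∈ s.image Prod.fst, k.mu * sliceCoeff s a β k ^ 2)) ∂dS1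
      ≤ fbNormJoint a := by
  have hcont : Continuous fun β => ∑ k ∈ s.image Prod.fst, k.mu * sliceCoeff s a β k ^ 2 := by
    fun_prop
  have hnonneg : ∀ β, 0 ≤ ∑ k ∈ s.image Prod.fst, k.mu * sliceCoeff s a β k ^ 2 := fun β =>
    Finset.sum_nonneg fun k _ => mul_nonneg (sq_nonneg _) (sq_nonneg _)
  have hsq : (∫⁻ β, ENNReal.ofReal
      (√(∑ k ∈ s.image Prod.fst, k.mu * sliceCoeff s a β k ^ 2)) ∂dS1) ^ 2
      ≤ ∑' k : FBIndex, ∑' m : ℤ, ENNReal.ofReal (k.mu * a (k, m) ^ 2) :=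
    calc _ ≤ ∫⁻ β, ENNReal.ofReal (∑ k ∈ s.image Prod.fst, k.mu * sliceCoeff s a β k ^ 2) ∂dS1 := by
          refine (sq_lintegral_le_measure_univ_mul
            hcont.sqrt.measurable.ennreal_ofReal.aemeasurable).trans_eq ?_
          simp_rw [← ENNReal.ofReal_pow (Real.sqrt_nonneg _), Real.sq_sqrt (hnonneg _)]
          rw [measure_univ, one_mul]
      _ = ∑ q ∈ s, ENNReal.ofReal (q.1.mu * a q ^ 2) := by
          rw [← ofReal_integral_eq_lintegral_ofReal (integrable_dS1_of_continuous hcont)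
            (ae_of_all _ hnonneg), integral_sum_mul_sliceCoeff_sq s a FBIndex.mu,
            ENNReal.ofReal_sum_of_nonneg fun q _ => mul_nonneg (sq_nonneg q.1.root) (sq_nonneg _)]
      _ ≤ _ := by
          rw [← ENNReal.tsum_prod (f := fun k m => ENNReal.ofReal (FBIndex.mu k * a (k, m) ^ 2))]
          exact ENNReal.sum_le_tsum s
  rw [fbNormJoint]
  refine (ENNReal.le_rpow_inv_iff two_pos).2 ?_ |>.trans_eq (by rw [one_div])
  rwa [ENNReal.rpow_two]

lemma hasDeformationBound_joint (j : ℝ) :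
    HasDeformationBound ((2 : ℝ) ^ (-j)) (ENNReal.ofReal π * fbNormJoint a)
      fun p => ∑ q ∈ s, a q * psiJoint j q p := by
  intro K δ T₀ T₁ _ _ h
  have hslice : ∀ v β, ∑ q ∈ s, a q * psiJoint j q (v, β)
      = ∑ k ∈ s.image Prod.fst, sliceCoeff s a β k * psiScaled j k v := fun v β =>
    sum_mul_fourierReal_eq_sum_sliceCoeff s a (fun k => psiScaled j k v) β
  simp only [hslice]
  refine (lintegral_mono fun β => lintegral_sum_psiScaled_sub_le _ _ j (h β)).trans ?_
  simp_rw [ENNReal.ofReal_mul Real.pi_pos.le]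
  have hmeas : Measurable fun β => ENNReal.ofReal
      (√(∑ k ∈ s.image Prod.fst, k.mu * sliceCoeff s a β k ^ 2)) :=
    (by fun_prop : Continuous fun β =>
      √(∑ k ∈ s.image Prod.fst, k.mu * sliceCoeff s a β k ^ 2)).measurable.ennreal_ofReal
  rw [lintegral_const_mul _ (hmeas.const_mul _), lintegral_const_mul _ hmeas]
  gcongr
  exact lintegral_sqrt_sliceCoeff_le s a

end JointExpansion

/-! ### Filters: `L²` limits of finite expansions -/

section L2Limits

variable {X ι : Type*} [MeasurableSpace X] {μ : Measure X} {f : X → ℝ} {D : Set X}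

lemma eLpNorm_two_sq (μ : Measure X) (f : X → ℝ) :
    eLpNorm f 2 μ ^ 2 = ∫⁻ x, ‖f x‖ₑ ^ 2 ∂μ := by
  simpa using eLpNorm_nnreal_pow_eq_lintegral (f := f) (μ := μ) (p := 2) two_ne_zero

lemma eLpNorm_le_eLpNorm_mul_rpow_measure_of_support_subset {p q : ℝ≥0∞} (hpq : p ≤ q)
    (hf : AEStronglyMeasurable f μ) (hD : Function.support f ⊆ D) :
    eLpNorm f p μ ≤ eLpNorm f q μ * μ D ^ (1 / p.toReal - 1 / q.toReal) := by
  rw [← eLpNorm_restrict_eq_of_support_subset hD (p := p),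
    ← eLpNorm_restrict_eq_of_support_subset hD (p := q), ← Measure.restrict_apply_univ]
  exact eLpNorm_le_eLpNorm_mul_rpow_measure_univ hpq hf.restrict

variable {l : Filter ι} [l.NeBot] {V : ι → X → ℝ}

lemma indicator_ae_eq_of_tendsto_eLpNorm {p : ℝ≥0∞} (hp : p ≠ 0)
    (hf : AEStronglyMeasurable f μ) (hD : MeasurableSet D)
    (hV : ∀ i, Function.support (V i) ⊆ D)
    (hlim : Tendsto (fun i => eLpNorm (fun x => f x - V i x) p μ) l (𝓝 0)) :
    D.indicator f =ᵐ[μ] f := by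
  have hle : ∀ i, eLpNorm (Dᶜ.indicator f) p μ ≤ eLpNorm (fun x => f x - V i x) p μ := fun i => by
    refine le_of_eq_of_le ?_ (eLpNorm_indicator_le (s := Dᶜ) _)
    congr 1
    refine Set.indicator_congr fun x hx => ?_
    rw [Function.notMem_support.1 fun h => hx (hV i h), sub_zero]
  have hzero : Dᶜ.indicator f =ᵐ[μ] 0 :=
    (eLpNorm_eq_zero_iff (hf.indicator hD.compl) hp).1
      (le_antisymm (ge_of_tendsto' hlim hle) zero_le)
  filter_upwards [hzero] with x hx
  rw [← Set.indicator_self_add_compl_apply D f x, hx, Pi.zero_apply, add_zero]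

end L2Limits

section DeformationBound

lemma lintegral_enorm_translate_sub {E : Type*} [NormedAddCommGroup E] [MeasurableSpace E]
    [BorelSpace E] (μ : Measure E) [μ.IsAddRightInvariant] {f : E → ℝ} (hf : Measurable f) {R : ℝ}
    (hsupp : ∀ v, R ≤ ‖v‖ → f v = 0) {w : E} (hw : 2 * R ≤ ‖w‖) :
    ∫⁻ v, ‖f (v + w) - f v‖ₑ ∂μ = 2 * ∫⁻ v, ‖f v‖ₑ ∂μ := by
  have hdisjoint : ∀ v, ‖f (v + w) - f v‖ₑ = ‖f (v + w)‖ₑ + ‖f v‖ₑ := fun v => by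
    rcases le_or_gt R ‖v‖ with hv | hv
    · rw [hsupp v hv, sub_zero, enorm_zero, add_zero]
    · have htriangle : ‖w‖ ≤ ‖v + w‖ + ‖v‖ := by simpa using norm_sub_le (v + w) v
      rw [hsupp (v + w) (by linarith), zero_sub, enorm_neg, enorm_zero, zero_add]
  simp_rw [hdisjoint]
  rw [lintegral_add_right _ hf.enorm, lintegral_add_right_eq_self (fun v => ‖f v‖ₑ) w, two_mul]

lemma isDeformation_translation {E : Type*} [NormedAddCommGroup E] [NormedSpace ℝ E] (c : ℝ)
    (w : E) : IsDeformation c 1 ‖w‖ₑ (fun v => v) fun v => v + w where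
  continuous₀ := continuous_id
  continuous₁ := by fun_prop
  antilipschitz s _ := AntilipschitzWith.of_le_mul_dist fun x y => by simp
  close s _ v _ := by rw [add_sub_cancel_left]

lemma lintegral_dPlaneS1 {f : ℂ × S1 → ℝ≥0∞} (hf : Measurable f) :
    ∫⁻ p, f p ∂dPlaneS1 = ∫⁻ β, (∫⁻ v, f (v, β)) ∂dS1 :=
  lintegral_prod_symm _ hf.aemeasurable

variable {c : ℝ} {A : ℝ≥0∞} {W : ℂ × S1 → ℝ}

/-- A filter supported in the disk of radius `1 / c` is moved off itself by a translation, so its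
`L¹` norm is controlled by its increments. -/
lemma HasDeformationBound.lintegral_le (hc : 0 < c) (hW : Measurable W)
    (hsupp : ∀ p : ℂ × S1, 1 ≤ c * ‖p.1‖ → W p = 0) (h : HasDeformationBound c A W) :
    ∫⁻ p, ‖W p‖ₑ ∂dPlaneS1 ≤ A := by
  have hw : ‖((2 / c : ℝ) : ℂ)‖ = 2 / c := by
    rw [Complex.norm_real, Real.norm_of_nonneg (by positivity)]
  have htranslate := h 1 _ (fun _ v => v) (fun _ v => v + ((2 / c : ℝ) : ℂ)) continuous_snd
    (continuous_snd.add continuous_const) fun _ => isDeformation_translation c _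
  have hdouble : ∀ β, ∫⁻ v, ‖W (v + ((2 / c : ℝ) : ℂ), β) - W (v, β)‖ₑ
      = 2 * ∫⁻ v, ‖W (v, β)‖ₑ := fun β =>
    lintegral_enorm_translate_sub volume (R := 1 / c) (hW.comp measurable_prodMk_right)
      (fun v hv => hsupp (v, β) ((div_le_iff₀' hc).1 hv)) (by rw [hw, mul_one_div])
  have htwo : ‖((2 / c : ℝ) : ℂ)‖ₑ * ENNReal.ofReal c = 2 := by
    rw [← ofReal_norm, hw, ← ENNReal.ofReal_mul (by positivity), div_mul_cancel₀ _ hc.ne',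
      ENNReal.ofReal_ofNat]
  simp_rw [hdouble] at htranslate
  rw [lintegral_const_mul' _ _ (by simp), ← lintegral_dPlaneS1 hW.enorm, ENNReal.coe_one,
    one_pow, mul_one, htwo] at htranslate
  exact (ENNReal.mul_le_mul_iff_right two_ne_zero (by simp)).1 htranslate

lemma lintegral_comp_fiberwise_le {K : NNReal} {T : S1 → ℂ → ℂ}
    (hT : ∀ β, AntilipschitzWith K (T β)) (hcont : Continuous (Function.uncurry T))
    {f : ℂ × S1 → ℝ≥0∞} (hf : Measurable f) :
    ∫⁻ β, (∫⁻ v, f (T β v, β)) ∂dS1 ≤ (K : ℝ≥0∞) ^ 2 * ∫⁻ p, f p ∂dPlaneS1 := by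
  rw [lintegral_dPlaneS1 hf, ← lintegral_const_mul' _ _ (by simp)]
  refine lintegral_mono fun β => ?_
  have hTβ : Measurable (T β) := (hcont.comp (.prodMk_right β)).measurable
  simpa only [Complex.finrank_real_complex] using lintegral_comp_le_of_antilipschitz volume
    (hT β) hTβ (f := fun v => f (v, β)) (hf.comp measurable_prodMk_right)

lemma lintegral_increment_le {V : ℂ × S1 → ℝ} (hW : Measurable W) (hV : Measurable V)
    {K : NNReal} {T₀ T₁ : S1 → ℂ → ℂ} (hcont₀ : Continuous (Function.uncurry T₀))
    (hcont₁ : Continuous (Function.uncurry T₁)) (hT₀ : ∀ β, AntilipschitzWith K (T₀ β))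
    (hT₁ : ∀ β, AntilipschitzWith K (T₁ β)) :
    ∫⁻ β, (∫⁻ v, ‖W (T₁ β v, β) - W (T₀ β v, β)‖ₑ) ∂dS1
      ≤ ∫⁻ β, (∫⁻ v, ‖V (T₁ β v, β) - V (T₀ β v, β)‖ₑ) ∂dS1
        + 2 * K ^ 2 * ∫⁻ p, ‖W p - V p‖ₑ ∂dPlaneS1 := by
  have hdiff : Measurable fun p => ‖W p - V p‖ₑ := (hW.sub hV).enorm
  have hmeas : ∀ {T : S1 → ℂ → ℂ}, Continuous (Function.uncurry T) →
      Measurable fun p : S1 × ℂ => ‖W (T p.1 p.2, p.1) - V (T p.1 p.2, p.1)‖ₑ := fun hT =>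
    hdiff.comp (hT.measurable.prodMk measurable_fst)
  have htriangle : ∀ p q, ‖W p - W q‖ₑ ≤ ‖V p - V q‖ₑ + ‖W p - V p‖ₑ + ‖W q - V q‖ₑ :=
    fun p q => by
      rw [show W p - W q = V p - V q + (W p - V p) - (W q - V q) by ring]
      exact enorm_sub_le.trans (add_le_add_left (enorm_add_le _ _) _)
  refine (lintegral_mono fun β => lintegral_mono fun v => htriangle _ _).trans ?_
  have hsplit : ∀ β, ∫⁻ v, (‖V (T₁ β v, β) - V (T₀ β v, β)‖ₑ
        + ‖W (T₁ β v, β) - V (T₁ β v, β)‖ₑ + ‖W (T₀ β v, β) - V (T₀ β v, β)‖ₑ)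
      = (∫⁻ v, ‖V (T₁ β v, β) - V (T₀ β v, β)‖ₑ)
        + (∫⁻ v, ‖W (T₁ β v, β) - V (T₁ β v, β)‖ₑ)
        + ∫⁻ v, ‖W (T₀ β v, β) - V (T₀ β v, β)‖ₑ := fun β => by
    rw [lintegral_add_right _ (by exact (hmeas hcont₀).comp measurable_prodMk_left),
      lintegral_add_right _ (by exact (hmeas hcont₁).comp measurable_prodMk_left)]
  simp_rw [hsplit]
  rw [lintegral_add_right _ (hmeas hcont₀).lintegral_prod_right',
    lintegral_add_right _ (hmeas hcont₁).lintegral_prod_right', add_assoc, mul_assoc,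
    two_mul (_ : ℝ≥0∞)]
  gcongr
  · exact lintegral_comp_fiberwise_le hT₁ hcont₁ hdiff
  · exact lintegral_comp_fiberwise_le hT₀ hcont₀ hdiff

variable {ι : Type*} {l : Filter ι} [l.NeBot] {V : ι → ℂ × S1 → ℝ}

lemma HasDeformationBound.of_tendsto (hW : Measurable W) (hV : ∀ i, Measurable (V i))
    (hbound : ∀ i, HasDeformationBound c A (V i))
    (hlim : Tendsto (fun i => ∫⁻ p, ‖W p - V i p‖ₑ ∂dPlaneS1) l (𝓝 0)) :
    HasDeformationBound c A W := by
  intro K δ T₀ T₁ hT₀ hT₁ h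
  have hconst : Tendsto (fun i => δ * K ^ 2 * ENNReal.ofReal c * A
      + 2 * K ^ 2 * ∫⁻ p, ‖W p - V i p‖ₑ ∂dPlaneS1) l (𝓝 (δ * K ^ 2 * ENNReal.ofReal c * A)) := by
    simpa using tendsto_const_nhds.add
      (ENNReal.Tendsto.const_mul hlim (.inr (by finiteness : 2 * (K : ℝ≥0∞) ^ 2 ≠ ∞)))
  refine ge_of_tendsto' hconst fun i => (lintegral_increment_le hW (hV i) hT₀ hT₁
    (fun β => (h β).antilipschitz₀) fun β => (h β).antilipschitz₁).trans ?_
  gcongr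
  exact hbound i K δ T₀ T₁ hT₀ hT₁ h

lemma measure_norm_fst_lt_lt_top (hc : 0 < c) :
    dPlaneS1 {p : ℂ × S1 | c * ‖p.1‖ < 1} < ∞ := by
  have hball : {p : ℂ × S1 | c * ‖p.1‖ < 1} = Metric.ball (0 : ℂ) (1 / c) ×ˢ Set.univ := by
    ext p
    simp only [Set.mem_ofPred_eq, Set.mem_prod, mem_ball_zero_iff, Set.mem_univ, and_true,
      lt_div_iff₀' hc]
  rw [hball, Measure.prod_prod, measure_univ, mul_one]
  exact measure_ball_lt_top

/-- What the network analysis uses of a filter: `L¹` size and increments along deformations, both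
controlled by `A`, where `c` is the inverse of the radius of the support. -/
structure FilterBound (c : ℝ) (A : ℝ≥0∞) (W : ℂ × S1 → ℝ) : Prop where
  measurable : Measurable W
  memLp : MemLp W 2 dPlaneS1
  integrable : Integrable W dPlaneS1
  lintegral_le : ∫⁻ p, ‖W p‖ₑ ∂dPlaneS1 ≤ A
  deformation : HasDeformationBound c A W

/-- On the common support, which has finite measure, `L²` convergence implies `L¹` convergence. -/
lemma exists_filterBound_of_tendsto (hc : 0 < c) (hW : MemLp W 2 dPlaneS1)
    (hV : ∀ i, Measurable (V i)) (hsupp : ∀ i, ∀ p : ℂ × S1, 1 ≤ c * ‖p.1‖ → V i p = 0)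
    (hbound : ∀ i, HasDeformationBound c A (V i))
    (hlim : Tendsto (fun i => eLpNorm (fun p => W p - V i p) 2 dPlaneS1) l (𝓝 0)) :
    ∃ W' : ℂ × S1 → ℝ, W' =ᵐ[dPlaneS1] W ∧ FilterBound c A W' := by
  set D : Set (ℂ × S1) := {p | c * ‖p.1‖ < 1}
  have hD : MeasurableSet D := (isOpen_lt (by fun_prop) continuous_const).measurableSet
  have hDfin : dPlaneS1 D < ∞ := measure_norm_fst_lt_lt_top hc
  have hVD : ∀ i, Function.support (V i) ⊆ D := fun i p hp =>
    not_le.1 fun h => hp (hsupp i p h)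
  set W' : ℂ × S1 → ℝ := D.indicator (hW.1.mk W)
  have hW' : Measurable W' := hW.1.stronglyMeasurable_mk.measurable.indicator hD
  have hae : W' =ᵐ[dPlaneS1] W := (hW.1.ae_eq_mk.symm.indicator (s := D)).trans
    (indicator_ae_eq_of_tendsto_eLpNorm two_ne_zero hW.1 hD hVD hlim)
  have hW'D : Function.support W' ⊆ D := Set.support_indicator_subset
  have hmemLp : MemLp W' 2 dPlaneS1 := hW.ae_eq hae.symm
  have hL1 : ∀ i, ∫⁻ p, ‖W' p - V i p‖ₑ ∂dPlaneS1
      ≤ eLpNorm (fun p => W p - V i p) 2 dPlaneS1 * dPlaneS1 D ^ (1 / 2 : ℝ) := fun i => by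
    have hcongr : eLpNorm (fun p => W' p - V i p) 2 dPlaneS1
        = eLpNorm (fun p => W p - V i p) 2 dPlaneS1 :=
      eLpNorm_congr_ae (hae.sub (.refl _ (V i)))
    rw [← eLpNorm_one_eq_lintegral_enorm, ← hcongr]
    refine (eLpNorm_le_eLpNorm_mul_rpow_measure_of_support_subset one_le_two
      (hW'.sub (hV i)).aestronglyMeasurable ((Function.support_sub _ _).trans
        (Set.union_subset hW'D (hVD i)))).trans_eq ?_
    norm_num
    rfl
  have hlim1 : Tendsto (fun i => ∫⁻ p, ‖W' p - V i p‖ₑ ∂dPlaneS1) l (𝓝 0) := by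
    have hfin : dPlaneS1 D ^ (1 / 2 : ℝ) ≠ ∞ := by finiteness
    refine tendsto_of_tendsto_of_tendsto_of_le_of_le tendsto_const_nhds ?_ (fun _ => zero_le) hL1
    simpa using ENNReal.Tendsto.mul_const hlim (.inr hfin)
  have hdeform : HasDeformationBound c A W' := .of_tendsto hW' hV hbound hlim1
  refine ⟨W', hae, hW', hmemLp, ?_, hdeform.lintegral_le hc hW'
    fun p hp => Set.indicator_of_notMem (show p ∉ D from hp.not_gt) _, hdeform⟩
  have : IsFiniteMeasure (dPlaneS1.restrict D) := ⟨by rwa [Measure.restrict_apply_univ]⟩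
  exact (integrableOn_iff_integrable_of_support_subset hW'D).1
    ((hmemLp.restrict D).integrable one_le_two)

end DeformationBound

@[fun_prop]
lemma continuous_psiJoint (j : ℝ) (q : FBIndex × ℤ) : Continuous (psiJoint j q) := by
  unfold psiJoint
  fun_prop

lemma exists_filterBound_joint (j : ℝ) (a : FBIndex × ℤ → ℝ) {W : ℂ × S1 → ℝ}
    (h : IsL2Expansion dPlaneS1 a (psiJoint j) W) :
    ∃ W' : ℂ × S1 → ℝ, W' =ᵐ[dPlaneS1] W ∧
      FilterBound ((2 : ℝ) ^ (-j)) (ENNReal.ofReal π * fbNormJoint a) W' := by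
  have hcont : ∀ s : Finset (FBIndex × ℤ), Continuous fun p => ∑ q ∈ s, a q * psiJoint j q p :=
    fun s => by fun_prop
  exact exists_filterBound_of_tendsto (by positivity) h.1 (fun s => (hcont s).measurable)
    (fun s p hp => Finset.sum_eq_zero fun q _ => by
      rw [psiJoint, psiScaled_eq_zero j q.1 hp, zero_mul, mul_zero])
    (fun s => hasDeformationBound_joint s a j) h.2

lemma exists_filterBound_planar (j : ℝ) (a : FBIndex → ℝ) {W : ℂ → ℝ}
    (h : IsL2Expansion volume a (psiScaled j) W) :
    ∃ W' : ℂ × S1 → ℝ, W' =ᵐ[dPlaneS1] (fun p => W p.1) ∧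
      FilterBound ((2 : ℝ) ^ (-j)) (ENNReal.ofReal π * fbNorm a) W' := by
  have hfst : MeasurePreserving (Prod.fst : ℂ × S1 → ℂ) dPlaneS1 volume := measurePreserving_fst
  have hcont : ∀ s : Finset FBIndex, Continuous fun v => ∑ k ∈ s, a k * psiScaled j k v :=
    fun s => by fun_prop
  have hnorm : ∀ s : Finset FBIndex,
      eLpNorm (fun p : ℂ × S1 => W p.1 - ∑ k ∈ s, a k * psiScaled j k p.1) 2 dPlaneS1
        = eLpNorm (fun v => W v - ∑ k ∈ s, a k * psiScaled j k v) 2 volume := fun s =>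
    eLpNorm_comp_measurePreserving (g := fun v => W v - ∑ k ∈ s, a k * psiScaled j k v)
      (h.1.1.sub (hcont s).aestronglyMeasurable) hfst
  exact exists_filterBound_of_tendsto (by positivity) (h.1.comp_measurePreserving hfst)
    (fun s => ((hcont s).comp continuous_fst).measurable)
    (fun s p (hp : 1 ≤ (2 : ℝ) ^ (-j) * ‖p.1‖) => Finset.sum_eq_zero fun k _ => by
      rw [psiScaled_eq_zero j k hp, mul_zero])
    (fun s => hasDeformationBound_planar s a j) (h.2.congr fun s => (hnorm s).symm)

/-! ### Rotations -/

lemma coe_rotation_toCircle (t : S1) : ⇑(rotation (AddCircle.toCircle t)) = rot t := rfl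

lemma rot_sub (t : S1) (v w : ℂ) : rot t (v - w) = rot t v - rot t w := mul_sub _ _ _

lemma rot_rot (s t : S1) (v : ℂ) : rot s (rot t v) = rot (s + t) v := by
  simp only [rot, AddCircle.toCircle_add, Circle.coe_mul, mul_assoc]

@[fun_prop]
lemma continuous_rot_comp {X : Type*} [TopologicalSpace X] {f : X → S1} {g : X → ℂ}
    (hf : Continuous f) (hg : Continuous g) : Continuous fun x => rot (f x) (g x) :=
  (continuous_subtype_val.comp (AddCircle.continuous_toCircle.comp hf)).mul hg

lemma measurePreserving_rot (t : S1) : MeasurePreserving (rot t) volume volume :=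
  (rotation (AddCircle.toCircle t)).measurePreserving

lemma antilipschitzWith_rot_comp {K : NNReal} {P : ℂ → ℂ} (h : AntilipschitzWith K P) (t : S1) :
    AntilipschitzWith K fun v => rot t (P v) := by
  simpa only [mul_one, Function.comp_def, coe_rotation_toCircle] using
    (rotation (AddCircle.toCircle t)).isometry.antilipschitz.comp h

lemma IsDeformation.linearIsometry_comp {E : Type*} [NormedAddCommGroup E] [NormedSpace ℝ E]
    {c : ℝ} {K : NNReal} {δ : ℝ≥0∞} {T₀ T₁ : E → E} (h : IsDeformation c K δ T₀ T₁)
    (e : E →ₗᵢ[ℝ] E) : IsDeformation c K δ (fun v => e (T₀ v)) fun v => e (T₁ v) := by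
  have hmap : ∀ (s : ℝ) v, e (T₀ v) + s • (e (T₁ v) - e (T₀ v))
      = e (T₀ v + s • (T₁ v - T₀ v)) := fun s v => by
    rw [map_add, map_smul, map_sub]
  refine ⟨e.continuous.comp h.continuous₀, e.continuous.comp h.continuous₁, fun s hs => ?_,
    fun s hs v hv => ?_⟩
  · simp_rw [hmap]
    simpa only [mul_one, Function.comp_def] using
      e.isometry.antilipschitz.comp (h.antilipschitz s hs)
  · rw [hmap, e.norm_map] at hv
    rw [← map_sub, e.enorm_map]
    exact h.close s hs v hv

/-! ### Integrals of rotated filters -/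

lemma lintegral_dPlaneS1_sub_right {f : ℂ × S1 → ℝ≥0∞} (hf : Measurable f) (α : S1) :
    ∫⁻ p, f (p.1, p.2 - α) ∂dPlaneS1 = ∫⁻ p, f p ∂dPlaneS1 :=
  ((MeasurePreserving.id volume).prod (measurePreserving_sub_right dS1 α)).lintegral_comp hf

lemma lintegral_dPlaneS1_sub_left {f : ℂ × S1 → ℝ≥0∞} (hf : Measurable f) (α : S1) :
    ∫⁻ p, f (p.1, α - p.2) ∂dPlaneS1 = ∫⁻ p, f p ∂dPlaneS1 :=
  ((MeasurePreserving.id volume).prod (Measure.measurePreserving_sub_left dS1 α)).lintegral_comp hf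

section RotatedFilter

variable {θ : S1 → S1} {K : NNReal}

lemma measurable_rot_comp (hθ : Continuous θ) {P : ℂ → ℂ} (hP : Continuous P) :
    Measurable fun p : ℂ × S1 => (rot (θ p.2) (P p.1), p.2) :=
  (by fun_prop : Continuous fun p : ℂ × S1 => (rot (θ p.2) (P p.1), p.2)).measurable

lemma lintegral_rot_comp_le (hθ : Continuous θ) {P : ℂ → ℂ} (hP : Continuous P)
    (hK : AntilipschitzWith K P) {f : ℂ × S1 → ℝ≥0∞} (hf : Measurable f) :
    ∫⁻ p : ℂ × S1, f (rot (θ p.2) (P p.1), p.2) ∂dPlaneS1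
      ≤ (K : ℝ≥0∞) ^ 2 * ∫⁻ p, f p ∂dPlaneS1 := by
  rw [lintegral_dPlaneS1 (by exact hf.comp (measurable_rot_comp hθ hP))]
  exact lintegral_comp_fiberwise_le (T := fun β v => rot (θ β) (P v))
    (fun β => antilipschitzWith_rot_comp hK (θ β)) (by fun_prop) hf

lemma lintegral_rot_comp_sub_right_le {P : ℂ → ℂ} (hP : Continuous P)
    (hK : AntilipschitzWith K P) {f : ℂ × S1 → ℝ≥0∞} (hf : Measurable f) (α : S1) :
    ∫⁻ p : ℂ × S1, f (rot α (P p.1), p.2 - α) ∂dPlaneS1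
      ≤ (K : ℝ≥0∞) ^ 2 * ∫⁻ p, f p ∂dPlaneS1 :=
  (lintegral_dPlaneS1_sub_right (hf.comp (measurable_rot_comp continuous_const hP)) α).trans_le
    (lintegral_rot_comp_le continuous_const hP hK hf)

lemma lintegral_rot_comp_sub_left_le {P : ℂ → ℂ} (hP : Continuous P)
    (hK : AntilipschitzWith K P) {f : ℂ × S1 → ℝ≥0∞} (hf : Measurable f) (α : S1) :
    ∫⁻ p : ℂ × S1, f (rot p.2 (P p.1), α - p.2) ∂dPlaneS1
      ≤ (K : ℝ≥0∞) ^ 2 * ∫⁻ p, f p ∂dPlaneS1 := by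
  have hθ : Continuous fun β => α - β := by fun_prop
  have hswap := lintegral_dPlaneS1_sub_left (f := fun p => f (rot (α - p.2) (P p.1), p.2))
    (hf.comp (measurable_rot_comp hθ hP)) α
  simp only [sub_sub_cancel] at hswap
  exact hswap.trans_le (lintegral_rot_comp_le hθ hP hK hf)

namespace FilterBound

variable {c : ℝ} {A : ℝ≥0∞} {W : ℂ × S1 → ℝ} {δ : ℝ≥0∞} {P₀ P₁ : ℂ → ℂ}

lemma measurable_enorm_rot_sub (hW : FilterBound c A W) (h : IsDeformation c K δ P₀ P₁)
    (hθ : Continuous θ) : Measurable fun p : ℂ × S1 =>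
      ‖W (rot (θ p.2) (P₁ p.1), p.2) - W (rot (θ p.2) (P₀ p.1), p.2)‖ₑ :=
  ((hW.measurable.comp (measurable_rot_comp hθ h.continuous₁)).sub
    (hW.measurable.comp (measurable_rot_comp hθ h.continuous₀))).enorm

lemma lintegral_rot_sub_le (hW : FilterBound c A W) (h : IsDeformation c K δ P₀ P₁)
    (hθ : Continuous θ) :
    ∫⁻ p : ℂ × S1, ‖W (rot (θ p.2) (P₁ p.1), p.2) - W (rot (θ p.2) (P₀ p.1), p.2)‖ₑ ∂dPlaneS1
      ≤ δ * K ^ 2 * ENNReal.ofReal c * A := by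
  have hP₀ := h.continuous₀
  have hP₁ := h.continuous₁
  rw [lintegral_dPlaneS1 (hW.measurable_enorm_rot_sub h hθ)]
  exact hW.deformation K δ (fun β v => rot (θ β) (P₀ v)) (fun β v => rot (θ β) (P₁ v))
    (by fun_prop) (by fun_prop) fun β =>
      h.linearIsometry_comp (rotation (AddCircle.toCircle (θ β))).toLinearIsometry

lemma lintegral_rot_sub_sub_right_le (hW : FilterBound c A W) (h : IsDeformation c K δ P₀ P₁)
    (α : S1) :
    ∫⁻ p : ℂ × S1, ‖W (rot α (P₁ p.1), p.2 - α) - W (rot α (P₀ p.1), p.2 - α)‖ₑ ∂dPlaneS1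
      ≤ δ * K ^ 2 * ENNReal.ofReal c * A := by
  have hmeas := hW.measurable_enorm_rot_sub h (continuous_const (y := α))
  have hbound := hW.lintegral_rot_sub_le h (continuous_const (y := α))
  exact (lintegral_dPlaneS1_sub_right hmeas α).trans_le hbound

lemma lintegral_rot_sub_sub_left_le (hW : FilterBound c A W) (h : IsDeformation c K δ P₀ P₁)
    (α : S1) :
    ∫⁻ p : ℂ × S1, ‖W (rot p.2 (P₁ p.1), α - p.2) - W (rot p.2 (P₀ p.1), α - p.2)‖ₑ ∂dPlaneS1
      ≤ δ * K ^ 2 * ENNReal.ofReal c * A := by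
  have hθ : Continuous fun β => α - β := by fun_prop
  have hswap := lintegral_dPlaneS1_sub_left
    (f := fun p => ‖W (rot (α - p.2) (P₁ p.1), p.2) - W (rot (α - p.2) (P₀ p.1), p.2)‖ₑ)
    (hW.measurable_enorm_rot_sub h hθ) α
  simp only [sub_sub_cancel] at hswap
  exact hswap.trans_le (hW.lintegral_rot_sub_le h hθ)

end FilterBound

end RotatedFilter

/-! ### The diffeomorphism `u ↦ u - τ u` -/

section Diffeomorphism

variable {E : Type*} [NormedAddCommGroup E] {τ : E → E} {ε K : NNReal}

lemma surjective_sub_of_lipschitzWith [CompleteSpace E] (hε : ε < 1) (hL : LipschitzWith ε τ) :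
    Function.Surjective fun v => v - τ v := fun w => by
  have hcontr : ContractingWith ε fun v => w + τ v :=
    ⟨hε, by simpa using (LipschitzWith.const w).add hL⟩
  exact ⟨hcontr.fixedPoint, sub_eq_of_eq_add hcontr.fixedPoint_isFixedPt.symm⟩

variable [NormedSpace ℝ E]

lemma antilipschitzWith_sub_smul (hε : ε < 1) (hτ : LipschitzWith ε τ) {s : ℝ}
    (hs : s ∈ Set.Icc (0 : ℝ) 1) : AntilipschitzWith (1 - ε)⁻¹ fun v => v - s • τ v := by
  have hsmul : LipschitzWith ε fun v => -(s • τ v) := LipschitzWith.of_dist_le_mul fun x y => by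
    rw [dist_neg_neg, dist_smul₀, Real.norm_of_nonneg hs.1]
    exact (mul_le_of_le_one_left dist_nonneg hs.2).trans (hτ.dist_le_mul x y)
  simpa [sub_eq_add_neg] using AntilipschitzWith.id.add_lipschitzWith hsmul (by simpa using hε)

section Deformations

variable (hK : ∀ s ∈ Set.Icc (0 : ℝ) 1, AntilipschitzWith K fun v => v - s • τ v)
include hK

lemma isDeformation_commutator_left (hτ : LipschitzWith ε τ) {c : ℝ} (hc : 0 < c) (u : E) :
    IsDeformation c K (ENNReal.ofReal (K * ε / c)) (fun v => v - u)
      fun v => v - τ v - (u - τ u) := by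
  have hτc := hτ.continuous
  have hline : ∀ (s : ℝ) v, v - u + s • (v - τ v - (u - τ u) - (v - u))
      = (v - s • τ v) - (u - s • τ u) := fun s v => by module
  refine ⟨by fun_prop, by fun_prop, fun s hs => ?_, fun s hs v hv => ?_⟩
  · simp_rw [hline]
    refine AntilipschitzWith.of_le_mul_dist fun x y => ?_
    rw [dist_sub_right]
    exact (hK s hs).le_mul_dist x y
  · rw [hline, ← dist_eq_norm] at hv
    have hdiff : v - τ v - (u - τ u) - (v - u) = τ u - τ v := by abel
    rw [hdiff, ← ofReal_norm, ← dist_eq_norm, dist_comm]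
    refine ENNReal.ofReal_le_ofReal ((le_div_iff₀ hc).2 ?_)
    calc dist (τ v) (τ u) * c ≤ ε * (K * dist (v - s • τ v) (u - s • τ u)) * c := by
          gcongr
          exact (hτ.dist_le_mul v u).trans (by gcongr; exact (hK s hs).le_mul_dist v u)
      _ = K * ε * (c * dist (v - s • τ v) (u - s • τ u)) := by ring
      _ ≤ K * ε := mul_le_of_le_one_right (by positivity) hv.le

lemma isDeformation_commutator_right (hτ : LipschitzWith ε τ) {c : ℝ} (hc : 0 < c) (v : E) :
    IsDeformation c K (ENNReal.ofReal (K * ε / c)) (fun u => v - u)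
      fun u => v - τ v - (u - τ u) := by
  simpa using (isDeformation_commutator_left hK hτ hc v).linearIsometry_comp
    (LinearIsometryEquiv.neg ℝ).toLinearIsometry

lemma isDeformation_displacement_right (hτ : Continuous τ) {δ : ℝ≥0∞} (hδ : ∀ u, ‖τ u‖ₑ ≤ δ)
    (c : ℝ) (v : E) : IsDeformation c K δ (fun u => v - u) fun u => v - (u - τ u) := by
  have hdiff : ∀ u, v - (u - τ u) - (v - u) = τ u := fun u => by abel
  refine ⟨by fun_prop, by fun_prop, fun s hs => ?_, fun s _ u _ => (hdiff u).symm ▸ hδ u⟩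
  have hline : ∀ u, v - u + s • τ u = v - (u - s • τ u) := fun u => by abel
  simp_rw [hdiff, hline]
  refine AntilipschitzWith.of_le_mul_dist fun x y => ?_
  rw [dist_sub_left]
  exact (hK s hs).le_mul_dist x y

end Deformations

lemma isDeformation_displacement_left {δ : ℝ≥0∞} (hδ : ∀ u, ‖τ u‖ₑ ≤ δ) (c : ℝ) (u : E) :
    IsDeformation c 1 δ (fun v => v - u) fun v => v - (u - τ u) := by
  have hdiff : ∀ v, v - (u - τ u) - (v - u) = τ u := fun v => by abel
  refine ⟨by fun_prop, by fun_prop, fun s _ => ?_, fun s _ v _ => (hdiff v).symm ▸ hδ u⟩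
  simp_rw [hdiff]
  exact AntilipschitzWith.of_le_mul_dist fun x y => by simp

/-- The Jacobian determinant of `u ↦ u - τ u`, in absolute value. -/
def jacobian (τ : E → E) (u : E) : ℝ := |(ContinuousLinearMap.id ℝ E - fderiv ℝ τ u).det|

lemma jacobian_nonneg (τ : E → E) (u : E) : 0 ≤ jacobian τ u := abs_nonneg _

section FiniteDimensional

variable [FiniteDimensional ℝ E] [MeasurableSpace E] [BorelSpace E]

lemma abs_det_le_opNorm_pow (B : E →L[ℝ] E) : |B.det| ≤ ‖B‖ ^ Module.finrank ℝ E := by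
  set μ : Measure E := Measure.addHaar
  have hsub : B '' Metric.closedBall 0 1 ⊆ Metric.closedBall 0 ‖B‖ := by
    rintro _ ⟨x, hx, rfl⟩
    rw [mem_closedBall_zero_iff] at hx ⊢
    exact B.unit_le_opNorm x hx
  have hvol := measure_mono (μ := μ) hsub
  rw [Measure.addHaar_image_continuousLinearMap, Measure.addHaar_closedBall μ 0 (norm_nonneg B),
    Measure.addHaar_closedBall μ 0 zero_le_one, one_pow, ENNReal.ofReal_one, one_mul,
    ENNReal.mul_le_mul_iff_left (Metric.measure_ball_pos μ 0 one_pos).ne'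
      measure_ball_lt_top.ne] at hvol
  exact (ENNReal.ofReal_le_ofReal_iff (by positivity)).1 hvol

lemma one_le_pow_mul_abs_det {B : E →L[ℝ] E} (hB : AntilipschitzWith K B) :
    1 ≤ (K : ℝ) ^ Module.finrank ℝ E * |B.det| := by
  set μ : Measure E := Measure.addHaar
  have hvol := (measure_mono (Set.subset_preimage_image B (Metric.ball 0 1))).trans
    (addHaar_preimage_le_of_antilipschitz μ hB (B '' Metric.ball 0 1))
  rw [Measure.addHaar_image_continuousLinearMap, ← mul_assoc] at hvol
  nth_rewrite 1 [← one_mul (μ _)] at hvol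
  rw [ENNReal.mul_le_mul_iff_left (Metric.measure_ball_pos μ 0 one_pos).ne'
      measure_ball_lt_top.ne, ← ENNReal.ofReal_coe_nnreal, ← ENNReal.ofReal_pow K.coe_nonneg,
      ← ENNReal.ofReal_mul (by positivity)] at hvol
  exact ENNReal.one_le_ofReal.1 hvol

lemma measurable_jacobian (τ : E → E) : Measurable (jacobian τ) := by
  have hdet : Continuous fun A : E →L[ℝ] E => |(ContinuousLinearMap.id ℝ E - A).det| :=
    (ContinuousLinearMap.continuous_det.comp (continuous_const.sub continuous_id)).abs
  exact hdet.measurable.comp (measurable_fderiv ℝ τ)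

lemma measurePreserving_sub_withDensity_jacobian (μ : Measure E) [μ.IsAddHaarMeasure]
    (hτ : Differentiable ℝ τ) (hε : ε < 1) (hL : LipschitzWith ε τ) :
    MeasurePreserving (fun v => v - τ v)
      (μ.withDensity fun v => ENNReal.ofReal (jacobian τ v)) μ := by
  have hinj : Function.Injective fun v => v - τ v := by
    simpa using (antilipschitzWith_sub_smul hε hL (s := 1) (by simp)).injective
  have hderiv : ∀ x ∈ Set.univ, HasFDerivWithinAt (fun v => v - τ v)
      (ContinuousLinearMap.id ℝ E - fderiv ℝ τ x) Set.univ x := fun x _ =>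
    ((hasFDerivAt_id x).sub (hτ x).hasFDerivAt).hasFDerivWithinAt
  refine ⟨(continuous_id.sub hτ.continuous).measurable, ?_⟩
  simpa only [Measure.restrict_univ, Set.image_univ,
    (surjective_sub_of_lipschitzWith hε hL).range_eq, jacobian] using
    map_withDensity_abs_det_fderiv_eq_addHaar μ MeasurableSet.univ.nullMeasurableSet hderiv
      hinj.injOn

lemma measurePreserving_prod_sub_withDensity_jacobian (μ : Measure E) [μ.IsAddHaarMeasure]
    {Y : Type*} [MeasurableSpace Y] (ν : Measure Y) [SFinite ν] (hτ : Differentiable ℝ τ)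
    (hε : ε < 1) (hL : LipschitzWith ε τ) :
    MeasurePreserving (fun q : E × Y => (q.1 - τ q.1, q.2))
      ((μ.prod ν).withDensity fun q => ENNReal.ofReal (jacobian τ q.1)) (μ.prod ν) := by
  rw [← prod_withDensity_left (measurable_jacobian τ).ennreal_ofReal]
  exact (measurePreserving_sub_withDensity_jacobian μ hτ hε hL).prod (MeasurePreserving.id ν)

lemma integrable_and_integral_eq_integral_jacobian_mul (μ : Measure E) [μ.IsAddHaarMeasure]
    {Y : Type*} [MeasurableSpace Y] {ν : Measure Y} [SFinite ν] (hτ : Differentiable ℝ τ)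
    (hε : ε < 1) (hL : LipschitzWith ε τ) {F : E × Y → ℝ} (hF : Integrable F (μ.prod ν)) :
    Integrable (fun q : E × Y => jacobian τ q.1 * F (q.1 - τ q.1, q.2)) (μ.prod ν) ∧
      ∫ q, F q ∂μ.prod ν = ∫ q : E × Y, jacobian τ q.1 * F (q.1 - τ q.1, q.2) ∂μ.prod ν := by
  have hmp := measurePreserving_prod_sub_withDensity_jacobian μ ν hτ hε hL
  have hdens : Measurable fun q : E × Y => ENNReal.ofReal (jacobian τ q.1) :=
    ((measurable_jacobian τ).comp measurable_fst).ennreal_ofReal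
  have hfin : ∀ᵐ q ∂μ.prod ν, ENNReal.ofReal (jacobian τ q.1) < ∞ :=
    ae_of_all _ fun _ => ENNReal.ofReal_lt_top
  have htoReal : ∀ q : E × Y,
      (ENNReal.ofReal (jacobian τ q.1)).toReal • F (q.1 - τ q.1, q.2)
        = jacobian τ q.1 * F (q.1 - τ q.1, q.2) := fun q => by
    rw [ENNReal.toReal_ofReal (jacobian_nonneg τ q.1), smul_eq_mul]
  constructor
  · have hcomp := (integrable_withDensity_iff_integrable_smul' hdens hfin).1
      (hmp.integrable_comp_of_integrable hF)
    exact hcomp.congr (ae_of_all _ htoReal)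
  · rw [← integral_congr_ae (ae_of_all _ htoReal),
      ← integral_withDensity_eq_integral_toReal_smul hdens hfin]
    conv_lhs => rw [← hmp.map_eq]
    exact integral_map hmp.measurable.aemeasurable (hmp.map_eq.symm ▸ hF.1)

end FiniteDimensional

section Plane

lemma abs_one_sub_abs_det_le {A : ℂ →L[ℝ] ℂ} (hA : ‖A‖ ≤ ε) (hε : ε ≤ 1 / 5) :
    |1 - (|(ContinuousLinearMap.id ℝ ℂ - A).det|)| ≤ 11 / 5 * ε := by
  set B : ℂ →L[ℝ] ℂ := ContinuousLinearMap.id ℝ ℂ - A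
  have hε1 : ε < 1 := hε.trans_lt (by norm_num)
  have hε' : (ε : ℝ) ≤ 1 / 5 := by exact_mod_cast hε
  have hnorm : ‖B‖ ≤ 1 + ε :=
    (norm_sub_le _ _).trans (add_le_add ContinuousLinearMap.norm_id_le hA)
  have hanti : AntilipschitzWith (1 - ε)⁻¹ fun v => v - A v := by
    simpa only [one_smul] using
      antilipschitzWith_sub_smul hε1 (A.lipschitz.weaken hA) (s := 1) (by simp)
  have hupper : |B.det| ≤ (1 + ε) ^ 2 := by
    simpa using (abs_det_le_opNorm_pow B).trans (pow_le_pow_left₀ (norm_nonneg B) hnorm _)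
  have hlower : (1 - ε : ℝ) ^ 2 ≤ |B.det| := by
    have hdet := one_le_pow_mul_abs_det (B := B) hanti
    rwa [Complex.finrank_real_complex, NNReal.coe_inv, NNReal.coe_sub hε1.le, NNReal.coe_one,
      inv_pow, inv_mul_eq_div, one_le_div (by nlinarith)] at hdet
  rw [abs_le]
  constructor <;> nlinarith [hε', ε.coe_nonneg]

lemma enorm_one_sub_jacobian_le {τ : ℂ → ℂ} (hε : ε ≤ 1 / 5) {u : ℂ} (hτ : ‖fderiv ℝ τ u‖ ≤ ε) :
    ‖1 - jacobian τ u‖ₑ ≤ ENNReal.ofReal (11 / 5 * ε) := by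
  rw [← ofReal_norm]
  exact ENNReal.ofReal_le_ofReal (abs_one_sub_abs_det_le hτ hε)

end Plane

end Diffeomorphism

/-! ### The Schur test and norms of feature maps -/

section Schur

variable {X Y : Type*} [MeasurableSpace X] [MeasurableSpace Y] {μ : Measure X} {ν : Measure Y}

lemma sq_lintegral_mul_le_lintegral_mul_lintegral_sq_mul {f k : X → ℝ≥0∞} (hf : Measurable f)
    (hk : Measurable k) :
    (∫⁻ x, f x * k x ∂μ) ^ 2 ≤ (∫⁻ x, k x ∂μ) * ∫⁻ x, f x ^ 2 * k x ∂μ := by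
  have hdens := sq_lintegral_le_measure_univ_mul (μ := μ.withDensity k) hf.aemeasurable
  rw [lintegral_withDensity_eq_lintegral_mul _ hk hf,
    lintegral_withDensity_eq_lintegral_mul _ hk (hf.pow_const 2), withDensity_apply _ .univ,
    Measure.restrict_univ] at hdens
  simpa only [Pi.mul_apply, mul_comm] using hdens

lemma lintegral_sq_lintegral_mul_le [SFinite μ] [SFinite ν] {k : X → Y → ℝ≥0∞}
    (hk : Measurable (Function.uncurry k)) {R C : ℝ≥0∞} (hrow : ∀ x, ∫⁻ y, k x y ∂ν ≤ R)
    (hcol : ∀ y, ∫⁻ x, k x y ∂μ ≤ C) {f : Y → ℝ≥0∞} (hf : Measurable f) :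
    ∫⁻ x, (∫⁻ y, f y * k x y ∂ν) ^ 2 ∂μ ≤ R * C * ∫⁻ y, f y ^ 2 ∂ν := by
  have hfk : Measurable fun p : X × Y => f p.2 ^ 2 * k p.1 p.2 :=
    ((hf.pow_const 2).comp measurable_snd).mul hk
  calc ∫⁻ x, (∫⁻ y, f y * k x y ∂ν) ^ 2 ∂μ
      ≤ ∫⁻ x, R * ∫⁻ y, f y ^ 2 * k x y ∂ν ∂μ := lintegral_mono fun x =>
        (sq_lintegral_mul_le_lintegral_mul_lintegral_sq_mul hf
          (hk.comp measurable_prodMk_left)).trans (mul_le_mul_left (hrow x) _)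
    _ = R * ∫⁻ y, ∫⁻ x, f y ^ 2 * k x y ∂μ ∂ν := by
        rw [lintegral_const_mul _ hfk.lintegral_prod_right',
          lintegral_lintegral_swap hfk.aemeasurable]
    _ ≤ R * ∫⁻ y, C * f y ^ 2 ∂ν := by
        gcongr with y
        rw [lintegral_const_mul _ (by exact hk.comp measurable_prodMk_right), mul_comm]
        gcongr
        exact hcol y
    _ = R * C * ∫⁻ y, f y ^ 2 ∂ν := by
        rw [lintegral_const_mul _ (hf.pow_const 2), mul_assoc]

lemma lintegral_count_prod {ι : Type*} [Fintype ι] [MeasurableSpace ι]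
    [MeasurableSingletonClass ι] [SFinite ν] {f : ι × Y → ℝ≥0∞} (hf : Measurable f) :
    ∫⁻ q, f q ∂Measure.count.prod ν = ∑ i, ∫⁻ y, f (i, y) ∂ν := by
  rw [lintegral_prod _ hf.aemeasurable, lintegral_count, tsum_fintype]

end Schur

/-- Each channel of the feature map is Borel measurable. -/
def MeasurableFeature {M : ℕ} (x : ℂ → S1 → Fin M → ℝ) : Prop :=
  ∀ c, Measurable fun p : ℂ × S1 => x p.1 p.2 c

section FeatureNorm

variable {Ω : Set ℂ} {M : ℕ} {x y z : ℂ → S1 → Fin M → ℝ}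

namespace MeasurableFeature

lemma sub (hx : MeasurableFeature x) (hy : MeasurableFeature y) : MeasurableFeature (x - y) :=
  fun c => (hx c).sub (hy c)

lemma measurable_joint (hx : MeasurableFeature x) :
    Measurable fun q : Fin M × (ℂ × S1) => x q.2.1 q.2.2 q.1 :=
  measurable_from_prod_countable_right hx

end MeasurableFeature

lemma featureNorm_sq (Ω : Set ℂ) (x : ℂ → S1 → Fin M → ℝ) :
    featureNorm Ω x ^ 2 = (M : ℝ≥0∞)⁻¹ * (volume Ω)⁻¹ *
      ∑ c, ∫⁻ p : ℂ × S1, ‖x p.1 p.2 c‖ₑ ^ 2 ∂dPlaneS1 := by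
  rw [featureNorm, ← ENNReal.rpow_two, ← ENNReal.rpow_mul, ← Finset.mul_sum, mul_assoc]
  norm_num

lemma featureNorm_eq_eLpNorm (Ω : Set ℂ) (hx : MeasurableFeature x) :
    featureNorm Ω x = eLpNorm (fun q : Fin M × (ℂ × S1) => x q.2.1 q.2.2 q.1) 2
      (((M : ℝ≥0∞)⁻¹ * (volume Ω)⁻¹) • Measure.count.prod dPlaneS1) := by
  refine (ENNReal.pow_right_strictMono two_ne_zero).injective ?_
  rw [featureNorm_sq, eLpNorm_two_sq, lintegral_smul_measure, smul_eq_mul,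
    lintegral_count_prod (hx.measurable_joint.enorm.pow_const 2)]

lemma featureNorm_sub_le (Ω : Set ℂ) (hx : MeasurableFeature x) (hy : MeasurableFeature y)
    (hz : MeasurableFeature z) :
    featureNorm Ω (x - z) ≤ featureNorm Ω (x - y) + featureNorm Ω (y - z) := by
  rw [featureNorm_eq_eLpNorm Ω (hx.sub hz), featureNorm_eq_eLpNorm Ω (hx.sub hy),
    featureNorm_eq_eLpNorm Ω (hy.sub hz)]
  refine le_of_eq_of_le (congrArg (fun f => eLpNorm f 2 _) ?_)
    (eLpNorm_add_le (hx.sub hy).measurable_joint.aestronglyMeasurable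
      (hy.sub hz).measurable_joint.aestronglyMeasurable one_le_two)
  funext q
  simp

lemma memLp_of_featureNorm_ne_top (hΩ : volume Ω ≠ ∞) (hx : MeasurableFeature x)
    (h : featureNorm Ω x ≠ ∞) (c : Fin M) :
    MemLp (fun p : ℂ × S1 => x p.1 p.2 c) 2 dPlaneS1 := by
  have hsum : ∑ c, ∫⁻ p : ℂ × S1, ‖x p.1 p.2 c‖ₑ ^ 2 ∂dPlaneS1 < ∞ := by
    have hsq := ENNReal.pow_ne_top (n := 2) h
    rw [featureNorm_sq] at hsq
    exact ENNReal.lt_top_of_mul_ne_top_right hsq (mul_ne_zero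
      (ENNReal.inv_ne_zero.2 (ENNReal.natCast_ne_top M)) (ENNReal.inv_ne_zero.2 hΩ))
  have hchannel := ENNReal.sum_lt_top.1 hsum c (Finset.mem_univ c)
  rw [← eLpNorm_two_sq] at hchannel
  exact ⟨(hx c).aestronglyMeasurable, (ENNReal.pow_lt_top_iff.1 hchannel).resolve_right two_ne_zero⟩

variable {M' : ℕ} {A : Fin M' → Fin M → ℝ≥0∞} {B : ℝ≥0∞}
  {k : Fin M' → Fin M → ℂ × S1 → ℂ × S1 → ℝ≥0∞}

/-- The row sums `∑_{c'} A c' c` and the rescaled column sums `(M' / M) ∑_c A c' c` are at most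
one, as assumption (A2) demands from the Fourier-Bessel norms of the filters. -/
structure IsNormalized (A : Fin M' → Fin M → ℝ≥0∞) : Prop where
  pos : 0 < M'
  row_le_one : ∀ c, ∑ c', A c' c ≤ 1
  col_le_one : ∀ c', (M' : ℝ≥0∞) / M * ∑ c, A c' c ≤ 1

lemma IsNormalized.col_le_div (hA : IsNormalized A) (c' : Fin M') :
    ∑ c, A c' c ≤ (M : ℝ≥0∞) / M' := by
  rw [← ENNReal.inv_div (.inl (ENNReal.natCast_ne_top M))
    (.inr (Nat.cast_ne_zero.2 hA.pos.ne')), ENNReal.le_inv_iff_mul_le, mul_comm]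
  exact hA.col_le_one c'

/-- The kernels `k c' c p q`, from channel `c'` at `q` to channel `c` at `p`, are measurable and
have row and column integrals at most `B * A c' c`. -/
structure KernelBound (B : ℝ≥0∞) (A : Fin M' → Fin M → ℝ≥0∞)
    (k : Fin M' → Fin M → ℂ × S1 → ℂ × S1 → ℝ≥0∞) : Prop where
  measurable : ∀ c' c, Measurable (Function.uncurry (k c' c))
  row_le : ∀ c' c p, ∫⁻ q, k c' c p q ∂dPlaneS1 ≤ B * A c' c
  col_le : ∀ c' c q, ∫⁻ p, k c' c p q ∂dPlaneS1 ≤ B * A c' c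

namespace KernelBound

lemma measurable_joint (hk : KernelBound B A k) :
    Measurable fun r : (Fin M × (ℂ × S1)) × (Fin M' × (ℂ × S1)) =>
      k r.2.1 r.1.1 r.1.2 r.2.2 := by
  have hswap : Measurable fun r : (Fin M × (ℂ × S1)) × (Fin M' × (ℂ × S1)) =>
      ((r.2.1, r.1.1), (r.1.2, r.2.2)) := by fun_prop
  exact (measurable_from_prod_countable_right
    (f := fun r : (Fin M' × Fin M) × ((ℂ × S1) × (ℂ × S1)) => k r.1.1 r.1.2 r.2.1 r.2.2)
    fun i => hk.measurable i.1 i.2).comp hswap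

lemma lintegral_row_le (hk : KernelBound B A k) (hA : IsNormalized A)
    (p : Fin M × (ℂ × S1)) :
    ∫⁻ q : Fin M' × (ℂ × S1), k q.1 p.1 p.2 q.2 ∂Measure.count.prod dPlaneS1 ≤ B := by
  rw [lintegral_count_prod (by exact hk.measurable_joint.comp measurable_prodMk_left)]
  calc ∑ c', ∫⁻ q, k c' p.1 p.2 q ∂dPlaneS1 ≤ ∑ c', B * A c' p.1 :=
        Finset.sum_le_sum fun c' _ => hk.row_le c' p.1 p.2
    _ = B * ∑ c', A c' p.1 := (Finset.mul_sum _ _ _).symm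
    _ ≤ B := mul_le_of_le_one_right' (hA.row_le_one p.1)

lemma lintegral_col_le (hk : KernelBound B A k) (hA : IsNormalized A)
    (q : Fin M' × (ℂ × S1)) :
    ∫⁻ p : Fin M × (ℂ × S1), k q.1 p.1 p.2 q.2 ∂Measure.count.prod dPlaneS1
      ≤ B * (M / M') := by
  rw [lintegral_count_prod (by exact hk.measurable_joint.comp measurable_prodMk_right)]
  calc ∑ c, ∫⁻ p, k q.1 c p q.2 ∂dPlaneS1 ≤ ∑ c, B * A q.1 c :=
        Finset.sum_le_sum fun c _ => hk.col_le q.1 c q.2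
    _ = B * ∑ c, A q.1 c := (Finset.mul_sum _ _ _).symm
    _ ≤ B * (M / M') := by gcongr; exact hA.col_le_div q.1

lemma featureNorm_le (hk : KernelBound B A k) (hA : IsNormalized A) (Ω : Set ℂ)
    {x : ℂ → S1 → Fin M' → ℝ} (hx : MeasurableFeature x) {y : ℂ → S1 → Fin M → ℝ}
    (hy : ∀ u α c, ‖y u α c‖ₑ
      ≤ ∑ c', ∫⁻ q : ℂ × S1, ‖x q.1 q.2 c'‖ₑ * k c' c (u, α) q ∂dPlaneS1) :
    featureNorm Ω y ≤ B * featureNorm Ω x := by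
  set m' : Measure (Fin M' × (ℂ × S1)) := Measure.count.prod dPlaneS1
  set f : Fin M' × (ℂ × S1) → ℝ≥0∞ := fun q => ‖x q.2.1 q.2.2 q.1‖ₑ
  set g : Fin M × (ℂ × S1) → ℝ≥0∞ := fun p => ∫⁻ q, f q * k q.1 p.1 p.2 q.2 ∂m'
  have hf : Measurable f := hx.measurable_joint.enorm
  have hfk : Measurable fun r : (Fin M × (ℂ × S1)) × (Fin M' × (ℂ × S1)) =>
      f r.2 * k r.2.1 r.1.1 r.1.2 r.2.2 := (hf.comp measurable_snd).mul hk.measurable_joint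
  have hg : Measurable g := hfk.lintegral_prod_right'
  have hyg : ∀ c (p : ℂ × S1), ‖y p.1 p.2 c‖ₑ ≤ g (c, p) := fun c p =>
    (hy p.1 p.2 c).trans_eq
      (lintegral_count_prod (by exact hfk.comp (measurable_prodMk_left (x := (c, p))))).symm
  have hschur : ∫⁻ p, g p ^ 2 ∂Measure.count.prod dPlaneS1
      ≤ B * (B * (M / M')) * ∫⁻ q, f q ^ 2 ∂m' :=
    lintegral_sq_lintegral_mul_le hk.measurable_joint (hk.lintegral_row_le hA)
      (hk.lintegral_col_le hA) hf
  rw [lintegral_count_prod (hg.pow_const 2), lintegral_count_prod (hf.pow_const 2)] at hschur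
  rw [← ENNReal.pow_le_pow_left_iff two_ne_zero, mul_pow, featureNorm_sq, featureNorm_sq]
  set S := ∑ c', ∫⁻ q, f (c', q) ^ 2 ∂dPlaneS1
  calc (M : ℝ≥0∞)⁻¹ * (volume Ω)⁻¹ * ∑ c, ∫⁻ p : ℂ × S1, ‖y p.1 p.2 c‖ₑ ^ 2 ∂dPlaneS1
      ≤ (M : ℝ≥0∞)⁻¹ * (volume Ω)⁻¹ * (B * (B * (M / M')) * S) := by
        gcongr
        refine le_trans (Finset.sum_le_sum fun c _ => lintegral_mono fun p => ?_) hschur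
        exact pow_le_pow_left' (hyg c p) 2
    _ = (M : ℝ≥0∞)⁻¹ * M * (B ^ 2 * ((M' : ℝ≥0∞)⁻¹ * (volume Ω)⁻¹ * S)) := by
        rw [div_eq_mul_inv]
        ring
    _ ≤ B ^ 2 * ((M' : ℝ≥0∞)⁻¹ * (volume Ω)⁻¹ * S) :=
        mul_le_of_le_one_left' (ENNReal.inv_mul_le_one _)

end KernelBound

end FeatureNorm

/-! ### Joint convolution layers -/

section Layer

variable {Ω : Set ℂ} {M' M : ℕ} {W W' : Fin M' → Fin M → ℂ × S1 → ℝ} {x y : ℂ → S1 → Fin M' → ℝ}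
  {κ : Fin M' → ℝ} {σ : ℝ → ℝ} {c : ℝ} {A : Fin M' → Fin M → ℝ≥0∞}

/-- The linear part of a joint convolution layer with filters `W`. -/
def preact (W : Fin M' → Fin M → ℂ × S1 → ℝ) (x : ℂ → S1 → Fin M' → ℝ) (u : ℂ) (α : S1)
    (k : Fin M) : ℝ :=
  ∑ c', ∫ p : ℂ × S1, x (u + p.1) p.2 c' * W c' k (rot α p.1, p.2 - α) ∂dPlaneS1

/-- A joint convolution layer with filters `W`, biases `b` and activation `σ`. -/
def layer (σ : ℝ → ℝ) (W : Fin M' → Fin M → ℂ × S1 → ℝ) (b : Fin M → ℝ)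
    (x : ℂ → S1 → Fin M' → ℝ) : ℂ → S1 → Fin M → ℝ :=
  fun u α k => σ (preact W x u α k + b k)

/-- The argument of a filter at the input position `q`, seen from the output position `(u, α)`. -/
def filterArg (u : ℂ) (α : S1) (q : ℂ × S1) : ℂ × S1 := (rot α (q.1 - u), q.2 - α)

lemma measurable_filterArg :
    Measurable fun r : (ℂ × S1) × (ℂ × S1) => filterArg r.1.1 r.1.2 r.2 :=
  (Continuous.prodMk (continuous_rot_comp (by fun_prop) (by fun_prop)) (by fun_prop)).measurable

lemma measurePreserving_filterArg (u : ℂ) (α : S1) :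
    MeasurePreserving (filterArg u α) dPlaneS1 dPlaneS1 :=
  ((measurePreserving_rot α).comp (measurePreserving_sub_right volume u)).prod
    (measurePreserving_sub_right dS1 α)

lemma preact_eq_sum_integral_filterArg (W : Fin M' → Fin M → ℂ × S1 → ℝ)
    (x : ℂ → S1 → Fin M' → ℝ) (u : ℂ) (α : S1) (k : Fin M) :
    preact W x u α k
      = ∑ c', ∫ q : ℂ × S1, x q.1 q.2 c' * W c' k (filterArg u α q) ∂dPlaneS1 := by
  refine Finset.sum_congr rfl fun c' _ => ?_
  rw [← integral_add_left_eq_self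
    (fun q : ℂ × S1 => x q.1 q.2 c' * W c' k (filterArg u α q)) ((u, 0) : ℂ × S1)]
  simp [filterArg]

lemma preact_congr_filter (h : ∀ c' k, W c' k =ᵐ[dPlaneS1] W' c' k)
    (x : ℂ → S1 → Fin M' → ℝ) : preact W x = preact W' x := by
  funext u α k
  simp only [preact_eq_sum_integral_filterArg]
  refine Finset.sum_congr rfl fun c' _ => integral_congr_ae ?_
  filter_upwards [(measurePreserving_filterArg u α).quasiMeasurePreserving.ae (h c' k)] with q hq
  rw [hq]

lemma preact_congr_input (W : Fin M' → Fin M → ℂ × S1 → ℝ)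
    (h : ∀ c', (fun q : ℂ × S1 => x q.1 q.2 c') =ᵐ[dPlaneS1] fun q => y q.1 q.2 c') :
    preact W x = preact W y := by
  funext u α k
  simp only [preact_eq_sum_integral_filterArg]
  refine Finset.sum_congr rfl fun c' _ => integral_congr_ae ?_
  filter_upwards [h c'] with q hq
  rw [hq]

lemma enorm_layer_sub_le (hσ : LipschitzWith 1 σ) (b : Fin M → ℝ) (u u' : ℂ) (α : S1)
    (k : Fin M) :
    ‖layer σ W b x u α k - layer σ W b y u' α k‖ₑ
      ≤ ‖preact W x u α k - preact W y u' α k‖ₑ := by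
  have hlip := hσ.edist_le_mul (preact W x u α k + b k) (preact W y u' α k + b k)
  rwa [edist_add_right, edist_eq_enorm_sub, edist_eq_enorm_sub, ENNReal.coe_one, one_mul] at hlip

lemma enorm_sum_integral_mul_le {X ι : Type*} [MeasurableSpace X] {μ : Measure X} (s : Finset ι)
    (f g : ι → X → ℝ) :
    ‖∑ i ∈ s, ∫ q, f i q * g i q ∂μ‖ₑ ≤ ∑ i ∈ s, ∫⁻ q, ‖f i q‖ₑ * ‖g i q‖ₑ ∂μ := by
  simp_rw [← enorm_mul]
  exact (enorm_sum_le _ _).trans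
    (Finset.sum_le_sum fun i _ => enorm_integral_le_lintegral_enorm _)

/-- The feature map is Borel measurable and differs from the constant `κ` by an `L²` function.
The constant accounts for biases, because of which layers do not map `L²` into itself. -/
structure IsAdmissible (Ω : Set ℂ) (κ : Fin M → ℝ) (x : ℂ → S1 → Fin M → ℝ) : Prop where
  measurable : MeasurableFeature x
  ne_top : featureNorm Ω (x - fun _ _ => κ) ≠ ∞

lemma measurableFeature_const (κ : Fin M → ℝ) :
    MeasurableFeature (fun _ _ => κ : ℂ → S1 → Fin M → ℝ) := fun _ => measurable_const

lemma featureNorm_zero (Ω : Set ℂ) : featureNorm Ω (0 : ℂ → S1 → Fin M → ℝ) = 0 := by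
  simp [featureNorm]

lemma isAdmissible_const (Ω : Set ℂ) (κ : Fin M → ℝ) : IsAdmissible Ω κ (fun _ _ => κ) :=
  ⟨measurableFeature_const κ, by simp [featureNorm_zero]⟩

lemma IsAdmissible.measurable_sub_const (hx : IsAdmissible Ω κ x) :
    MeasurableFeature (x - fun _ _ => κ) :=
  hx.measurable.sub (measurableFeature_const κ)

lemma IsAdmissible.integrable_mul (hΩ : volume Ω ≠ ∞) (hx : IsAdmissible Ω κ x)
    {V : ℂ × S1 → ℝ} (hV : MemLp V 2 dPlaneS1) (u : ℂ) (α : S1) (c' : Fin M') :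
    Integrable (fun q : ℂ × S1 => (x q.1 q.2 c' - κ c') * V (filterArg u α q)) dPlaneS1 :=
  (memLp_of_featureNorm_ne_top hΩ hx.measurable_sub_const hx.ne_top c').integrable_mul
    (hV.comp_measurePreserving (measurePreserving_filterArg u α))

/-- The filters of a layer satisfy `FilterBound` with normalized constants. -/
structure LayerBound (c : ℝ) (A : Fin M' → Fin M → ℝ≥0∞)
    (W : Fin M' → Fin M → ℂ × S1 → ℝ) : Prop where
  normalized : IsNormalized A
  filter : ∀ c' k, FilterBound c (A c' k) (W c' k)

/-- The output of a layer on the constant input `κ`. -/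
def layerConst (σ : ℝ → ℝ) (W : Fin M' → Fin M → ℂ × S1 → ℝ) (b : Fin M → ℝ)
    (κ : Fin M' → ℝ) (k : Fin M) : ℝ :=
  σ (∑ c', κ c' * ∫ q, W c' k q ∂dPlaneS1 + b k)

namespace LayerBound

lemma preact_eq_add_const (hW : LayerBound c A W) (hΩ : volume Ω ≠ ∞) (hx : IsAdmissible Ω κ x)
    (u : ℂ) (α : S1) (k : Fin M) :
    preact W x u α k
      = ∑ c', ∫ q : ℂ × S1, (x q.1 q.2 c' - κ c') * W c' k (filterArg u α q) ∂dPlaneS1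
        + ∑ c', κ c' * ∫ q, W c' k q ∂dPlaneS1 := by
  rw [preact_eq_sum_integral_filterArg, ← Finset.sum_add_distrib]
  refine Finset.sum_congr rfl fun c' _ => ?_
  have hmp := measurePreserving_filterArg u α
  have hint : Integrable (fun q => W c' k (filterArg u α q)) dPlaneS1 :=
    hmp.integrable_comp_of_integrable (hW.filter c' k).integrable
  have hinvariant : ∫ q, W c' k q ∂dPlaneS1 = ∫ q, W c' k (filterArg u α q) ∂dPlaneS1 := by
    conv_lhs => rw [← hmp.map_eq]
    exact integral_map hmp.aemeasurable (hW.filter c' k).measurable.aestronglyMeasurable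
  rw [hinvariant, ← integral_const_mul,
    ← integral_add (hx.integrable_mul hΩ (hW.filter c' k).memLp u α c') (hint.const_mul _)]
  exact integral_congr_ae (ae_of_all _ fun q => by ring)

lemma preact_sub_preact (hW : LayerBound c A W) (hΩ : volume Ω ≠ ∞) (hx : IsAdmissible Ω κ x)
    (hy : IsAdmissible Ω κ y) (u u' : ℂ) (α : S1) (k : Fin M) :
    preact W x u α k - preact W y u' α k
      = ∑ c', (∫ q : ℂ × S1, (x q.1 q.2 c' - κ c') * W c' k (filterArg u α q) ∂dPlaneS1
        - ∫ q : ℂ × S1, (y q.1 q.2 c' - κ c') * W c' k (filterArg u' α q) ∂dPlaneS1) := by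
  rw [hW.preact_eq_add_const hΩ hx, hW.preact_eq_add_const hΩ hy, add_sub_add_right_eq_sub,
    Finset.sum_sub_distrib]

lemma layer_const (hW : LayerBound c A W) (b : Fin M → ℝ) :
    layer σ W b (fun _ _ => κ) = fun _ _ => layerConst σ W b κ := by
  funext u α k
  simp [layer, layerConst, hW.preact_eq_add_const (Ω := ∅) (by simp) (isAdmissible_const ∅ κ)]

lemma measurableFeature_layer (hW : LayerBound c A W) (hσ : Continuous σ) (b : Fin M → ℝ)
    (hx : MeasurableFeature x) : MeasurableFeature (layer σ W b x) := fun k => by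
  refine hσ.measurable.comp (Measurable.add_const ?_ _)
  simp only [preact_eq_sum_integral_filterArg]
  refine Finset.measurable_fun_sum _ fun c' _ => ?_
  have hintegrand : Measurable fun r : (ℂ × S1) × (ℂ × S1) =>
      x r.2.1 r.2.2 c' * W c' k (filterArg r.1.1 r.1.2 r.2) :=
    ((hx c').comp measurable_snd).mul ((hW.filter c' k).measurable.comp measurable_filterArg)
  exact hintegrand.stronglyMeasurable.integral_prod_right'.measurable

lemma kernelBound_filterArg (hW : LayerBound c A W) :
    KernelBound 1 A fun c' k p q => ‖W c' k (filterArg p.1 p.2 q)‖ₑ where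
  measurable c' k := ((hW.filter c' k).measurable.comp measurable_filterArg).enorm
  row_le c' k p := by
    have hrow := lintegral_rot_comp_sub_right_le (P := fun v => v - p.1) (by fun_prop)
      (IsometryEquiv.subRight p.1).isometry.antilipschitz (hW.filter c' k).measurable.enorm p.2
    rw [ENNReal.coe_one, one_pow, one_mul] at hrow
    exact hrow.trans ((hW.filter c' k).lintegral_le.trans_eq (one_mul _).symm)
  col_le c' k q := by
    have hcol := lintegral_rot_comp_sub_left_le (P := fun u => q.1 - u) (by fun_prop)
      (IsometryEquiv.subLeft q.1).isometry.antilipschitz (hW.filter c' k).measurable.enorm q.2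
    rw [ENNReal.coe_one, one_pow, one_mul] at hcol
    exact hcol.trans ((hW.filter c' k).lintegral_le.trans_eq (one_mul _).symm)

lemma featureNorm_layer_sub_le (hW : LayerBound c A W) (hΩ : volume Ω ≠ ∞)
    (hσ : LipschitzWith 1 σ) (b : Fin M → ℝ) (hx : IsAdmissible Ω κ x)
    (hy : IsAdmissible Ω κ y) :
    featureNorm Ω (layer σ W b x - layer σ W b y) ≤ featureNorm Ω (x - y) := by
  rw [← one_mul (featureNorm Ω (x - y))]
  refine hW.kernelBound_filterArg.featureNorm_le hW.normalized Ω
    (hx.measurable.sub hy.measurable) fun u α k => ?_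
  have hpreact : preact W x u α k - preact W y u α k = ∑ c', ∫ q : ℂ × S1,
      (x - y) q.1 q.2 c' * W c' k (filterArg u α q) ∂dPlaneS1 := by
    rw [hW.preact_sub_preact hΩ hx hy]
    refine Finset.sum_congr rfl fun c' _ => ?_
    rw [← integral_sub (hx.integrable_mul hΩ (hW.filter c' k).memLp u α c')
      (hy.integrable_mul hΩ (hW.filter c' k).memLp u α c')]
    refine integral_congr_ae (ae_of_all _ fun q => ?_)
    simp only [Pi.sub_apply]
    ring
  refine (enorm_layer_sub_le hσ b u u α k).trans ?_
  rw [hpreact]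
  exact enorm_sum_integral_mul_le _ _ _

lemma featureNorm_layer_sub_const_le (hW : LayerBound c A W) (hΩ : volume Ω ≠ ∞)
    (hσ : LipschitzWith 1 σ) (b : Fin M → ℝ) (hx : IsAdmissible Ω κ x) :
    featureNorm Ω (layer σ W b x - fun _ _ => layerConst σ W b κ)
      ≤ featureNorm Ω (x - fun _ _ => κ) := by
  rw [← hW.layer_const]
  exact hW.featureNorm_layer_sub_le hΩ hσ b hx (isAdmissible_const Ω κ)

lemma isAdmissible_layer (hW : LayerBound c A W) (hΩ : volume Ω ≠ ∞) (hσ : LipschitzWith 1 σ)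
    (b : Fin M → ℝ) (hx : IsAdmissible Ω κ x) :
    IsAdmissible Ω (layerConst σ W b κ) (layer σ W b x) :=
  ⟨hW.measurableFeature_layer hσ.continuous b hx.measurable,
    ne_top_of_le_ne_top hx.ne_top (hW.featureNorm_layer_sub_const_le hΩ hσ b hx)⟩

end LayerBound

end Layer

/-! ### Layers and deformations -/

section Deform

variable {Ω : Set ℂ} {M' M : ℕ} {W : Fin M' → Fin M → ℂ × S1 → ℝ} {x : ℂ → S1 → Fin M' → ℝ}
  {κ : Fin M' → ℝ} {σ : ℝ → ℝ} {c : ℝ} {A : Fin M' → Fin M → ℝ≥0∞} {τ : ℂ → ℂ} {ε K : NNReal}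
  {η δ : ℝ≥0∞}

/-- The deformation `x(u, α, λ) ↦ x(u - τ(u), α, λ)` of a feature map. -/
def deform (τ : ℂ → ℂ) (x : ℂ → S1 → Fin M → ℝ) : ℂ → S1 → Fin M → ℝ := fun u => x (u - τ u)

lemma MeasurableFeature.deform (hτ : Continuous τ) (hx : MeasurableFeature x) :
    MeasurableFeature (deform τ x) := fun c' =>
  (hx c').comp (by fun_prop : Continuous fun p : ℂ × S1 => (p.1 - τ p.1, p.2)).measurable

lemma featureNorm_deform_le (Ω : Set ℂ) (hτ : Continuous τ)
    (hK : AntilipschitzWith K fun v => v - τ v) (hx : MeasurableFeature x) :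
    featureNorm Ω (deform τ x) ≤ K * featureNorm Ω x := by
  have hcomp : ∀ c', ∫⁻ p : ℂ × S1, ‖deform τ x p.1 p.2 c'‖ₑ ^ 2 ∂dPlaneS1
      ≤ K ^ 2 * ∫⁻ p : ℂ × S1, ‖x p.1 p.2 c'‖ₑ ^ 2 ∂dPlaneS1 := fun c' => by
    have hsq : Measurable fun p : ℂ × S1 => ‖x p.1 p.2 c'‖ₑ ^ 2 := (hx c').enorm.pow_const 2
    rw [lintegral_dPlaneS1 (by exact ((hx.deform hτ) c').enorm.pow_const 2)]
    exact lintegral_comp_fiberwise_le (T := fun _ v => v - τ v) (fun _ => hK) (by fun_prop) hsq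
  rw [← ENNReal.pow_le_pow_left_iff two_ne_zero, mul_pow, featureNorm_sq, featureNorm_sq]
  calc _ ≤ _ := mul_le_mul_right (Finset.sum_le_sum fun c' _ => hcomp c') _
    _ = _ := by rw [← Finset.mul_sum, mul_left_comm]

lemma IsAdmissible.deform (hτ : Continuous τ) (hK : AntilipschitzWith K fun v => v - τ v)
    (hx : IsAdmissible Ω κ x) : IsAdmissible Ω κ (deform τ x) := by
  have hsub : RotDCF.deform τ x - (fun _ _ => κ) = RotDCF.deform τ (x - fun _ _ => κ) := rfl
  refine ⟨hx.measurable.deform hτ, ?_⟩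
  rw [hsub]
  exact ne_top_of_le_ne_top (ENNReal.mul_ne_top ENNReal.coe_ne_top hx.ne_top)
    (featureNorm_deform_le Ω hτ hK hx.measurable_sub_const)

lemma lintegral_enorm_sub_mul_le {X : Type*} [MeasurableSpace X] {μ : Measure X} {f g J : X → ℝ}
    (hg : Measurable g) (hJ : ∀ x, ‖1 - J x‖ₑ ≤ η) :
    ∫⁻ x, ‖f x - J x * g x‖ₑ ∂μ ≤ ∫⁻ x, ‖g x - f x‖ₑ ∂μ + η * ∫⁻ x, ‖g x‖ₑ ∂μ := by
  rw [← lintegral_const_mul _ hg.enorm, ← lintegral_add_right _ (hg.enorm.const_mul η)]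
  refine lintegral_mono fun x => ?_
  calc ‖f x - J x * g x‖ₑ = ‖(f x - g x) + (1 - J x) * g x‖ₑ := by ring_nf
    _ ≤ ‖f x - g x‖ₑ + ‖1 - J x‖ₑ * ‖g x‖ₑ := (enorm_add_le _ _).trans_eq (by rw [enorm_mul])
    _ ≤ ‖g x - f x‖ₑ + η * ‖g x‖ₑ := by
        rw [enorm_sub_rev]
        gcongr
        exact hJ x

namespace LayerBound

variable (hK : ∀ s ∈ Set.Icc (0 : ℝ) 1, AntilipschitzWith K fun v => v - s • τ v)
include hK

/-- The kernel of the commutator of a layer with a deformation: substituting `q ↦ q - τ q` in the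
deformed output produces the Jacobian factor. -/
lemma kernelBound_commutator (hW : LayerBound c A W) (hc : 0 < c) (hτ : LipschitzWith ε τ)
    (hJ : ∀ u, ‖1 - jacobian τ u‖ₑ ≤ η) :
    KernelBound ((K * ε + η) * K ^ 2) A fun c' k p q => ‖W c' k (filterArg p.1 p.2 q)
      - jacobian τ q.1 * W c' k (filterArg (p.1 - τ p.1) p.2 (q.1 - τ q.1, q.2))‖ₑ := by
  have hτc := hτ.continuous
  have hdeformed : ∀ c' k, Measurable fun r : (ℂ × S1) × (ℂ × S1) =>
      W c' k (filterArg (r.1.1 - τ r.1.1) r.1.2 (r.2.1 - τ r.2.1, r.2.2)) := fun c' k =>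
    (hW.filter c' k).measurable.comp (measurable_filterArg.comp
      (by fun_prop : Continuous fun r : (ℂ × S1) × (ℂ × S1) =>
        ((r.1.1 - τ r.1.1, r.1.2), (r.2.1 - τ r.2.1, r.2.2))).measurable)
  have hconst : ∀ c' k, ENNReal.ofReal (K * ε / c) * K ^ 2 * ENNReal.ofReal c * A c' k
      + η * (K ^ 2 * A c' k) = (K * ε + η) * K ^ 2 * A c' k := fun c' k => by
    have hcancel : ENNReal.ofReal (K * ε / c) * ENNReal.ofReal c = K * ε := by
      rw [← ENNReal.ofReal_mul (by positivity), div_mul_cancel₀ _ hc.ne',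
        ENNReal.ofReal_mul K.coe_nonneg, ENNReal.ofReal_coe_nnreal, ENNReal.ofReal_coe_nnreal]
    rw [← hcancel]
    ring
  refine ⟨fun c' k => ?_, fun c' k p => ?_, fun c' k q => ?_⟩
  · exact (((hW.filter c' k).measurable.comp measurable_filterArg).sub
      (((measurable_jacobian τ).comp (measurable_fst.comp measurable_snd)).mul
        (hdeformed c' k))).enorm
  · have hdef := isDeformation_commutator_left hK hτ hc p.1
    refine (lintegral_enorm_sub_mul_le ((hdeformed c' k).comp measurable_prodMk_left)
      fun q => hJ q.1).trans ?_
    rw [← hconst]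
    gcongr
    · exact (hW.filter c' k).lintegral_rot_sub_sub_right_le hdef p.2
    · exact (lintegral_rot_comp_sub_right_le hdef.continuous₁ hdef.antilipschitz₁
        (hW.filter c' k).measurable.enorm p.2).trans
          (by gcongr; exact (hW.filter c' k).lintegral_le)
  · have hdef := isDeformation_commutator_right hK hτ hc q.1
    refine (lintegral_enorm_sub_mul_le ((hdeformed c' k).comp measurable_prodMk_right)
      fun _ => hJ q.1).trans ?_
    rw [← hconst]
    gcongr
    · exact (hW.filter c' k).lintegral_rot_sub_sub_left_le hdef q.2
    · exact (lintegral_rot_comp_sub_left_le hdef.continuous₁ hdef.antilipschitz₁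
        (hW.filter c' k).measurable.enorm q.2).trans
          (by gcongr; exact (hW.filter c' k).lintegral_le)

lemma preact_deform_sub_preact (hW : LayerBound c A W) (hΩ : volume Ω ≠ ∞)
    (hx : IsAdmissible Ω κ x) (hτ : Differentiable ℝ τ) (hε : ε < 1) (hL : LipschitzWith ε τ)
    (u : ℂ) (α : S1) (k : Fin M) :
    preact W (deform τ x) u α k - preact W x (u - τ u) α k
      = ∑ c', ∫ q : ℂ × S1, deform τ (x - fun _ _ => κ) q.1 q.2 c'
        * (W c' k (filterArg u α q) - jacobian τ q.1
          * W c' k (filterArg (u - τ u) α (q.1 - τ q.1, q.2))) ∂dPlaneS1 := by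
  have hanti : AntilipschitzWith K fun v => v - τ v := by simpa using hK 1 (by simp)
  have hxd := hx.deform hL.continuous hanti
  rw [hW.preact_sub_preact hΩ hxd hx]
  refine Finset.sum_congr rfl fun c' _ => ?_
  obtain ⟨hint, hchange⟩ := integrable_and_integral_eq_integral_jacobian_mul volume hτ hε hL
    (hx.integrable_mul hΩ (hW.filter c' k).memLp (u - τ u) α c')
  rw [hchange, ← integral_sub (hxd.integrable_mul hΩ (hW.filter c' k).memLp u α c') hint]
  refine integral_congr_ae (ae_of_all _ fun q => ?_)
  simp only [Pi.sub_apply, deform]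
  ring

lemma featureNorm_commutator_le (hW : LayerBound c A W) (hc : 0 < c) (hΩ : volume Ω ≠ ∞)
    (hσ : LipschitzWith 1 σ) (b : Fin M → ℝ) (hx : IsAdmissible Ω κ x) (hτ : Differentiable ℝ τ)
    (hε : ε < 1) (hL : LipschitzWith ε τ) (hJ : ∀ u, ‖1 - jacobian τ u‖ₑ ≤ η) :
    featureNorm Ω (layer σ W b (deform τ x) - deform τ (layer σ W b x))
      ≤ (K * ε + η) * K ^ 3 * featureNorm Ω (x - fun _ _ => κ) := by
  have hanti : AntilipschitzWith K fun v => v - τ v := by simpa using hK 1 (by simp)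
  calc featureNorm Ω (layer σ W b (deform τ x) - deform τ (layer σ W b x))
      ≤ (K * ε + η) * K ^ 2 * featureNorm Ω (deform τ (x - fun _ _ => κ)) := by
        refine (hW.kernelBound_commutator hK hc hL hJ).featureNorm_le hW.normalized Ω
          (hx.measurable_sub_const.deform hL.continuous) fun u α k => ?_
        refine (enorm_layer_sub_le hσ b u (u - τ u) α k).trans ?_
        rw [hW.preact_deform_sub_preact hK hΩ hx hτ hε hL]
        exact enorm_sum_integral_mul_le _ _ _
    _ ≤ (K * ε + η) * K ^ 2 * (K * featureNorm Ω (x - fun _ _ => κ)) := by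
        gcongr
        exact featureNorm_deform_le Ω hL.continuous hanti hx.measurable_sub_const
    _ = (K * ε + η) * K ^ 3 * featureNorm Ω (x - fun _ _ => κ) := by ring

lemma kernelBound_displacement (hW : LayerBound c A W) (hτ : Continuous τ)
    (hδ : ∀ u, ‖τ u‖ₑ ≤ δ) :
    KernelBound (δ * K ^ 2 * ENNReal.ofReal c) A fun c' k p q =>
      ‖W c' k (filterArg (p.1 - τ p.1) p.2 q) - W c' k (filterArg p.1 p.2 q)‖ₑ where
  measurable c' k := by
    have hdeformed : Measurable fun r : (ℂ × S1) × (ℂ × S1) =>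
        filterArg (r.1.1 - τ r.1.1) r.1.2 r.2 := measurable_filterArg.comp
      (by fun_prop : Continuous fun r : (ℂ × S1) × (ℂ × S1) =>
        ((r.1.1 - τ r.1.1, r.1.2), r.2)).measurable
    exact (((hW.filter c' k).measurable.comp hdeformed).sub
      ((hW.filter c' k).measurable.comp measurable_filterArg)).enorm
  row_le c' k p := by
    have hone : 1 ≤ K := by
      have hid := (hK 0 (by simp)).le_mul_dist 0 1
      simpa using hid
    refine ((hW.filter c' k).lintegral_rot_sub_sub_right_le
      (isDeformation_displacement_left hδ c p.1) p.2).trans ?_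
    gcongr
  col_le c' k q := (hW.filter c' k).lintegral_rot_sub_sub_left_le
    (isDeformation_displacement_right hK hτ hδ c q.1) q.2

lemma featureNorm_displacement_le (hW : LayerBound c A W) (hΩ : volume Ω ≠ ∞)
    (hσ : LipschitzWith 1 σ) (b : Fin M → ℝ) (hx : IsAdmissible Ω κ x) (hτ : Continuous τ)
    (hδ : ∀ u, ‖τ u‖ₑ ≤ δ) :
    featureNorm Ω (deform τ (layer σ W b x) - layer σ W b x)
      ≤ δ * K ^ 2 * ENNReal.ofReal c * featureNorm Ω (x - fun _ _ => κ) := by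
  refine (hW.kernelBound_displacement hK hτ hδ).featureNorm_le hW.normalized Ω
    hx.measurable_sub_const fun u α k => ?_
  have hpreact : preact W x (u - τ u) α k - preact W x u α k = ∑ c', ∫ q : ℂ × S1,
      (x - fun _ _ => κ : ℂ → S1 → Fin M' → ℝ) q.1 q.2 c'
        * (W c' k (filterArg (u - τ u) α q) - W c' k (filterArg u α q)) ∂dPlaneS1 := by
    rw [hW.preact_sub_preact hΩ hx hx]
    refine Finset.sum_congr rfl fun c' _ => ?_
    rw [← integral_sub (hx.integrable_mul hΩ (hW.filter c' k).memLp (u - τ u) α c')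
      (hx.integrable_mul hΩ (hW.filter c' k).memLp u α c')]
    refine integral_congr_ae (ae_of_all _ fun q => ?_)
    simp only [Pi.sub_apply]
    ring
  refine (enorm_layer_sub_le hσ b (u - τ u) u α k).trans ?_
  rw [hpreact]
  exact enorm_sum_integral_mul_le _ _ _

end LayerBound

end Deform

/-! ### Rotation equivariance -/

section Rotation

variable {M' M : ℕ}

/-- The rigid motion `(u, α) ↦ (ρ u, α - t)` for `ρ = ρ_{u₀,t}`, through which `Trho` acts. -/
def rigidMotion (u₀ : ℂ) (t : S1) (p : ℂ × S1) : ℂ × S1 := (rotAround u₀ t p.1, p.2 - t)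

lemma measurePreserving_rigidMotion (u₀ : ℂ) (t : S1) :
    MeasurePreserving (rigidMotion u₀ t) dPlaneS1 dPlaneS1 :=
  ((measurePreserving_add_left volume u₀).comp
    ((measurePreserving_rot t).comp (measurePreserving_sub_right volume u₀))).prod
    (measurePreserving_sub_right dS1 t)

lemma measurableEmbedding_rigidMotion (u₀ : ℂ) (t : S1) :
    MeasurableEmbedding (rigidMotion u₀ t) :=
  ((Homeomorph.addLeft u₀).measurableEmbedding.comp
    ((rotation (AddCircle.toCircle t)).toHomeomorph.measurableEmbedding.comp
      (Homeomorph.subRight u₀).measurableEmbedding)).prodMap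
    (Homeomorph.subRight t).measurableEmbedding

lemma filterArg_rigidMotion (u₀ : ℂ) (t : S1) (u : ℂ) (α : S1) (q : ℂ × S1) :
    filterArg (rotAround u₀ t u) (α - t) (rigidMotion u₀ t q) = filterArg u α q := by
  simp only [filterArg, rigidMotion, rotAround, add_sub_add_left_eq_sub, ← rot_sub, rot_rot,
    sub_add_cancel, sub_sub_sub_cancel_right]

lemma preact_Trho (W : Fin M' → Fin M → ℂ × S1 → ℝ) (u₀ : ℂ) (t : S1)
    (x : ℂ → S1 → Fin M' → ℝ) : preact W (Trho u₀ t x) = Trho u₀ t (preact W x) := by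
  funext u α k
  simp only [Trho, preact_eq_sum_integral_filterArg]
  refine Finset.sum_congr rfl fun c' _ => ?_
  simp_rw [← filterArg_rigidMotion u₀ t u α]
  exact (measurePreserving_rigidMotion u₀ t).integral_comp (measurableEmbedding_rigidMotion u₀ t)
    fun q => x q.1 q.2 c' * W c' k (filterArg (rotAround u₀ t u) (α - t) q)

lemma featureNorm_Trho (Ω : Set ℂ) (u₀ : ℂ) (t : S1) (x : ℂ → S1 → Fin M → ℝ) :
    featureNorm Ω (Trho u₀ t x) = featureNorm Ω x := by
  have hinvariant : ∀ c, ∫⁻ p : ℂ × S1, ‖Trho u₀ t x p.1 p.2 c‖ₑ ^ 2 ∂dPlaneS1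
      = ∫⁻ p : ℂ × S1, ‖x p.1 p.2 c‖ₑ ^ 2 ∂dPlaneS1 := fun c =>
    (measurePreserving_rigidMotion u₀ t).lintegral_comp_emb
      (measurableEmbedding_rigidMotion u₀ t) fun p => ‖x p.1 p.2 c‖ₑ ^ 2
  simp only [featureNorm, hinvariant]

end Rotation

/-! ### Networks -/

section Inputs

variable {Ω : Set ℂ} {M : ℕ} {x y : ℂ → Fin M → ℝ}

lemma inputNorm_congr (Ω : Set ℂ) (h : ∀ c, (fun u => x u c) =ᵐ[volume] fun u => y u c) :
    inputNorm Ω x = inputNorm Ω y := by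
  have hint : ∀ c, ∫⁻ u, ‖x u c‖ₑ ^ 2 = ∫⁻ u, ‖y u c‖ₑ ^ 2 := fun c =>
    lintegral_congr_ae ((h c).fun_comp fun r => ‖r‖ₑ ^ 2)
  simp only [inputNorm, hint]

lemma featureNorm_eq_inputNorm (Ω : Set ℂ) (hx : ∀ c, Measurable fun u => x u c) :
    featureNorm Ω (fun u _ c => x u c) = inputNorm Ω x := by
  have hint : ∀ c, ∫⁻ p : ℂ × S1, ‖x p.1 c‖ₑ ^ 2 ∂dPlaneS1 = ∫⁻ u, ‖x u c‖ₑ ^ 2 := fun c =>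
    (measurePreserving_fst (μ := (volume : Measure ℂ)) (ν := dS1)).lintegral_comp
      ((hx c).enorm.pow_const 2)
  simp only [inputNorm, featureNorm, hint]

lemma inputNorm_ne_top (hΩ : volume Ω ≠ 0) (hM : M ≠ 0)
    (hx : ∀ c, MemLp (fun u => x u c) 2 volume) : inputNorm Ω x ≠ ∞ := by
  refine ENNReal.rpow_ne_top_of_nonneg (by norm_num) (ENNReal.mul_ne_top (by simpa using hM) ?_)
  refine ENNReal.sum_ne_top.2 fun c _ => ENNReal.mul_ne_top (by simpa using hΩ) ?_
  rw [← eLpNorm_two_sq]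
  exact ENNReal.pow_ne_top (hx c).eLpNorm_ne_top

end Inputs

lemma layerBound_of_boundOf_le {c : ℝ} {M' M : ℕ} (hM' : 0 < M') {w : Fin M' → Fin M → ℝ≥0∞}
    (hw : boundOf w ≤ 1) {W : Fin M' → Fin M → ℂ × S1 → ℝ}
    (hW : ∀ c' k, FilterBound c (ENNReal.ofReal π * w c' k) (W c' k)) :
    LayerBound c (fun c' k => ENNReal.ofReal π * w c' k) W := by
  refine ⟨⟨hM', fun k => ?_, fun c' => ?_⟩, hW⟩
  · rw [← Finset.mul_sum]
    refine (mul_le_mul_right ?_ _).trans hw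
    exact (le_iSup (fun k => ∑ c', w c' k) k).trans (le_max_left _ _)
  · rw [← Finset.mul_sum, mul_left_comm]
    refine (mul_le_mul_right ?_ _).trans hw
    exact (le_iSup (fun c' => (M' : ℝ≥0∞) / M * ∑ k, w c' k) c').trans (le_max_right _ _)

namespace Net

variable (N : Net)

/-- The filters of the layer `l + 1`, as functions on `ℝ² × S¹` (the filters of the first layer
do not depend on the angle). -/
def filter : (l : ℕ) → Fin (N.M l) → Fin (N.M (l + 1)) → ℂ × S1 → ℝ
  | 0 => fun c' c p => N.W₁ c' c p.1
  | n + 1 => N.W n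

lemma output_succ (x : ℂ → Fin (N.M 0) → ℝ) (l : ℕ) :
    N.output x (l + 1) = layer N.σ (N.filter l) (N.b (l + 1)) (N.output x l) := by
  cases l with
  | zero =>
    have hplanar : ∀ u α c' c, ∫ v : ℂ, x (u + v) c' * N.W₁ c' c (rot α v)
        = ∫ p : ℂ × S1, x (u + p.1) c' * N.W₁ c' c (rot α p.1) ∂dPlaneS1 := fun u α c' c => by
      simp [integral_fun_fst (μ := (volume : Measure ℂ)) (ν := dS1)
        fun v => x (u + v) c' * N.W₁ c' c (rot α v)]
    funext u α c
    simp only [output, firstLayer, layer, preact, filter, hplanar]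
  | succ n => rfl

lemma output_succ_of_ae_eq {l : ℕ} {W : Fin (N.M l) → Fin (N.M (l + 1)) → ℂ × S1 → ℝ}
    (hW : ∀ c' c, W c' c =ᵐ[dPlaneS1] N.filter l c' c) (x : ℂ → Fin (N.M 0) → ℝ) :
    N.output x (l + 1) = layer N.σ W (N.b (l + 1)) (N.output x l) := by
  rw [output_succ]
  unfold layer
  rw [preact_congr_filter hW]

lemma exists_layerBound {l : ℕ} (hA : N.A (l + 1) ≤ 1) :
    ∃ W A, LayerBound ((2 : ℝ) ^ (-N.j (l + 1))) A W
      ∧ ∀ x, N.output x (l + 1) = layer N.σ W (N.b (l + 1)) (N.output x l) := by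
  cases l with
  | zero =>
    choose W hae hbound using fun c' c =>
      exists_filterBound_planar (N.j 1) (N.a₁ c' c) (N.W₁_eq c' c)
    exact ⟨W, _, layerBound_of_boundOf_le (N.M_pos 0) hA hbound, N.output_succ_of_ae_eq hae⟩
  | succ n =>
    choose W hae hbound using fun c' c =>
      exists_filterBound_joint (N.j (n + 2)) (N.a n c' c) (N.W_eq n c' c)
    exact ⟨W, _, layerBound_of_boundOf_le (N.M_pos _) hA hbound, N.output_succ_of_ae_eq hae⟩

lemma output_congr {x y : ℂ → Fin (N.M 0) → ℝ}
    (h : ∀ c, (fun u => x u c) =ᵐ[volume] fun u => y u c) (l : ℕ) :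
    N.output x (l + 1) = N.output y (l + 1) := by
  induction l with
  | zero =>
    rw [output_succ, output_succ]
    unfold layer
    rw [preact_congr_input (N.filter 0) (x := N.output x 0) (y := N.output y 0) fun c' =>
      Measure.quasiMeasurePreserving_fst.ae (h c')]
  | succ n ih => rw [output_succ, ih, ← output_succ]

lemma output_Drho (u₀ : ℂ) (t : S1) (x : ℂ → Fin (N.M 0) → ℝ) (l : ℕ) :
    N.output (Drho u₀ t x) l = Trho u₀ t (N.output x l) := by
  induction l with
  | zero => rfl
  | succ n ih =>
    rw [output_succ, output_succ, ih]
    unfold layer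
    rw [preact_Trho]
    rfl

end Net

/-! ### Stability under deformations -/

/-- A displacement field `τ` with `|∇τ|_∞ ≤ ε ≤ 1/5`, for which every `v ↦ v - s τ(v)` with
`s ∈ [0, 1]` is a bi-Lipschitz change of variables. -/
structure IsSmallDisplacement (ε : NNReal) (τ : ℂ → ℂ) : Prop where
  le_one_fifth : ε ≤ 1 / 5
  differentiable : Differentiable ℝ τ
  nnnorm_fderiv_le : ∀ u, ‖fderiv ℝ τ u‖₊ ≤ ε

lemma isSmallDisplacement_of_supGrad_le {τ : ℂ → ℂ} (hτ : Differentiable ℝ τ)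
    (hle : supGrad τ ≤ 1 / 5) : IsSmallDisplacement (supGrad τ).toNNReal τ where
  le_one_fifth := by
    rw [← ENNReal.coe_le_coe, ENNReal.coe_toNNReal (ne_top_of_le_ne_top (by simp) hle)]
    simpa using hle
  differentiable := hτ
  nnnorm_fderiv_le u := by
    rw [← ENNReal.coe_le_coe, ENNReal.coe_toNNReal (ne_top_of_le_ne_top (by simp) hle)]
    exact le_iSup (fun u => ‖fderiv ℝ τ u‖ₑ) u

namespace IsSmallDisplacement

variable {Ω : Set ℂ} {M' M : ℕ} {W : Fin M' → Fin M → ℂ × S1 → ℝ} {x y : ℂ → S1 → Fin M' → ℝ}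
  {κ : Fin M' → ℝ} {σ : ℝ → ℝ} {c : ℝ} {A : Fin M' → Fin M → ℝ≥0∞} {τ : ℂ → ℂ} {ε : NNReal}

lemma lt_one (hτ : IsSmallDisplacement ε τ) : ε < 1 := hτ.le_one_fifth.trans_lt (by norm_num)

lemma lipschitzWith (hτ : IsSmallDisplacement ε τ) : LipschitzWith ε τ :=
  lipschitzWith_of_nnnorm_fderiv_le hτ.differentiable hτ.nnnorm_fderiv_le

lemma antilipschitzWith_sub_smul (hτ : IsSmallDisplacement ε τ) {s : ℝ}
    (hs : s ∈ Set.Icc (0 : ℝ) 1) : AntilipschitzWith (5 / 4) fun v => v - s • τ v :=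
    fun v w => by
  have hconst : (1 - ε)⁻¹ ≤ 5 / 4 := by
    rw [inv_le_comm₀ (tsub_pos_of_lt hτ.lt_one) (by norm_num), le_tsub_iff_right hτ.lt_one.le]
    calc (5 / 4)⁻¹ + ε ≤ (5 / 4)⁻¹ + 1 / 5 := by gcongr; exact hτ.le_one_fifth
      _ = 1 := by norm_num
  refine (RotDCF.antilipschitzWith_sub_smul hτ.lt_one hτ.lipschitzWith hs v w).trans ?_
  gcongr

lemma antilipschitzWith_sub (hτ : IsSmallDisplacement ε τ) :
    AntilipschitzWith (5 / 4) fun v => v - τ v := by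
  simpa using hτ.antilipschitzWith_sub_smul (s := 1) (by simp)

lemma isAdmissible_deform (hτ : IsSmallDisplacement ε τ) (hx : IsAdmissible Ω κ x) :
    IsAdmissible Ω κ (deform τ x) :=
  hx.deform hτ.lipschitzWith.continuous hτ.antilipschitzWith_sub

lemma comp_sub_ae_eq (hτ : IsSmallDisplacement ε τ) {f g : ℂ → ℝ} (h : f =ᵐ[volume] g) :
    (fun u => f (u - τ u)) =ᵐ[volume] fun u => g (u - τ u) := by
  have hmeas : Measurable fun u => u - τ u :=
    measurable_id.sub hτ.lipschitzWith.continuous.measurable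
  have hquasi : Measure.QuasiMeasurePreserving (fun u => u - τ u) volume volume :=
    ⟨hmeas, Measure.absolutelyContinuous_of_le_smul
      (map_addHaar_le_of_antilipschitz volume hτ.antilipschitzWith_sub hmeas)⟩
  exact hquasi.ae h

lemma featureNorm_commutator_le (hτ : IsSmallDisplacement ε τ) (hW : LayerBound c A W)
    (hc : 0 < c) (hΩ : volume Ω ≠ ∞) (hσ : LipschitzWith 1 σ) (b : Fin M → ℝ)
    (hx : IsAdmissible Ω κ x) :
    featureNorm Ω (layer σ W b (deform τ x) - deform τ (layer σ W b x))
      ≤ 8 * ε * featureNorm Ω (x - fun _ _ => κ) := by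
  have hconst : (5 / 4 * ε + 11 / 5 * ε) * (5 / 4) ^ 3 ≤ 8 * ε := by
    rw [← NNReal.coe_le_coe]
    push_cast
    linarith [ε.coe_nonneg]
  refine (hW.featureNorm_commutator_le (K := 5 / 4) (η := (11 / 5 * ε : NNReal))
    (fun _ => hτ.antilipschitzWith_sub_smul) hc hΩ hσ b hx hτ.differentiable hτ.lt_one
    hτ.lipschitzWith fun u => ?_).trans ?_
  · exact (enorm_one_sub_jacobian_le hτ.le_one_fifth (hτ.nnnorm_fderiv_le u)).trans_eq
      (ENNReal.ofReal_coe_nnreal (p := 11 / 5 * ε))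
  · exact mul_le_mul_left (by exact_mod_cast hconst) _

lemma featureNorm_layer_sub_deform_le (hτ : IsSmallDisplacement ε τ) (hW : LayerBound c A W)
    (hc : 0 < c) (hΩ : volume Ω ≠ ∞) (hσ : LipschitzWith 1 σ) (b : Fin M → ℝ)
    (hx : IsAdmissible Ω κ x) (hy : IsAdmissible Ω κ y) :
    featureNorm Ω (layer σ W b y - deform τ (layer σ W b x))
      ≤ featureNorm Ω (y - deform τ x) + 8 * ε * featureNorm Ω (x - fun _ _ => κ) := by
  have hx_deform := hτ.isAdmissible_deform hx
  refine (featureNorm_sub_le Ω (hW.measurableFeature_layer hσ.continuous b hy.measurable)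
    (hW.measurableFeature_layer hσ.continuous b hx_deform.measurable)
    ((hW.measurableFeature_layer hσ.continuous b hx.measurable).deform
      hτ.lipschitzWith.continuous)).trans ?_
  exact add_le_add (hW.featureNorm_layer_sub_le hΩ hσ b hy hx_deform)
    (hτ.featureNorm_commutator_le hW hc hΩ hσ b hx)

lemma featureNorm_displacement_le (hτ : IsSmallDisplacement ε τ) (hW : LayerBound c A W)
    (hΩ : volume Ω ≠ ∞) (hσ : LipschitzWith 1 σ) (b : Fin M → ℝ) (hx : IsAdmissible Ω κ x) :
    featureNorm Ω (deform τ (layer σ W b x) - layer σ W b x)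
      ≤ 2 * ENNReal.ofReal c * supNorm τ * featureNorm Ω (x - fun _ _ => κ) := by
  have hconst : (5 / 4) ^ 2 ≤ (2 : NNReal) := by
    rw [← NNReal.coe_le_coe]
    norm_num
  refine (hW.featureNorm_displacement_le (K := 5 / 4) (δ := supNorm τ)
    (fun _ => hτ.antilipschitzWith_sub_smul) hΩ hσ b hx hτ.lipschitzWith.continuous
    (le_iSup fun u => ‖τ u‖ₑ)).trans ?_
  rw [mul_comm (supNorm τ), mul_right_comm _ (supNorm τ)]
  gcongr
  exact_mod_cast hconst

end IsSmallDisplacement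

namespace Net

variable (N : Net) {τ : ℂ → ℂ} {ε : NNReal} {Ω : Set ℂ} {x : ℂ → Fin (N.M 0) → ℝ}

/-- The error grows linearly in the depth because commuting `τ` past one layer costs `8 ε`, and
the layers above it do not amplify that cost. -/
lemma exists_isAdmissible_output (hσ : LipschitzWith 1 N.σ) (hτ : IsSmallDisplacement ε τ)
    (hΩ : volume Ω ≠ ∞) (hx : ∀ c, Measurable fun u => x u c) (hxΩ : inputNorm Ω x ≠ ∞) {l : ℕ}
    (hA : ∀ k < l, N.A (k + 1) ≤ 1) :
    ∃ κ, IsAdmissible Ω κ (N.output x l) ∧ IsAdmissible Ω κ (N.output (Dtau τ x) l)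
      ∧ featureNorm Ω (N.output x l - fun _ _ => κ) ≤ inputNorm Ω x
      ∧ featureNorm Ω (N.output (Dtau τ x) l - deform τ (N.output x l))
        ≤ l * (8 * ε) * inputNorm Ω x := by
  induction l with
  | zero =>
    have hzero : (N.output x 0 - fun _ _ => (0 : Fin (N.M 0) → ℝ)) = N.output x 0 := sub_zero _
    have hnorm : featureNorm Ω (N.output x 0 - fun _ _ => (0 : Fin (N.M 0) → ℝ))
        = inputNorm Ω x := by
      rw [hzero]
      exact featureNorm_eq_inputNorm Ω hx
    have hadm : IsAdmissible Ω 0 (N.output x 0) :=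
      ⟨fun c => (hx c).comp measurable_fst, hnorm.trans_ne hxΩ⟩
    have hDtau : N.output (Dtau τ x) 0 = deform τ (N.output x 0) := rfl
    refine ⟨0, hadm, hτ.isAdmissible_deform hadm, hnorm.le, ?_⟩
    rw [hDtau, sub_self, featureNorm_zero]
    exact zero_le
  | succ n ih =>
    obtain ⟨κ, hadm, hadm_Dtau, hle, hcomm⟩ := ih fun k hk => hA k (hk.trans n.lt_succ_self)
    obtain ⟨W, A, hW, hout⟩ := N.exists_layerBound (hA n n.lt_succ_self)
    rw [hout, hout]
    refine ⟨_, hW.isAdmissible_layer hΩ hσ _ hadm, hW.isAdmissible_layer hΩ hσ _ hadm_Dtau,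
      (hW.featureNorm_layer_sub_const_le hΩ hσ _ hadm).trans hle, ?_⟩
    calc _ ≤ n * (8 * ε) * inputNorm Ω x + 8 * ε * inputNorm Ω x :=
          (hτ.featureNorm_layer_sub_deform_le hW (by positivity) hΩ hσ _ hadm hadm_Dtau).trans
            (by gcongr)
      _ = (n + 1 : ℕ) * (8 * ε) * inputNorm Ω x := by
          push_cast
          ring

lemma featureNorm_output_Dtau_sub_le_of_measurable (hσ : LipschitzWith 1 N.σ)
    (hτ : IsSmallDisplacement ε τ) (hΩ : volume Ω ≠ ∞) (hx : ∀ c, Measurable fun u => x u c)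
    (hxΩ : inputNorm Ω x ≠ ∞) {l : ℕ} (hA : ∀ k < l + 1, N.A (k + 1) ≤ 1) :
    featureNorm Ω (N.output (Dtau τ x) (l + 1) - N.output x (l + 1))
      ≤ (2 * 4 * (l + 1 : ℕ) * ε
          + 2 * ENNReal.ofReal ((2 : ℝ) ^ (-N.j (l + 1))) * supNorm τ) * inputNorm Ω x := by
  obtain ⟨κ, hadm, -, hle, -⟩ :=
    N.exists_isAdmissible_output hσ hτ hΩ hx hxΩ fun k hk => hA k (hk.trans l.lt_succ_self)
  obtain ⟨κ', hadm', hadm_Dtau, -, hcomm⟩ := N.exists_isAdmissible_output hσ hτ hΩ hx hxΩ hA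
  obtain ⟨W, A, hW, hout⟩ := N.exists_layerBound (hA l l.lt_succ_self)
  have hdisp : featureNorm Ω (deform τ (N.output x (l + 1)) - N.output x (l + 1))
      ≤ 2 * ENNReal.ofReal ((2 : ℝ) ^ (-N.j (l + 1))) * supNorm τ * inputNorm Ω x := by
    rw [hout]
    exact (hτ.featureNorm_displacement_le hW hΩ hσ _ hadm).trans (by gcongr)
  calc _ ≤ _ := featureNorm_sub_le Ω hadm_Dtau.measurable
        (hadm'.measurable.deform hτ.lipschitzWith.continuous) hadm'.measurable
    _ ≤ _ := add_le_add hcomm hdisp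
    _ = _ := by ring

lemma featureNorm_output_Dtau_sub_le (hσ : LipschitzWith 1 N.σ) (hτ : IsSmallDisplacement ε τ)
    (hΩ₀ : volume Ω ≠ 0) (hΩ : volume Ω ≠ ∞) (hx : ∀ c, MemLp (fun u => x u c) 2 volume) {l : ℕ}
    (hA : ∀ k < l + 1, N.A (k + 1) ≤ 1) :
    featureNorm Ω (N.output (Dtau τ x) (l + 1) - N.output x (l + 1))
      ≤ (2 * 4 * (l + 1 : ℕ) * ε
          + 2 * ENNReal.ofReal ((2 : ℝ) ^ (-N.j (l + 1))) * supNorm τ) * inputNorm Ω x := by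
  obtain ⟨y, hy, hxy⟩ : ∃ y : ℂ → Fin (N.M 0) → ℝ, (∀ c, Measurable fun u => y u c)
      ∧ ∀ c, (fun u => x u c) =ᵐ[volume] fun u => y u c :=
    ⟨fun u c => (hx c).1.mk (fun u => x u c) u,
      fun c => (hx c).1.stronglyMeasurable_mk.measurable, fun c => (hx c).1.ae_eq_mk⟩
  have hDtau : N.output (Dtau τ x) (l + 1) = N.output (Dtau τ y) (l + 1) :=
    N.output_congr (fun c => hτ.comp_sub_ae_eq (hxy c)) l
  have hyΩ : inputNorm Ω y ≠ ∞ :=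
    inputNorm_congr Ω hxy ▸ inputNorm_ne_top hΩ₀ (N.M_pos 0).ne' hx
  rw [hDtau, N.output_congr hxy, inputNorm_congr Ω hxy]
  exact N.featureNorm_output_Dtau_sub_le_of_measurable hσ hτ hΩ hy hyΩ hA

end Net

end

end RotDCF

theorem theorem3p2_general (N : RotDCF.Net) (L : ℕ) (hL : 1 ≤ L)
    (hA1 : LipschitzWith 1 N.σ)
    (hA2 : ∀ l, 1 ≤ l → l ≤ L → N.A l ≤ 1)
    (τ : ℂ → ℂ) (hτ : Differentiable ℝ τ)
    (hA3 : RotDCF.supGrad τ ≤ 1 / 5)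
    (u₀ : ℂ) (t : RotDCF.S1)
    (Ω : Set ℂ) (hΩ0 : 0 < volume Ω) (hΩ : volume Ω < ∞)
    (x : ℂ → Fin (N.M 0) → ℝ) (hx : ∀ c, MemLp (fun u => x u c) 2 volume) :
    RotDCF.featureNorm Ω
        (N.output (RotDCF.Drho u₀ t (RotDCF.Dtau τ x)) L - RotDCF.Trho u₀ t (N.output x L))
      ≤ (2 * 4 * (L : ℝ≥0∞) * RotDCF.supGrad τ
          + 2 * ENNReal.ofReal ((2 : ℝ) ^ (-N.j L)) * RotDCF.supNorm τ)
        * RotDCF.inputNorm Ω x := by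
  obtain ⟨l, rfl⟩ := Nat.exists_eq_add_of_le' hL
  have hsmall := RotDCF.isSmallDisplacement_of_supGrad_le hτ hA3
  have hequivariant : N.output (RotDCF.Drho u₀ t (RotDCF.Dtau τ x)) (l + 1)
      - RotDCF.Trho u₀ t (N.output x (l + 1))
      = RotDCF.Trho u₀ t (N.output (RotDCF.Dtau τ x) (l + 1) - N.output x (l + 1)) := by
    rw [N.output_Drho]
    rfl
  have hstable := N.featureNorm_output_Dtau_sub_le hA1 hsmall hΩ0.ne' hΩ.ne hx
    fun k (hk : k < l + 1) => hA2 (k + 1) k.succ_pos hk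
  rw [ENNReal.coe_toNNReal (ne_top_of_le_ne_top (by simp) hA3)] at hstable
  rw [hequivariant, RotDCF.featureNorm_Trho]
  exact hstable

theorem theorem3p2 (N : RotDCF.Net) (L : ℕ) (hL : 1 ≤ L)
    (hA1 : LipschitzWith 1 N.σ)
    (hA2 : ∀ l, 1 ≤ l → l ≤ L → N.A l ≤ 1)
    (τ : ℂ → ℂ) (hτ : ContDiff ℝ 2 τ)
    (hA3 : RotDCF.supGrad τ < 1 / 5)
    (u₀ : ℂ) (t : RotDCF.S1)
    (Ω : Set ℂ) (hΩ0 : 0 < volume Ω) (hΩ : volume Ω < ∞)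
    (x : ℂ → Fin (N.M 0) → ℝ) (hx : ∀ c, MemLp (fun u => x u c) 2 volume) :
    RotDCF.featureNorm Ω
        (N.output (RotDCF.Drho u₀ t (RotDCF.Dtau τ x)) L - RotDCF.Trho u₀ t (N.output x L))
      ≤ (2 * 4 * (L : ℝ≥0∞) * RotDCF.supGrad τ
          + 2 * ENNReal.ofReal ((2 : ℝ) ^ (-N.j L)) * RotDCF.supNorm τ)
        * RotDCF.inputNorm Ω x :=
  theorem3p2_general N L hL hA1 hA2 τ (hτ.differentiable two_ne_zero) hA3.le u₀ t Ω hΩ0 hΩ x hx
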